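/- \textbf{Definitions.} All alphabets and state sets are finite. A \emph{layered automaton} $\mathcal A$ over an alphabet $\Sigma$ consists of transition systems $\mathcal T_1,\dots,\mathcal T_d$ ($d\ge 1$) with pairwise disjoint state sets $Q_1,\dots,Q_d$ and partial transition functions $\delta_x\colon Q_x\times\Sigma\rightharpoonup Q_x$, together with maps $\mu_x\colon Q_{x+1}\to Q_x$ ($1\le x<d$) such that $\delta_{x+1}(q,a)=q'$ implies $\delta_x(\mu_x(q),a)=\mu_x(q')$; moreover $\delta_1$ is total and all states of $Q_1$ are reachable from a distinguished state $q_{\mathsf{init}}\in Q_1$. We write $p\xrightarrow{u}_x q$ for paths in $\mathcal T_x$. The \emph{layer} of $q\in Q_x$ is $x$; for $q$ on a layer $\ge x$, $\hat\mu_x(q)\in Q_x$ is its \emph{ancestor} on layer $x$, obtained by iterating the maps $\mu$ (each state is an ancestor of itself), and $p\sim_x q$ means $\hat\mu_x(p)=\hat\mu_x(q)$. A \emph{leaf state} is a state that is not in the image of any $\mu_x$. \emph{Language.} For a leaf state $q$ and a letter $a$ let $x(q,a)$ be the largest $x$ such that $\delta_x(\hat\mu_x(q),a)$ is defined. The alternating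 automaton $[\![\mathcal A]\!]$ has the leaf states as states, and for $x=x(q,a)$ a transition $q\xrightarrow{a:x}q'$ of priority $x$ for every leaf state $q'$ with $\delta_x(\hat\mu_x(q),a)=\hat\mu_x(q')$; the successor is chosen by Eve if $x$ is odd and by Adam if $x$ is even. A word $w\in\Sigma^\omega$ is in the language $L(q)$ of a leaf state $q$ if Eve has a winning strategy from $q$ in the game on $w$, where Eve wins a play if the least priority occurring infinitely often is even. For an arbitrary state $p$, $L(p)$ is the language of a leaf state that has $p$ as an ancestor, and $L(\mathcal A)=L(q_{\mathsf{init}})$ (for consistent automata, defined below, the choice of the leaf state is irrelevant). Two automata are \emph{equivalent} if they have the same language. \emph{Consistency.} For $q$ on a layer $\ge x$, $L_x(q)$ is the set of finite and infinite words labelling a path in $\mathcal T_x$ from $\hat\mu_x(q)$. A state $p\in Q_x$ \emph{strongly accepts} (for $x$ even), respectively \emph{strongly rejects} (for $x$ odd), $w\in\Sigma^\omega$ if $w\in L_x(p)$ and there are no decomposition $w=uw'$ and $p'\in Q_{x+1}$ with $p\xrightarrow{u}_x\mu_x(p')$ and $w'\in L_{x+1}(p')$. $\mathcal A$ is \emph{consistent}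 if there are no states $p\sim_1p'$ and $w\in\Sigma^\omega$ such that $p$ strongly accepts $w$ and $p'$ strongly rejects $w$. \emph{Normal, centralised, safe minimal.} $\mathcal A$ is \emph{normal} if for all $x\ge 2$ and $q\in Q_x$: (N1) if $q\xrightarrow{u}_xq'$ for some $u\in\Sigma^*$ then $q'\xrightarrow{v}_xq$ for some nonempty $v$; (N2) for every $p\in\mu_x^{-1}(q)$ some finite word is in $L_x(q)$ but not in $L_{x+1}(p)$. It is \emph{centralised} if for all $x\ge2$ and $p,q\in Q_x$ with $p\sim_{x-1}q$ and $L_x(p)\subseteq L_x(q)$, $p$ and $q$ are in the same strongly connected component of $\mathcal T_x$. It is \emph{safe minimal} if for all $x\ge1$ and $p,q\in Q_x$, $L(p)=L(q)$ and $L_y(p)=L_y(q)$ for all $1<y\le x$ imply $p=q$. \emph{Morphisms.} A \emph{morphism} $\varphi\colon\mathcal A\to\mathcal B$ is a map from the states of $\mathcal A$ to those of $\mathcal B$ that maps the initial state to the initial state, maps every transition $q\xrightarrow{a}q'$ of a layer to a transition $\varphi(q)\xrightarrow{a}\varphi(q')$ of the layer of $\varphi(q)$, and maps ancestors of $q$ to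 ancestors of $\varphi(q)$. It is \emph{strong} if moreover $\varphi(q)$ has no $a$-transition on its layer whenever $q$ has none on its layer. $\mathcal A'$ is a \emph{subautomaton} of $\mathcal A$ if there is an injective morphism $\mathcal A'\to\mathcal A$. \textbf{Theorem.} There is an algorithm which, given a consistent layered automaton $\mathcal A$ (over any alphabet), computes in time polynomial in the size of $\mathcal A$ (number of layers, letters and states) an equivalent consistent layered automaton $\mathcal A_L$ over the same alphabet that is normal, centralised and safe minimal. Moreover, $\mathcal A$ contains a subautomaton (not necessarily consistent) that admits a surjective strong morphism to $\mathcal A_L$. In particular, $\mathcal A_L$ has no more states and no more leaf states than $\mathcal A$. -/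

import Mathlib

/-! ### Alternating parity automata that are simple by priorities -/

/-- A complete transition system over `α × ℕ` (the numbers are priorities) in which all
`a`-transitions leaving a given state carry the same priority. -/
structure SimpleParityAutomaton (α S : Type*) where
  trans : S → α → ℕ → S → Prop
  complete : ∀ s a, ∃ x s', trans s a x s'
  unique_priority : ∀ s a x y s₁ s₂, trans s a x s₁ → trans s a y s₂ → x = y

namespace SimpleParityAutomaton

variable {α S : Type*} (M : SimpleParityAutomaton α S)

/-- `ρ` is a run over the infinite word `w` from `s`, and `pr` is its sequence of priorities. -/
def IsRun (s : S) (w : ℕ → α) (ρ : ℕ → S) (pr : ℕ → ℕ) : Prop :=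
  ρ 0 = s ∧ ∀ i, M.trans (ρ i) (w i) (pr i) (ρ (i + 1))

/-- The min-parity condition: the limit inferior of the sequence exists and is even. -/
def Parity (pr : ℕ → ℕ) : Prop :=
  ∃ x, Even x ∧ (∃ᶠ i in Filter.atTop, pr i = x) ∧ ∀ᶠ i in Filter.atTop, x ≤ pr i

/-- A strategy for Eve in the game on `w`: given the list of the previous states and the current
state, it picks a legal successor whenever the priority of the current letter is odd. -/
def IsEveStrategy (w : ℕ → α) (σ : List S → S → S) : Prop :=
  ∀ (past : List S) (s : S) (x : ℕ), Odd x → (∃ s', M.trans s (w past.length) x s') →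
    M.trans s (w past.length) x (σ past s)

/-- The play `ρ`, with priorities `pr`, follows Eve's strategy `σ`. -/
def Follows (σ : List S → S → S) (ρ : ℕ → S) (pr : ℕ → ℕ) : Prop :=
  ∀ i, Odd (pr i) → ρ (i + 1) = σ ((List.range i).map ρ) (ρ i)

/-- The language of the state `s`: the words `w` such that Eve has a winning strategy in the
game on `w` that starts in `s`. -/
def language (s : S) : Set (ℕ → α) :=
  {w | ∃ σ, M.IsEveStrategy w σ ∧
    ∀ ρ pr, M.IsRun s w ρ pr → Follows σ ρ pr → Parity pr}

end SimpleParityAutomaton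

/-! ### Layered automata -/

/-- A layered automaton over the alphabet `α`. The carrier `Q` is the disjoint union of the sets
`Q_1, …, Q_d` of states of the layers `T_1, …, T_d`, and `layer q` is the index `x` with
`q ∈ Q_x`. The function `step` is the union of the partial transition functions of the layers,
and `parent` the union of the morphisms `μ_x : T_{x+1} → T_x`. By convention (irrelevant
elsewhere), `parent` is the identity on layer `1`. -/
structure LayeredAutomaton (α Q : Type*) where
  d : ℕ
  layer : Q → ℕ
  one_le_layer : ∀ q, 1 ≤ layer q
  layer_le : ∀ q, layer q ≤ d
  step : Q → α → Option Q
  step_layer : ∀ q a q', step q a = some q' → layer q' = layer q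
  parent : Q → Q
  parent_root : ∀ q, layer q = 1 → parent q = q
  parent_layer : ∀ q, 1 < layer q → layer (parent q) + 1 = layer q
  parent_step : ∀ q a q', 1 < layer q → step q a = some q' →
    step (parent q) a = some (parent q')
  complete_one : ∀ q a, layer q = 1 → (step q a).isSome
  init : Q
  init_layer : layer init = 1
  reachable_one : ∀ q, layer q = 1 →
    ∃ u : List α, u.foldl (fun o a => o.bind fun p => step p a) (some init) = some q

namespace LayeredAutomaton

variable {α Q Q' : Type*} (A : LayeredAutomaton α Q)

/-- The state reached from `q` by the finite word `u` (inside the layer of `q`), if any. -/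
def run (q : Q) (u : List α) : Option Q :=
  u.foldl (fun o a => o.bind fun p => A.step p a) (some q)

/-- The ancestor of `q` on layer `x`, for `x ≤ layer q`. -/
def anc (x : ℕ) (q : Q) : Q := A.parent^[A.layer q - x] q

/-- `p` is an ancestor of `q` (every state is an ancestor of itself). -/
def IsAncestor (p q : Q) : Prop := A.layer p ≤ A.layer q ∧ A.anc (A.layer p) q = p

/-- `p` and `q` lie on layers `≥ x` and have the same ancestor on layer `x`. -/
def Sim (x : ℕ) (p q : Q) : Prop := x ≤ A.layer p ∧ x ≤ A.layer q ∧ A.anc x p = A.anc x q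

/-- A leaf state is one that is not in the image of any of the morphisms between the layers. -/
def IsLeaf (q : Q) : Prop := ¬ ∃ p, 1 < A.layer p ∧ A.parent p = q

/-- The biggest layer `x` on which the ancestor of `q` has an `a`-transition. -/
def prio (q : Q) (a : α) : ℕ :=
  Nat.findGreatest (fun x => 1 ≤ x ∧ (A.step (A.anc x q) a).isSome = true) (A.layer q)

theorem layer_anc (q : Q) (x : ℕ) (h1 : 1 ≤ x) (hx : x ≤ A.layer q) :
    A.layer (A.anc x q) = x := by
  have key : ∀ (n : ℕ) (q : Q), n < A.layer q → A.layer (A.parent^[n] q) = A.layer q - n := by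
    intro n
    induction n with
    | zero => intro q _; simp
    | succ n ih =>
      intro q hq
      have h := A.parent_layer q (by omega)
      rw [Function.iterate_succ_apply, ih _ (by omega)]
      omega
  unfold anc
  rw [key _ _ (by omega)]
  omega

theorem anc_parent (q : Q) (x : ℕ) (h1 : 1 ≤ x) (hx : x < A.layer q) :
    A.anc x (A.parent q) = A.anc x q := by
  have h := A.parent_layer q (by omega)
  unfold anc
  rw [show A.layer q - x = (A.layer (A.parent q) - x) + 1 by omega,
    Function.iterate_succ_apply]

theorem exists_leaf (q : Q) : ∃ l, A.IsLeaf l ∧ A.IsAncestor q l := by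
  have key : ∀ (n : ℕ) (q : Q), A.d - A.layer q ≤ n →
      ∃ l, A.IsLeaf l ∧ A.IsAncestor q l := by
    intro n
    induction n with
    | zero =>
      intro q hq
      refine ⟨q, ?_, le_rfl, by simp [anc]⟩
      rintro ⟨p, hp, rfl⟩
      have h1 := A.parent_layer p hp
      have h2 := A.layer_le p
      omega
    | succ n ih =>
      intro q hq
      by_cases hl : A.IsLeaf q
      · exact ⟨q, hl, le_rfl, by simp [anc]⟩
      · obtain ⟨p, hp, rfl⟩ := not_not.1 hl
        have h1 := A.parent_layer p hp
        have h2 := A.layer_le p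
        have h3 := A.one_le_layer (A.parent p)
        obtain ⟨l, hll, hle, hanc⟩ := ih p (by omega)
        refine ⟨l, hll, by omega, ?_⟩
        have h4 : A.anc (A.layer (A.parent p)) l
            = A.parent (A.anc (A.layer p) l) := by
          unfold anc
          rw [← Function.iterate_succ_apply' A.parent]
          congr 1
          omega
        rw [h4, hanc]
  exact key _ q le_rfl

theorem prio_spec (q : Q) (a : α) :
    (1 ≤ A.prio q a ∧ (A.step (A.anc (A.prio q a) q) a).isSome = true) ∧
      A.prio q a ≤ A.layer q := by
  refine ⟨?_, Nat.findGreatest_le _⟩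
  have h1 := A.one_le_layer q
  exact Nat.findGreatest_spec
    (P := fun x => 1 ≤ x ∧ (A.step (A.anc x q) a).isSome = true) h1
    ⟨le_rfl, A.complete_one _ a (A.layer_anc q 1 le_rfl h1)⟩

/-- The semantics automaton, up to the choice of the initial state. Its states are the leaf
states; `q` has `a`-transitions, all of priority `x = prio q a`, to exactly those leaf states
whose ancestor on layer `x` is the `a`-successor of the ancestor of `q` on layer `x`. -/
def sem : SimpleParityAutomaton α {q : Q // A.IsLeaf q} where
  trans q a x q' := x = A.prio q.1 a ∧ x ≤ A.layer q'.1 ∧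
    A.step (A.anc x q.1) a = some (A.anc x q'.1)
  complete := by
    rintro ⟨q, _⟩ a
    obtain ⟨⟨h1, h2⟩, h3⟩ := A.prio_spec q a
    obtain ⟨p, hp⟩ := Option.isSome_iff_exists.1 h2
    obtain ⟨l, hl, hle, hanc⟩ := A.exists_leaf p
    have hlay : A.layer p = A.prio q a := by
      rw [A.step_layer _ _ _ hp, A.layer_anc q _ h1 h3]
    rw [hlay] at hle hanc
    exact ⟨A.prio q a, ⟨l, hl⟩, rfl, hle, by rw [hp, hanc]⟩
  unique_priority := by
    rintro s a x y s₁ s₂ ⟨rfl, -⟩ ⟨rfl, -⟩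
    rfl

/-- The language of a state `p`: the language of a leaf state below `p` in the semantics
automaton. (For consistent automata it does not matter which leaf state is taken.) -/
def lang (p : Q) : Set (ℕ → α) :=
  {w | ∃ l : {q : Q // A.IsLeaf q}, A.IsAncestor p l.1 ∧ w ∈ A.sem.language l}

/-- Two layered automata are equivalent: their semantics automata recognise the same language.
The initial state of a semantics automaton may be any leaf state below the initial state of the
first layer; equality is demanded for all choices. -/
def Equivalent (B : LayeredAutomaton α Q') : Prop :=
  ∀ (l : {q : Q // A.IsLeaf q}) (m : {q : Q' // B.IsLeaf q}),
    A.IsAncestor A.init l.1 → B.IsAncestor B.init m.1 →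
      A.sem.language l = B.sem.language m

/-! ### Safe languages, strong acceptance, consistency -/

/-- The `x`-safe language of `q` (for `x ≤ layer q`): the finite and the infinite words that
label a path of layer `x` from the ancestor of `q` on that layer. -/
def safe (x : ℕ) (q : Q) : Set (List α ⊕ (ℕ → α)) :=
  {v | match v with
    | Sum.inl u => ∃ q', A.run (A.anc x q) u = some q'
    | Sum.inr w => ∃ ρ : ℕ → Q, ρ 0 = A.anc x q ∧ ∀ i, A.step (ρ i) (w i) = some (ρ (i + 1))}

/-- The infinite word `w` is safe from `p` on the layer `x` of `p`, and no suffix of `w` is safe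
on layer `x + 1` from a child of the state that the corresponding prefix leads to from `p`. -/
def StronglySafe (p : Q) (w : ℕ → α) : Prop :=
  Sum.inr w ∈ A.safe (A.layer p) p ∧
    ∀ i, ¬ ∃ p', A.layer p' = A.layer p + 1 ∧
      A.run p ((List.range i).map w) = some (A.anc (A.layer p) p') ∧
      Sum.inr (fun j => w (i + j)) ∈ A.safe (A.layer p + 1) p'

def StronglyAccepts (p : Q) (w : ℕ → α) : Prop := Even (A.layer p) ∧ A.StronglySafe p w

def StronglyRejects (p : Q) (w : ℕ → α) : Prop := Odd (A.layer p) ∧ A.StronglySafe p w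

def Consistent : Prop :=
  ¬ ∃ (p p' : Q) (w : ℕ → α), A.Sim 1 p p' ∧ A.StronglyAccepts p w ∧ A.StronglyRejects p' w

/-! ### Normal, centralised and safe minimal automata -/

structure Normal : Prop where
  n1 : ∀ q q', 2 ≤ A.layer q → (∃ u : List α, A.run q u = some q') →
    ∃ v : List α, v ≠ [] ∧ A.run q' v = some q
  n2 : ∀ q p, 2 ≤ A.layer q → A.layer p = A.layer q + 1 → A.parent p = q →
    ∃ u : List α, (∃ q', A.run q u = some q') ∧ A.run p u = none

/-- `p` and `q` are in the same strongly connected component (of the layer they lie on). -/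
def SameSCC (p q : Q) : Prop :=
  (∃ u : List α, A.run p u = some q) ∧ ∃ v : List α, A.run q v = some p

def Centralised : Prop :=
  ∀ x p q, 2 ≤ x → A.layer p = x → A.layer q = x →
    A.Sim (x - 1) p q → A.safe x p ⊆ A.safe x q → A.SameSCC p q

/-- The relations `≈_x`, for `x ≥ 1` (the value at `0` is not used), on states of layers `≥ x`. -/
def SafeEquiv : ℕ → Q → Q → Prop
  | 0, p, q => A.lang p = A.lang q
  | 1, p, q => A.lang p = A.lang q
  | x + 2, p, q => SafeEquiv (x + 1) p q ∧ A.safe (x + 2) p = A.safe (x + 2) q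

def SafeMinimal : Prop :=
  ∀ x p q, 1 ≤ x → A.layer p = x → A.layer q = x → A.SafeEquiv x p q → p = q

/-! ### Morphisms and subautomata -/

structure IsMorphism (B : LayeredAutomaton α Q') (φ : Q → Q') : Prop where
  map_init : φ A.init = B.init
  map_step : ∀ q a q', A.step q a = some q' → B.step (φ q) a = some (φ q')
  map_ancestor : ∀ p q, A.IsAncestor p q → B.IsAncestor (φ p) (φ q)

structure IsStrongMorphism (B : LayeredAutomaton α Q') (φ : Q → Q') : Prop
    extends A.IsMorphism B φ where
  map_none : ∀ q a, A.step q a = none → B.step (φ q) a = none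

/-- `A` is a subautomaton of `B`. -/
def IsSubautomaton (B : LayeredAutomaton α Q') : Prop :=
  ∃ φ : Q → Q', Function.Injective φ ∧ A.IsMorphism B φ

noncomputable def numLeaves : ℕ := Nat.card {q : Q // A.IsLeaf q}

/-! ### Layered automata as inputs and outputs of programs -/

/-- A layered automaton with states `0, …, n - 1` and letters `0, …, k - 1`, written as a list of
numbers: the numbers of layers, letters and states, the initial state, the layers of the states,
the parents of the states and, state by state, the transition table, in which `0` stands for an
undefined transition and `q + 1` for a transition to `q`. -/
def code {k n : ℕ} (A : LayeredAutomaton (Fin k) (Fin n)) : List ℕ :=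
  [A.d, k, n, (A.init : ℕ)]
    ++ List.ofFn (fun q => A.layer q)
    ++ List.ofFn (fun q => (A.parent q : ℕ))
    ++ (List.ofFn fun q => List.ofFn fun a =>
        match A.step q a with
        | none => 0
        | some q' => (q' : ℕ) + 1).flatten

/-- The size of an automaton: the number of layers, plus letters, plus states. -/
def size {k n : ℕ} (A : LayeredAutomaton (Fin k) (Fin n)) : ℕ := A.d + k + n

end LayeredAutomaton

/-! ### Random access machines -/

namespace RAM

/-- Structured programs of a random access machine with registers `0, 1, 2, …` and memory
arrays `0, 1, 2, …` with indirect addressing, all over `ℕ`. A given program mentions only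
finitely many registers and arrays. The only arithmetic is addition and truncated subtraction. -/
inductive Prog
  | const (r c : ℕ)
  | copy (r s : ℕ)
  | add (r s t : ℕ)
  | sub (r s t : ℕ)
  | load (r a i : ℕ)
  | store (a i r : ℕ)
  | seq (P₁ P₂ : Prog)
  | branch (r : ℕ) (P₁ P₂ : Prog)
  | loop (r : ℕ) (P : Prog)

structure State where
  reg : ℕ → ℕ
  arr : ℕ → ℕ → ℕ

def State.setReg (s : State) (r v : ℕ) : State :=
  ⟨Function.update s.reg r v, s.arr⟩

def State.setArr (s : State) (a i v : ℕ) : State :=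
  ⟨s.reg, Function.update s.arr a (Function.update (s.arr a) i v)⟩

/-- `Run P s t s'`: the program `P`, started in the state `s`, halts after exactly `t` steps, in
the state `s'`. Every basic instruction and every evaluation of a test (is register `r`
nonzero?) takes one step. -/
inductive Run : Prog → State → ℕ → State → Prop
  | const (r c : ℕ) (s : State) : Run (.const r c) s 1 (s.setReg r c)
  | copy (r r₁ : ℕ) (s : State) : Run (.copy r r₁) s 1 (s.setReg r (s.reg r₁))
  | add (r r₁ r₂ : ℕ) (s : State) :
      Run (.add r r₁ r₂) s 1 (s.setReg r (s.reg r₁ + s.reg r₂))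
  | sub (r r₁ r₂ : ℕ) (s : State) :
      Run (.sub r r₁ r₂) s 1 (s.setReg r (s.reg r₁ - s.reg r₂))
  | load (r a i : ℕ) (s : State) : Run (.load r a i) s 1 (s.setReg r (s.arr a (s.reg i)))
  | store (a i r : ℕ) (s : State) : Run (.store a i r) s 1 (s.setArr a (s.reg i) (s.reg r))
  | seq {P₁ P₂ : Prog} {s s₁ s₂ : State} {t₁ t₂ : ℕ} :
      Run P₁ s t₁ s₁ → Run P₂ s₁ t₂ s₂ → Run (.seq P₁ P₂) s (t₁ + t₂) s₂
  | branch_pos {r : ℕ} {P₁ P₂ : Prog} {s s₁ : State} {t : ℕ} :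
      s.reg r ≠ 0 → Run P₁ s t s₁ → Run (.branch r P₁ P₂) s (t + 1) s₁
  | branch_zero {r : ℕ} {P₁ P₂ : Prog} {s s₁ : State} {t : ℕ} :
      s.reg r = 0 → Run P₂ s t s₁ → Run (.branch r P₁ P₂) s (t + 1) s₁
  | loop_zero {r : ℕ} {P : Prog} {s : State} :
      s.reg r = 0 → Run (.loop r P) s 1 s
  | loop_pos {r : ℕ} {P : Prog} {s s₁ s₂ : State} {t₁ t₂ : ℕ} :
      s.reg r ≠ 0 → Run P s t₁ s₁ → Run (.loop r P) s₁ t₂ s₂ →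
        Run (.loop r P) s (t₁ + t₂ + 1) s₂

/-- The initial state on the input `l`: the input is in array `0`, its length in register `0`,
and everything else is `0`. -/
def State.input (l : List ℕ) : State :=
  ⟨fun r => if r = 0 then l.length else 0, fun a i => if a = 0 then l.getD i 0 else 0⟩

/-- The output in the state `s`: array `1`, up to the length given in register `0`. -/
def State.output (s : State) : List ℕ := (List.range (s.reg 0)).map (s.arr 1)

/-- On the input `l`, the program `P` halts within `T` steps with the output `l'`. -/
def Outputs (P : Prog) (l l' : List ℕ) (T : ℕ) : Prop :=
  ∃ t s, t ≤ T ∧ Run P (State.input l) t s ∧ s.output = l'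

end RAM

/-!
The proof separates the semantics of a layered automaton, the minimisation procedure, and its
implementation with polynomial running time.

*Semantics.* The notion that is preserved is that of a certificate (`LayeredAutomaton.Cert`,
`PLA.Cert`): a family of sets of words, one for each state of the first layer, that is compatible
with the transitions of the first layer and decides membership of each word that is strongly
accepted or rejected from some state by the parity of the layer of that state. Every word is
eventually strongly accepted or rejected from some state above its run, since the number of layers
is finite; so a certificate is unique, and an automaton is consistent if and only if it has one
(`LayeredAutomaton.Consistent.exists_cert`, `LayeredAutomaton.Cert.consistent`). The certificate
consists of the languages of the alternating automaton: each of the two players has the positional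
strategy of moving to a leaf state above a child on which the rest of the word is live, if there is
one (`LayeredAutomaton.Cert.language_eq`). Games are not needed beyond this point.

*The procedure.* Automata are encoded on the natural numbers (`PLA`), so that deleting and moving
states does not change the type. `PLA.trim` deletes the transitions above the first layer that do
not lie on cycles, so that all components become strongly connected. `PLA.langQuot` identifies
states of the first layer with the same language. Then the following three steps are iterated.
`PLA.collapse` removes a violation of the second condition of normality: if a child of `p` is safe
for the same words as `p`, then the layer of `p` and the next one are deleted above the component
of `p`, and the layers above these are moved down by two, which keeps parities. `PLA.delete` removes
a violation of centralisation: the component of `p` is deleted if the safe language of `p` is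
contained in that of a state with the same parent in another component. `PLA.merge` identifies
siblings with the same safe language. Each step preserves the certificate and the fact that the
result is the image of a subautomaton of the input under a surjective strong morphism
(`PLA.SubQuot`). A round that removes no state has nothing to do, so as many rounds as there are
states suffice (`PLA.Reduct.stable_iterate`). When nothing is left to be done, the automaton is
normal, centralised and safe minimal (`PLA.Models.normal`, `PLA.Models.centralised`,
`PLA.Models.safeMinimal`), and the subautomaton bounds the numbers of states and of leaf states
(`PLA.SubQuot.exists_subautomaton`).

*Deciding the conditions.* Reachability, inclusion of safe languages and equality of languages are
least fixpoints of monotone operators on binary relations on the states. For the equality of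
languages, two states have different languages if and only if some word leads from them to states
below a pair of states on layers of different parity that have a common strong word
(`PLA.Valid.differ_iff`); the latter is a nested fixpoint (`PLA.NoClash`, `PLA.Kill`).

*Running time.* The procedure is written in a language `RAM.Stm` of loops bounded by a number `N`,
acting on arrays, whose expressions `RAM.Exp` have bounded sums. Programs in this language compile
to random access machines with a running time polynomial in `N` (`RAM.exists_outputs`), and least
fixpoints of operators on `N × N` tables are reached after `N ^ 2` iterations (`RAM.isTab_lfp`).
-/

/-! ### A language of bounded loops for the random access machine -/

namespace RAM

/-- Expressions over eight variables and the arrays of a memory. Loops run over the numbers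
below a fixed bound `N`, so that the evaluation time is a polynomial in `N` that depends on the
expression only. -/
inductive Exp
  | lit (c : ℕ)
  | var (i : Fin 8)
  | plus (e f : Exp)
  | minus (e f : Exp)
  | get (a : ℕ) (e : Exp)
  | ite (c e f : Exp)
  | sum (i : Fin 8) (e : Exp)
  | scale (e : Exp)

/-- The value of an expression: `sum i e` is the sum of `e` over all values `< N` of the
variable `i`, and `scale e` is `e * N`. -/
def Exp.eval (N : ℕ) (m : ℕ → ℕ → ℕ) : Exp → (Fin 8 → ℕ) → ℕ
  | .lit c, _ => c
  | .var i, ρ => ρ i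
  | .plus e f, ρ => e.eval N m ρ + f.eval N m ρ
  | .minus e f, ρ => e.eval N m ρ - f.eval N m ρ
  | .get a e, ρ => m a (e.eval N m ρ)
  | .ite c e f, ρ => if c.eval N m ρ ≠ 0 then e.eval N m ρ else f.eval N m ρ
  | .sum i e, ρ => ∑ x ∈ Finset.range N, e.eval N m (Function.update ρ i x)
  | .scale e, ρ => e.eval N m ρ * N

/-- The arrays of a machine state that the expressions can read. The array `1` of the machine,
like all odd ones, is not among them: it serves as scratch space and finally holds the output. -/
def State.tables (s : State) : ℕ → ℕ → ℕ := fun a => s.arr (2 * a)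

theorem State.tables_congr {s s' : State} (h : s.arr = s'.arr) : s.tables = s'.tables := by
  funext a
  simp [State.tables, h]

@[simp] theorem State.setReg_arr (s : State) (r v : ℕ) : (s.setReg r v).arr = s.arr := rfl
@[simp] theorem State.setReg_reg_self (s : State) (r v : ℕ) : (s.setReg r v).reg r = v := by
  simp [State.setReg]
theorem State.setReg_reg_ne (s : State) (r v i : ℕ) (h : i ≠ r) :
    (s.setReg r v).reg i = s.reg i := by
  simp [State.setReg, h]
theorem State.setReg_reg (s : State) (r v i : ℕ) :
    (s.setReg r v).reg i = if i = r then v else s.reg i := by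
  simp [State.setReg, Function.update_apply]
@[simp] theorem State.setArr_reg (s : State) (a i v : ℕ) : (s.setArr a i v).reg = s.reg := rfl

/-- Repeat `P` as often as register `0` says, with the counter in register `c`; register `o`
holds the constant `1`. -/
def Prog.times (c o : ℕ) (P : Prog) : Prog :=
  .seq (.copy c 0) (.seq (.const o 1) (.loop c (.seq P (.sub c c o))))

/-- The loop rule for `Prog.times`, with an invariant `I` indexed by the number of rounds. -/
theorem Prog.times_run {c o : ℕ} (hco : c ≠ o) {P : Prog} {T N : ℕ}
    (I : ℕ → State → Prop)
    (hset : ∀ x s v, I x s → I x (s.setReg c v))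
    (hstep : ∀ x s, x < N → I x s → s.reg o = 1 → ∃ t s', t ≤ T ∧ Run P s t s' ∧ I (x + 1) s' ∧
      s'.reg c = s.reg c ∧ s'.reg o = 1)
    (s : State) (hN : s.reg 0 = N) (h0 : I 0 ((s.setReg c N).setReg o 1)) :
    ∃ t s', t ≤ N * (T + 2) + 3 ∧ Run (Prog.times c o P) s t s' ∧ I N s' := by
  have key : ∀ (j x : ℕ) (s : State), x + j = N → I x s → s.reg o = 1 → s.reg c = j →
      ∃ t s', t ≤ j * (T + 2) + 1 ∧ Run (.loop c (.seq P (.sub c c o))) s t s' ∧ I N s' := by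
    intro j
    induction j with
    | zero =>
      intro x s hx hI _ hc
      obtain rfl : x = N := by omega
      exact ⟨1, s, by omega, Run.loop_zero hc, hI⟩
    | succ j ih =>
      intro x s hx hI ho hc
      obtain ⟨t, s', ht, hrun, hI', hc', ho'⟩ := hstep x s (by omega) hI ho
      obtain ⟨t₂, s₂, ht₂, hrun₂, hI₂⟩ := ih (x + 1) (s'.setReg c (s'.reg c - s'.reg o))
        (by omega) (hset _ _ _ hI') (by rw [State.setReg_reg_ne _ _ _ _ hco.symm, ho'])
        (by rw [State.setReg_reg_self, hc', ho', hc]; omega)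
      refine ⟨(t + 1) + t₂ + 1, s₂, ?_, Run.loop_pos (by omega) (Run.seq hrun (Run.sub c c o s'))
        hrun₂, hI₂⟩
      have : (j + 1) * (T + 2) = j * (T + 2) + (T + 2) := by ring
      omega
  obtain ⟨t, s', ht, hrun, hI⟩ := key N 0 ((s.setReg c N).setReg o 1) (by omega) h0
    (by simp) (by rw [State.setReg_reg_ne _ _ _ _ hco, State.setReg_reg_self])
  refine ⟨1 + (1 + t), s', by omega, ?_, hI⟩
  refine Run.seq (s₁ := s.setReg c N) ?_ (Run.seq (Run.const o 1 _) hrun)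
  rw [← hN]
  exact Run.copy c 0 s

/-- `P` computes the value of the expression `e` into register `r`, in time `T` and without
touching the arrays or the registers below `r`, from states that agree with `ρ` on the variables
(the variable `i` is held in register `i + 1`). -/
def Computes (P : Prog) (r : ℕ) (T : Polynomial ℕ) (e : Exp) : Prop :=
  ∀ (s : State) (ρ : Fin 8 → ℕ), (∀ i : Fin 8, s.reg (i + 1) = ρ i) →
    ∃ t s', t ≤ T.eval (s.reg 0) ∧ Run P s t s' ∧ s'.arr = s.arr ∧
      (∀ i < r, s'.reg i = s.reg i) ∧ s'.reg r = e.eval (s.reg 0) s.tables ρ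

open Polynomial in
/-- Every expression can be evaluated in polynomial time, in any register from `9` on, with the
registers above it as workspace. -/
theorem Exp.exists_computes (e : Exp) :
    ∀ r, 9 ≤ r → ∃ P T, Computes P r T e := by
  induction e with
  | lit c =>
    intro r hr
    refine ⟨.const r c, 1, fun s ρ hρ => ⟨1, _, by simp, Run.const r c s, rfl, ?_, by simp [eval]⟩⟩
    intro i hi
    rw [State.setReg_reg_ne _ _ _ _ (by omega)]
  | var v =>
    intro r hr
    refine ⟨.copy r (v + 1), 1, fun s ρ hρ => ⟨1, _, by simp, Run.copy r _ s, rfl, ?_, ?_⟩⟩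
    · intro i hi
      rw [State.setReg_reg_ne _ _ _ _ (by omega)]
    · simp [eval, hρ]
  | plus e f ihe ihf =>
    intro r hr
    obtain ⟨P₁, T₁, h₁⟩ := ihe r hr
    obtain ⟨P₂, T₂, h₂⟩ := ihf (r + 1) (by omega)
    refine ⟨.seq P₁ (.seq P₂ (.add r r (r + 1))), T₁ + T₂ + 1, fun s ρ hρ => ?_⟩
    obtain ⟨t₁, s₁, ht₁, hr₁, ha₁, hp₁, hv₁⟩ := h₁ s ρ hρ
    obtain ⟨t₂, s₂, ht₂, hr₂, ha₂, hp₂, hv₂⟩ := h₂ s₁ ρ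
      (fun i => by rw [hp₁ _ (by omega), hρ])
    have h0 : s₁.reg 0 = s.reg 0 := hp₁ 0 (by omega)
    refine ⟨t₁ + (t₂ + 1), _, ?_, Run.seq hr₁ (Run.seq hr₂ (Run.add r r (r + 1) s₂)), ?_, ?_, ?_⟩
    · rw [h0] at ht₂
      simp only [eval_add, eval_one]
      omega
    · simp [ha₁, ha₂]
    · intro i hi
      rw [State.setReg_reg_ne _ _ _ _ (by omega), hp₂ _ (by omega), hp₁ _ hi]
    · rw [State.setReg_reg_self, hv₂, hp₂ _ (by omega), hv₁]
      simp only [Exp.eval, State.tables_congr ha₁, h0]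
  | minus e f ihe ihf =>
    intro r hr
    obtain ⟨P₁, T₁, h₁⟩ := ihe r hr
    obtain ⟨P₂, T₂, h₂⟩ := ihf (r + 1) (by omega)
    refine ⟨.seq P₁ (.seq P₂ (.sub r r (r + 1))), T₁ + T₂ + 1, fun s ρ hρ => ?_⟩
    obtain ⟨t₁, s₁, ht₁, hr₁, ha₁, hp₁, hv₁⟩ := h₁ s ρ hρ
    obtain ⟨t₂, s₂, ht₂, hr₂, ha₂, hp₂, hv₂⟩ := h₂ s₁ ρ
      (fun i => by rw [hp₁ _ (by omega), hρ])
    have h0 : s₁.reg 0 = s.reg 0 := hp₁ 0 (by omega)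
    refine ⟨t₁ + (t₂ + 1), _, ?_, Run.seq hr₁ (Run.seq hr₂ (Run.sub r r (r + 1) s₂)), ?_, ?_, ?_⟩
    · rw [h0] at ht₂
      simp only [eval_add, eval_one]
      omega
    · simp [ha₁, ha₂]
    · intro i hi
      rw [State.setReg_reg_ne _ _ _ _ (by omega), hp₂ _ (by omega), hp₁ _ hi]
    · rw [State.setReg_reg_self, hv₂, hp₂ _ (by omega), hv₁]
      simp only [Exp.eval, State.tables_congr ha₁, h0]
  | get a e ih =>
    intro r hr
    obtain ⟨P₁, T₁, h₁⟩ := ih r hr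
    refine ⟨.seq P₁ (.load r (2 * a) r), T₁ + 1, fun s ρ hρ => ?_⟩
    obtain ⟨t₁, s₁, ht₁, hr₁, ha₁, hp₁, hv₁⟩ := h₁ s ρ hρ
    refine ⟨t₁ + 1, _, ?_, Run.seq hr₁ (Run.load r (2 * a) r s₁), by simp [ha₁], ?_, ?_⟩
    · simp only [eval_add, eval_one]
      omega
    · intro i hi
      rw [State.setReg_reg_ne _ _ _ _ (by omega), hp₁ _ hi]
    · rw [State.setReg_reg_self, hv₁, ha₁]
      simp [Exp.eval, State.tables]
  | ite c e f ihc ihe ihf =>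
    intro r hr
    obtain ⟨P₀, T₀, h₀⟩ := ihc r hr
    obtain ⟨P₁, T₁, h₁⟩ := ihe r hr
    obtain ⟨P₂, T₂, h₂⟩ := ihf r hr
    refine ⟨.seq P₀ (.branch r P₁ P₂), T₀ + T₁ + T₂ + 1, fun s ρ hρ => ?_⟩
    obtain ⟨t₀, s₀, ht₀, hr₀, ha₀, hp₀, hv₀⟩ := h₀ s ρ hρ
    have h0 : s₀.reg 0 = s.reg 0 := hp₀ 0 (by omega)
    have hρ' : ∀ i : Fin 8, s₀.reg (i + 1) = ρ i := fun i => by rw [hp₀ _ (by omega), hρ]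
    simp only [eval_add, eval_one]
    by_cases hc : c.eval (s.reg 0) s.tables ρ = 0
    · obtain ⟨t₂, s₂, ht₂, hr₂, ha₂, hp₂, hv₂⟩ := h₂ s₀ ρ hρ'
      refine ⟨t₀ + (t₂ + 1), s₂, ?_, Run.seq hr₀ (Run.branch_zero (by rw [hv₀, hc]) hr₂),
        by rw [ha₂, ha₀], fun i hi => by rw [hp₂ _ hi, hp₀ _ hi], ?_⟩
      · rw [h0] at ht₂
        omega
      · rw [hv₂]
        simp [Exp.eval, hc, h0, State.tables_congr ha₀]
    · obtain ⟨t₂, s₂, ht₂, hr₂, ha₂, hp₂, hv₂⟩ := h₁ s₀ ρ hρ'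
      refine ⟨t₀ + (t₂ + 1), s₂, ?_, Run.seq hr₀ (Run.branch_pos (by rw [hv₀]; exact hc) hr₂),
        by rw [ha₂, ha₀], fun i hi => by rw [hp₂ _ hi, hp₀ _ hi], ?_⟩
      · rw [h0] at ht₂
        omega
      · rw [hv₂]
        simp [Exp.eval, hc, h0, State.tables_congr ha₀]
  | sum v e ih =>
    intro r hr
    obtain ⟨P₁, T₁, h₁⟩ := ih (r + 4) (by omega)
    -- Register `r` accumulates the sum, `r + 1` saves the value of the bound variable, `r + 2` and
    -- `r + 3` belong to the loop, and the summands are computed in register `r + 4`.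
    refine ⟨.seq (.copy (r + 1) (v + 1)) (.seq (.const r 0) (.seq (.const (v + 1) 0)
      (.seq (Prog.times (r + 2) (r + 3)
        (.seq P₁ (.seq (.add r r (r + 4)) (.add (v + 1) (v + 1) (r + 3)))))
        (.copy (v + 1) (r + 1))))), X * (T₁ + 4) + 7, fun s ρ hρ => ?_⟩
    have hv : (v : ℕ) + 1 < 9 := by omega
    let I : ℕ → State → Prop := fun x s' => s'.arr = s.arr ∧
      (∀ i < r, i ≠ v + 1 → s'.reg i = s.reg i) ∧ s'.reg (v + 1) = x ∧ s'.reg (r + 1) = ρ v ∧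
      s'.reg r = ∑ y ∈ Finset.range x, e.eval (s.reg 0) s.tables (Function.update ρ v y)
    obtain ⟨t, s', ht, hrun, hI1, hI2, hI3, hI4, hI5⟩ := Prog.times_run (c := r + 2) (o := r + 3)
      (by omega) (P := .seq P₁ (.seq (.add r r (r + 4)) (.add (v + 1) (v + 1) (r + 3))))
      (T := T₁.eval (s.reg 0) + 2) (N := s.reg 0) I
      (by
        rintro x s' w ⟨h1, h2, h3, h4, h5⟩
        refine ⟨h1, fun i hi hi' => ?_, ?_, ?_, ?_⟩
        · rw [State.setReg_reg_ne _ _ _ _ (by omega), h2 i hi hi']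
        · rw [State.setReg_reg_ne _ _ _ _ (by omega), h3]
        · rw [State.setReg_reg_ne _ _ _ _ (by omega), h4]
        · rw [State.setReg_reg_ne _ _ _ _ (by omega), h5])
      (by
        rintro x s' hx ⟨h1, h2, h3, h4, h5⟩ ho
        obtain ⟨t₁, s₁, ht₁, hr₁, ha₁, hp₁, hv₁⟩ := h₁ s' (Function.update ρ v x) (by
          intro i
          by_cases hi : i = v
          · subst hi; simp [h3]
          · rw [Function.update_of_ne hi, h2 _ (by omega) (by simpa [Fin.val_inj] using hi), hρ])
        have h0 : s'.reg 0 = s.reg 0 := h2 0 (by omega) (by omega)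
        refine ⟨t₁ + (1 + 1), _, ?_, Run.seq hr₁ (Run.seq (Run.add r r (r + 4) s₁)
          (Run.add (v + 1) (v + 1) (r + 3) _)), ⟨by simp [ha₁, h1], ?_, ?_, ?_, ?_⟩, ?_, ?_⟩
        · rw [h0] at ht₁
          omega
        · intro i hi hi'
          rw [State.setReg_reg_ne _ _ _ _ hi', State.setReg_reg_ne _ _ _ _ (by omega),
            hp₁ _ (by omega), h2 i hi hi']
        · rw [State.setReg_reg_self, State.setReg_reg_ne _ _ _ _ (by omega),
            State.setReg_reg_ne _ _ _ _ (by omega), hp₁ _ (by omega), hp₁ _ (by omega), h3, ho]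
        · rw [State.setReg_reg_ne _ _ _ _ (by omega), State.setReg_reg_ne _ _ _ _ (by omega),
            hp₁ _ (by omega), h4]
        · rw [State.setReg_reg_ne _ _ _ _ (by omega), State.setReg_reg_self, hp₁ _ (by omega),
            h5, hv₁, Finset.sum_range_succ, h0, State.tables_congr h1]
        · rw [State.setReg_reg_ne _ _ _ _ (by omega), State.setReg_reg_ne _ _ _ _ (by omega),
            hp₁ _ (by omega)]
        · rw [State.setReg_reg_ne _ _ _ _ (by omega), State.setReg_reg_ne _ _ _ _ (by omega),
            hp₁ _ (by omega), ho])
      (((s.setReg (r + 1) (s.reg (v + 1))).setReg r 0).setReg (v + 1) 0)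
      (by
        rw [State.setReg_reg_ne _ _ _ _ (by omega), State.setReg_reg_ne _ _ _ _ (by omega),
          State.setReg_reg_ne _ _ _ _ (by omega)])
      (by
        refine ⟨rfl, fun i hi hi' => ?_, ?_, ?_, ?_⟩ <;> simp only [State.setReg_reg, if_true]
        · rw [if_neg (by omega), if_neg (by omega), if_neg (by omega), if_neg (by omega),
            if_neg (by omega)]
        · rw [if_neg (by omega), if_neg (by omega)]
        · rw [if_neg (by omega), if_neg (by omega), if_neg (by omega), if_neg (by omega), hρ]
        · rw [if_neg (by omega), if_neg (by omega), if_neg (by omega)]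
          simp)
    refine ⟨1 + (1 + (1 + (t + 1))), _, ?_, Run.seq (Run.copy _ _ _) (Run.seq (Run.const _ _ _)
      (Run.seq (Run.const _ _ _) (Run.seq hrun (Run.copy _ _ _)))), hI1, ?_, ?_⟩
    · simp only [eval_add, eval_mul, eval_X, eval_ofNat]
      have : s.reg 0 * (T₁.eval (s.reg 0) + 2 + 2) = s.reg 0 * (T₁.eval (s.reg 0) + 4) := by ring
      omega
    · intro i hi
      rw [State.setReg_reg]
      split_ifs with hi'
      · rw [hi', hI4, hρ]
      · exact hI2 i hi hi'
    · rw [State.setReg_reg_ne _ _ _ _ (by omega), hI5]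
      rfl
  | scale e ih =>
    intro r hr
    obtain ⟨P₁, T₁, h₁⟩ := ih (r + 1) (by omega)
    refine ⟨.seq P₁ (.seq (.const r 0) (Prog.times (r + 2) (r + 3) (.add r r (r + 1)))),
      T₁ + X * 3 + 4, fun s ρ hρ => ?_⟩
    obtain ⟨t₁, s₁, ht₁, hr₁, ha₁, hp₁, hv₁⟩ := h₁ s ρ hρ
    let I : ℕ → State → Prop := fun x s' => s'.arr = s.arr ∧
      (∀ i < r, s'.reg i = s.reg i) ∧ s'.reg (r + 1) = e.eval (s.reg 0) s.tables ρ ∧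
      s'.reg r = e.eval (s.reg 0) s.tables ρ * x
    obtain ⟨t, s', ht, hrun, hI1, hI2, hI3, hI4⟩ := Prog.times_run (c := r + 2) (o := r + 3)
      (by omega) (P := .add r r (r + 1))
      (T := 1) (N := s.reg 0) I
      (by
        rintro x s' w ⟨h1, h2, h3, h4⟩
        refine ⟨h1, fun i hi => ?_, ?_, ?_⟩
        · rw [State.setReg_reg_ne _ _ _ _ (by omega), h2 i hi]
        · rw [State.setReg_reg_ne _ _ _ _ (by omega), h3]
        · rw [State.setReg_reg_ne _ _ _ _ (by omega), h4])
      (by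
        rintro x s' hx ⟨h1, h2, h3, h4⟩ ho
        refine ⟨1, _, le_rfl, Run.add r r (r + 1) s', ⟨h1, ?_, ?_, ?_⟩, ?_, ?_⟩
        · intro i hi
          rw [State.setReg_reg_ne _ _ _ _ (by omega), h2 i hi]
        · rw [State.setReg_reg_ne _ _ _ _ (by omega), h3]
        · rw [State.setReg_reg_self, h3, h4]; ring
        · rw [State.setReg_reg_ne _ _ _ _ (by omega)]
        · rw [State.setReg_reg_ne _ _ _ _ (by omega), ho])
      (s₁.setReg r 0)
      (by rw [State.setReg_reg_ne _ _ _ _ (by omega), hp₁ _ (by omega)])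
      (by
        refine ⟨ha₁, fun i hi => ?_, ?_, ?_⟩ <;> simp only [State.setReg_reg, if_true]
        · rw [if_neg (by omega), if_neg (by omega), if_neg (by omega), hp₁ _ (by omega)]
        · rw [if_neg (by omega), if_neg (by omega), if_neg (by omega), hv₁]
        · rw [if_neg (by omega), if_neg (by omega)]; simp)
    refine ⟨t₁ + (1 + t), s', ?_, Run.seq hr₁ (Run.seq (Run.const r 0 s₁) hrun), hI1, hI2, ?_⟩
    · simp only [eval_add, eval_mul, eval_X, eval_ofNat]
      omega
    · rw [hI4]; rfl

/-- The memory in which the first `N * N` entries of the array `a` are those of the `N × N` table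
`f`, stored row by row. -/
def writeTable (N : ℕ) (m : ℕ → ℕ → ℕ) (a : ℕ) (f : ℕ → ℕ → ℕ) : ℕ → ℕ → ℕ :=
  fun b x => if b = a ∧ x < N * N then f (x / N) (x % N) else m b x

/-- Statements: `fill a e` simultaneously sets the entries of an `N × N` table to the values of
`e`, whose variables `0` and `1` hold the indices of the row and the column; `iter S` repeats `S`
for `N` rounds. -/
inductive Stm
  | fill (a : ℕ) (e : Exp)
  | seq (S₁ S₂ : Stm)
  | iter (S : Stm)

/-- The values of the variables in the entry `(i, j)` of a table that is being filled. -/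
def cell (i j : ℕ) : Fin 8 → ℕ := ![i, j, 0, 0, 0, 0, 0, 0]

/-- The effect of a statement on the memory. -/
def Stm.eval (N : ℕ) : Stm → (ℕ → ℕ → ℕ) → (ℕ → ℕ → ℕ)
  | .fill a e, m => writeTable N m a fun i j => e.eval N m (cell i j)
  | .seq S₁ S₂, m => S₂.eval N (S₁.eval N m)
  | .iter S, m => (S.eval N)^[N] m

theorem lt_sq_of_lt {N i j : ℕ} (hi : i < N) (hj : j < N) : i * N + j < N * N := by
  calc i * N + j < i * N + N := by omega
    _ = (i + 1) * N := by ring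
    _ ≤ N * N := Nat.mul_le_mul_right _ hi

theorem index_div {N i j : ℕ} (hj : j < N) : (i * N + j) / N = i := by
  rw [mul_comm, Nat.mul_add_div (by omega), Nat.div_eq_of_lt hj, add_zero]

theorem index_mod {N i j : ℕ} (hj : j < N) : (i * N + j) % N = j := by
  rw [mul_comm, Nat.mul_add_mod, Nat.mod_eq_of_lt hj]

/-- Run `P` for all `(i, j)` with `i, j < N`, row by row, with `i` and `j` in the registers `1`
and `2`. -/
def Prog.forCells (r : ℕ) (P : Prog) : Prog :=
  .seq (.times r (r + 1) (.seq (.times (r + 2) (r + 3) (.seq P (.add 2 2 (r + 3))))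
    (.seq (.const 2 0) (.add 1 1 (r + 1))))) (.const 1 0)

/-- The variables have the values `cell i j`. -/
def State.AtCell (s : State) (i j : ℕ) : Prop :=
  s.reg 1 = i ∧ s.reg 2 = j ∧ ∀ k, 3 ≤ k → k < 9 → s.reg k = 0

theorem State.AtCell.reg_eq {s : State} {i j : ℕ} (h : s.AtCell i j) (v : Fin 8) :
    s.reg (v + 1) = cell i j v := by
  obtain ⟨h1, h2, h3⟩ := h
  fin_cases v
  · simpa [cell] using h1
  · simpa [cell] using h2
  all_goals simpa [cell] using h3 _ (by simp) (by simp)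

theorem Prog.forCells_run {r : ℕ} (hr : 9 ≤ r) {P : Prog} {T N : ℕ}
    (J : ℕ → (ℕ → ℕ → ℕ) → Prop)
    (hstep : ∀ s i j, i < N → j < N → s.reg 0 = N → s.AtCell i j → J (i * N + j) s.arr →
      ∃ t s', t ≤ T ∧ Run P s t s' ∧ J (i * N + j + 1) s'.arr ∧ ∀ k < r + 4, s'.reg k = s.reg k)
    (s : State) (hN : s.reg 0 = N) (hs : s.AtCell 0 0) (h0 : J 0 s.arr) :
    ∃ t s', t ≤ N * (N * (T + 3) + 7) + 4 ∧ Run (P.forCells r) s t s' ∧ J (N * N) s'.arr ∧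
      ∀ k < r, s'.reg k = s.reg k := by
  have inner : ∀ (s : State) (i : ℕ), i < N → s.reg 0 = N → s.AtCell i 0 → J (i * N) s.arr →
      ∃ t s', t ≤ N * (T + 1 + 2) + 3 ∧
        Run (.times (r + 2) (r + 3) (.seq P (.add 2 2 (r + 3)))) s t s' ∧
        J ((i + 1) * N) s'.arr ∧ ∀ k < r + 2, k ≠ 2 → s'.reg k = s.reg k := by
    intro s i hi hN hs h0
    obtain ⟨t, s', ht, hrun, h1, h2, h3⟩ := Prog.times_run (c := r + 2) (o := r + 3)
      (by omega) (P := .seq P (.add 2 2 (r + 3))) (T := T + 1) (N := N)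
      (fun x s' => J (i * N + x) s'.arr ∧ (∀ k < r + 2, k ≠ 2 → s'.reg k = s.reg k) ∧
        s'.reg 2 = x)
      (by
        rintro x s' w ⟨h1, h2, h3⟩
        refine ⟨h1, fun k hk hk' => ?_, ?_⟩
        · rw [State.setReg_reg_ne _ _ _ _ (by omega), h2 k hk hk']
        · rw [State.setReg_reg_ne _ _ _ _ (by omega), h3])
      (by
        rintro x s' hx ⟨h1, h2, h3⟩ ho
        obtain ⟨t, s₁, ht, hrun, hJ, hk⟩ := hstep s' i x hi hx
          (by rw [h2 _ (by omega) (by omega), hN])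
          ⟨by rw [h2 _ (by omega) (by omega), hs.1], h3, fun k hk hk' => by
            rw [h2 _ (by omega) (by omega), hs.2.2 k hk hk']⟩ h1
        refine ⟨t + 1, _, by omega, Run.seq hrun (Run.add 2 2 (r + 3) s₁), ⟨hJ, ?_, ?_⟩, ?_, ?_⟩
        · intro k hk1 hk2
          rw [State.setReg_reg_ne _ _ _ _ hk2, hk _ (by omega), h2 _ hk1 hk2]
        · rw [State.setReg_reg_self, hk _ (by omega), hk _ (by omega), h3, ho]
        · rw [State.setReg_reg_ne _ _ _ _ (by omega), hk _ (by omega)]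
        · rw [State.setReg_reg_ne _ _ _ _ (by omega), hk _ (by omega), ho])
      s hN
      (by
        refine ⟨h0, fun k hk hk' => ?_, ?_⟩ <;> simp only [State.setReg_reg]
        · rw [if_neg (by omega), if_neg (by omega)]
        · rw [if_neg (by omega), if_neg (by omega), hs.2.1])
    exact ⟨t, s', ht, hrun, by rwa [add_mul, one_mul], h2⟩
  obtain ⟨t, s', ht, hrun, h1, h2, h3, h4⟩ := Prog.times_run (c := r) (o := r + 1)
    (by omega) (P := .seq (.times (r + 2) (r + 3) (.seq P (.add 2 2 (r + 3))))
      (.seq (.const 2 0) (.add 1 1 (r + 1)))) (T := N * (T + 1 + 2) + 3 + 2) (N := N)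
    (fun x s' => J (x * N) s'.arr ∧ (∀ k < r, k ≠ 1 → k ≠ 2 → s'.reg k = s.reg k) ∧
        s'.reg 1 = x ∧ s'.reg 2 = 0)
    (by
      rintro x s' w ⟨h1, h2, h3, h4⟩
      refine ⟨h1, fun k hk hk' hk2 => ?_, ?_, ?_⟩
      · rw [State.setReg_reg_ne _ _ _ _ (by omega), h2 k hk hk' hk2]
      · rw [State.setReg_reg_ne _ _ _ _ (by omega), h3]
      · rw [State.setReg_reg_ne _ _ _ _ (by omega), h4])
    (by
      rintro x s' hx ⟨h1, h2, h3, h4⟩ ho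
      obtain ⟨t, s₁, ht, hrun, hJ, hk⟩ := inner s' x hx
        (by rw [h2 _ (by omega) (by omega) (by omega), hN])
        ⟨h3, h4, fun k hk hk' => by
          rw [h2 _ (by omega) (by omega) (by omega), hs.2.2 k hk hk']⟩ h1
      refine ⟨t + (1 + 1), _, by omega, Run.seq hrun (Run.seq (Run.const 2 0 s₁)
        (Run.add 1 1 (r + 1) _)), ⟨hJ, ?_, ?_, ?_⟩, ?_, ?_⟩
      · intro k hk1 hk2 hk3
        rw [State.setReg_reg_ne _ _ _ _ hk2, State.setReg_reg_ne _ _ _ _ hk3,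
          hk _ (by omega) hk3, h2 _ hk1 hk2 hk3]
      · rw [State.setReg_reg_self, State.setReg_reg_ne _ _ _ _ (by omega),
          State.setReg_reg_ne _ _ _ _ (by omega), hk _ (by omega) (by omega),
          hk _ (by omega) (by omega), h3, ho]
      · rw [State.setReg_reg_ne _ _ _ _ (by omega), State.setReg_reg_self]
      · rw [State.setReg_reg_ne _ _ _ _ (by omega), State.setReg_reg_ne _ _ _ _ (by omega),
          hk _ (by omega) (by omega)]
      · rw [State.setReg_reg_ne _ _ _ _ (by omega), State.setReg_reg_ne _ _ _ _ (by omega),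
          hk _ (by omega) (by omega), ho])
    s hN
    (by
      refine ⟨by simpa using h0, fun k hk hk' _ => ?_, ?_, ?_⟩ <;> simp only [State.setReg_reg]
      · rw [if_neg (by omega), if_neg (by omega)]
      · rw [if_neg (by omega), if_neg (by omega), hs.1]
      · rw [if_neg (by omega), if_neg (by omega), hs.2.1])
  refine ⟨t + 1, _, ?_, Run.seq hrun (Run.const 1 0 s'), h1, fun k hk => ?_⟩
  · have : N * (N * (T + 1 + 2) + 3 + 2 + 2) = N * (N * (T + 3) + 7) := by ring
    omega
  · rw [State.setReg_reg]
    split_ifs with hk1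
    · rw [hk1, hs.1]
    · by_cases hk2 : k = 2
      · rw [hk2, h4, hs.2.1]
      · exact h2 k hk hk1 hk2

open Polynomial in
/-- If `P` computes the entries of a table from the arrays other than `b`, then the table can be
written into the array `b`. -/
theorem exists_store {r : ℕ} (hr : 9 ≤ r) (b : ℕ) (P : Prog) (T : Polynomial ℕ)
    (f : ℕ → (ℕ → ℕ → ℕ) → ℕ → ℕ → ℕ)
    (hf : ∀ N arr arr' i j, (∀ c ≠ b, arr c = arr' c) → f N arr i j = f N arr' i j)
    (hP : ∀ s i j, s.AtCell i j → ∃ t s', t ≤ T.eval (s.reg 0) ∧ Run P s t s' ∧ s'.arr = s.arr ∧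
      (∀ k < r + 4, s'.reg k = s.reg k) ∧ s'.reg (r + 4) = f (s.reg 0) s.arr i j) :
    ∃ P' T', ∀ s : State, s.AtCell 0 0 → ∃ t s', t ≤ (T' : Polynomial ℕ).eval (s.reg 0) ∧
      Run P' s t s' ∧ (∀ k < r, s'.reg k = s.reg k) ∧
      s'.arr = writeTable (s.reg 0) s.arr b (f (s.reg 0) s.arr) := by
  obtain ⟨P₁, T₁, h₁⟩ := Exp.exists_computes (.plus (.scale (.var 0)) (.var 1)) (r + 5) (by omega)
  refine ⟨(Prog.seq P (.seq P₁ (.store b (r + 5) (r + 4)))).forCells r,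
    X * (X * (T + T₁ + 1 + 3) + 7) + 4, fun s hs => ?_⟩
  obtain ⟨t, s', ht, hrun, hJ, hk⟩ := Prog.forCells_run hr (T := (T + T₁ + 1).eval (s.reg 0))
    (P := Prog.seq P (.seq P₁ (.store b (r + 5) (r + 4)))) (N := s.reg 0)
    (fun x arr => ∀ c y, arr c y = if c = b ∧ y < x then
      f (s.reg 0) s.arr (y / s.reg 0) (y % s.reg 0) else s.arr c y)
    (by
      intro s' i j hi hj hN hc hJ
      obtain ⟨t, s₁, ht, hrun, ha, hk, hv⟩ := hP s' i j hc
      obtain ⟨t₂, s₂, ht₂, hrun₂, ha₂, hk₂, hv₂⟩ := h₁ s₁ (cell i j) (fun v => by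
        rw [hk _ (by omega), hc.reg_eq])
      have hidx : s₂.reg (r + 5) = i * s.reg 0 + j := by
        rw [hv₂, hk _ (by omega), hN]
        simp [Exp.eval, cell]
      refine ⟨t + (t₂ + 1), _, ?_, Run.seq hrun (Run.seq hrun₂ (Run.store b (r + 5) (r + 4) s₂)),
        ?_, ?_⟩
      · rw [hN] at ht
        rw [hk _ (by omega), hN] at ht₂
        simp only [eval_add, eval_one]
        omega
      · intro c y
        rw [hidx, hk₂ _ (by omega), hv, hN]
        rw [hf _ s'.arr s.arr i j (by
          intro c hcb
          funext y
          rw [hJ, if_neg (by tauto)])]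
        simp only [State.setArr, Function.update_apply]
        by_cases hcb : c = b
        · rw [if_pos hcb, Function.update_apply]
          by_cases hy : y = i * s.reg 0 + j
          · rw [if_pos hy, if_pos ⟨hcb, by omega⟩, hy, index_div hj, index_mod hj]
          · rw [if_neg hy, ha₂, ha, hJ]
            by_cases hy' : y < i * s.reg 0 + j
            · rw [if_pos ⟨rfl, hy'⟩, if_pos ⟨hcb, by omega⟩]
            · rw [if_neg (by tauto), if_neg (by omega), hcb]
        · rw [if_neg hcb, ha₂, ha, hJ, if_neg (by tauto), if_neg (by tauto)]
      · intro k hk'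
        rw [State.setArr_reg, hk₂ _ (by omega), hk _ hk'])
    s rfl hs (by intro c y; simp)
  refine ⟨t, s', ?_, hrun, hk, ?_⟩
  · simpa using ht
  · funext c y
    rw [hJ]
    rfl

open Polynomial in
/-- The table of the values of `e` can be written to the scratch array. -/
theorem Exp.exists_tabulate (e : Exp) {r : ℕ} (hr : 9 ≤ r) :
    ∃ P T, ∀ s : State, s.AtCell 0 0 → ∃ t s', t ≤ (T : Polynomial ℕ).eval (s.reg 0) ∧
      Run P s t s' ∧ (∀ k < r, s'.reg k = s.reg k) ∧
      s'.arr = writeTable (s.reg 0) s.arr 1 fun i j => e.eval (s.reg 0) s.tables (cell i j) := by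
  obtain ⟨P, T, h⟩ := e.exists_computes (r + 4) (by omega)
  obtain ⟨P', T', h'⟩ := exists_store hr 1 P T
    (fun N arr i j => e.eval N (fun a => arr (2 * a)) (cell i j))
    (by
      intro N arr arr' i j harr
      congr 1
      funext a
      rw [harr _ (by omega)])
    (fun s i j hs => h s (cell i j) hs.reg_eq)
  exact ⟨P', T', h'⟩

open Polynomial in
/-- Statements run in polynomial time. A table is first written to the scratch array, because its
entries may depend on the old values of the array that is to be filled. -/
theorem Stm.exists_run (S : Stm) :
    ∀ r, 9 ≤ r → ∃ P T, ∀ s : State, s.AtCell 0 0 → ∃ t s',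
      t ≤ (T : Polynomial ℕ).eval (s.reg 0) ∧ Run P s t s' ∧ (∀ k < r, s'.reg k = s.reg k) ∧
      s'.tables = S.eval (s.reg 0) s.tables := by
  induction S with
  | fill a e =>
    intro r hr
    obtain ⟨P₁, T₁, h₁⟩ := e.exists_tabulate hr
    obtain ⟨P₀, T₀, h₀⟩ := Exp.exists_computes (.plus (.scale (.var 0)) (.var 1)) (r + 4) (by omega)
    obtain ⟨P₂, T₂, h₂⟩ := exists_store hr (2 * a) (.seq P₀ (.load (r + 4) 1 (r + 4))) (T₀ + 1)
      (fun N arr i j => arr 1 (i * N + j))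
      (by
        intro N arr arr' i j harr
        rw [harr _ (by omega)])
      (by
        intro s i j hs
        obtain ⟨t, s', ht, hrun, ha, hk, hv⟩ := h₀ s (cell i j) hs.reg_eq
        refine ⟨t + 1, _, ?_, Run.seq hrun (Run.load _ _ _ _), by simpa using ha, ?_, ?_⟩
        · simp only [eval_add, eval_one]
          omega
        · intro k hk'
          rw [State.setReg_reg_ne _ _ _ _ (by omega), hk _ hk']
        · rw [State.setReg_reg_self, hv, ha]
          simp [Exp.eval, cell])
    refine ⟨.seq P₁ P₂, T₁ + T₂, fun s hs => ?_⟩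
    obtain ⟨t₁, s₁, ht₁, hr₁, hk₁, ha₁⟩ := h₁ s hs
    obtain ⟨t₂, s₂, ht₂, hr₂, hk₂, ha₂⟩ := h₂ s₁
      ⟨by rw [hk₁ _ (by omega), hs.1], by rw [hk₁ _ (by omega), hs.2.1], fun k h3 h9 => by
        rw [hk₁ _ (by omega), hs.2.2 k h3 h9]⟩
    have h0 : s₁.reg 0 = s.reg 0 := hk₁ 0 (by omega)
    refine ⟨t₁ + t₂, s₂, ?_, Run.seq hr₁ hr₂, fun k hk => by rw [hk₂ _ hk, hk₁ _ hk], ?_⟩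
    · rw [h0] at ht₂
      simp only [eval_add]
      omega
    · funext b x
      simp only [State.tables, ha₂, Stm.eval, writeTable, h0, ha₁]
      have hb : ¬ 2 * b = 1 := by omega
      by_cases hx : b = a ∧ x < s.reg 0 * s.reg 0
      · obtain ⟨rfl, hx⟩ := hx
        have hN : 0 < s.reg 0 := by
          rcases Nat.eq_zero_or_pos (s.reg 0) with h | h
          · simp [h] at hx
          · exact h
        have hx' : x / s.reg 0 * s.reg 0 + x % s.reg 0 = x := Nat.div_add_mod' x _
        simp only [hx', hx, and_self, if_true]
      · rw [if_neg (by omega), if_neg (by tauto), if_neg hx]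
  | seq S₁ S₂ ih₁ ih₂ =>
    intro r hr
    obtain ⟨P₁, T₁, h₁⟩ := ih₁ r hr
    obtain ⟨P₂, T₂, h₂⟩ := ih₂ r hr
    refine ⟨.seq P₁ P₂, T₁ + T₂, fun s hs => ?_⟩
    obtain ⟨t₁, s₁, ht₁, hr₁, hk₁, ha₁⟩ := h₁ s hs
    obtain ⟨t₂, s₂, ht₂, hr₂, hk₂, ha₂⟩ := h₂ s₁
      ⟨by rw [hk₁ _ (by omega), hs.1], by rw [hk₁ _ (by omega), hs.2.1], fun k h3 h9 => by
        rw [hk₁ _ (by omega), hs.2.2 k h3 h9]⟩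
    have h0 : s₁.reg 0 = s.reg 0 := hk₁ 0 (by omega)
    refine ⟨t₁ + t₂, s₂, ?_, Run.seq hr₁ hr₂, fun k hk => by rw [hk₂ _ hk, hk₁ _ hk], ?_⟩
    · rw [h0] at ht₂
      simp only [eval_add]
      omega
    · rw [ha₂, ha₁, h0]
      rfl
  | iter S ih =>
    intro r hr
    obtain ⟨P, T, h⟩ := ih (r + 2) (by omega)
    refine ⟨Prog.times r (r + 1) P, X * (T + 2) + 3, fun s hs => ?_⟩
    obtain ⟨t, s', ht, hrun, h1, h2⟩ := Prog.times_run (c := r) (o := r + 1)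
      (by omega) (P := P) (T := T.eval (s.reg 0)) (N := s.reg 0)
      (fun x s' => s'.tables = (S.eval (s.reg 0))^[x] s.tables ∧ ∀ k < r, s'.reg k = s.reg k)
      (by
        rintro x s' w ⟨h1, h2⟩
        refine ⟨h1, fun k hk => ?_⟩
        rw [State.setReg_reg_ne _ _ _ _ (by omega), h2 k hk])
      (by
        rintro x s' hx ⟨h1, h2⟩ ho
        obtain ⟨t, s₁, ht, hrun, hk, ha⟩ := h s'
          ⟨by rw [h2 _ (by omega), hs.1], by rw [h2 _ (by omega), hs.2.1], fun k h3 h9 => by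
            rw [h2 _ (by omega), hs.2.2 k h3 h9]⟩
        have h0 : s'.reg 0 = s.reg 0 := h2 0 (by omega)
        refine ⟨t, s₁, by rwa [h0] at ht, hrun, ⟨?_, ?_⟩, hk _ (by omega), ?_⟩
        · rw [ha, h0, h1, Function.iterate_succ_apply']
        · intro k hk'
          rw [hk _ (by omega), h2 _ hk']
        · rw [hk _ (by omega), ho])
      s rfl
      (by
        refine ⟨rfl, fun k hk => ?_⟩
        simp only [State.setReg_reg]
        rw [if_neg (by omega), if_neg (by omega)])
    refine ⟨t, s', ?_, hrun, h2, h1⟩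
    simpa using ht

theorem eval_le_eval_of_le (T : Polynomial ℕ) {x y : ℕ} (h : x ≤ y) : T.eval x ≤ T.eval y := by
  rw [Polynomial.eval_eq_sum_range, Polynomial.eval_eq_sum_range]
  gcongr

open Polynomial in
/-- The program that runs `S` on the input, and then writes the values of `out`, as many as
`len` says, to the output array. All numbers are read off the first row of an `N × N` table, where
`N` is the length of the input, so that the output must not be longer than the input. -/
theorem exists_outputs (S : Stm) (out len : Exp) :
    ∃ (P : Prog) (T : Polynomial ℕ), ∀ l l' : List ℕ,
      (∀ m : ℕ → ℕ → ℕ, m = S.eval l.length (fun a i => if a = 0 then l.getD i 0 else 0) →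
        l'.length ≤ l.length ∧
        len.eval l.length m (cell 0 0) = l'.length ∧
        ∀ j, (hj : j < l'.length) → out.eval l.length m (cell 0 j) = l'[j]) →
      Outputs P l l' (T.eval l.length) := by
  obtain ⟨P₁, T₁, h₁⟩ := S.exists_run 9 le_rfl
  obtain ⟨P₂, T₂, h₂⟩ := out.exists_tabulate (r := 9) le_rfl
  obtain ⟨P₃, T₃, h₃⟩ := len.exists_computes 9 le_rfl
  refine ⟨.seq P₁ (.seq P₂ (.seq P₃ (.copy 0 9))), T₁ + T₂ + T₃ + 1, fun l l' hl => ?_⟩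
  have hs : (State.input l).AtCell 0 0 := by
    refine ⟨rfl, rfl, fun k hk _ => ?_⟩
    simp only [State.input]
    rw [if_neg (by omega)]
  obtain ⟨t₁, s₁, ht₁, hr₁, hk₁, ha₁⟩ := h₁ _ hs
  have hN : (State.input l).reg 0 = l.length := rfl
  have h0 : s₁.reg 0 = l.length := hk₁ 0 (by omega)
  have hs₁ : s₁.AtCell 0 0 := ⟨by rw [hk₁ _ (by omega), hs.1], by rw [hk₁ _ (by omega), hs.2.1],
    fun k h3 h9 => by rw [hk₁ _ (by omega), hs.2.2 k h3 h9]⟩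
  obtain ⟨t₂, s₂, ht₂, hr₂, hk₂, ha₂⟩ := h₂ s₁ hs₁
  have hs₂ : s₂.AtCell 0 0 := ⟨by rw [hk₂ _ (by omega), hs₁.1], by rw [hk₂ _ (by omega), hs₁.2.1],
    fun k h3 h9 => by rw [hk₂ _ (by omega), hs₁.2.2 k h3 h9]⟩
  have h0' : s₂.reg 0 = l.length := by rw [hk₂ 0 (by omega), h0]
  obtain ⟨t₃, s₃, ht₃, hr₃, ha₃, hk₃, hv₃⟩ := h₃ s₂ (cell 0 0) hs₂.reg_eq
  rw [hN] at ha₁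
  have htab : (State.input l).tables = fun a i => if a = 0 then l.getD i 0 else 0 := by
    funext a i
    simp [State.tables, State.input]
  rw [htab] at ha₁
  obtain ⟨hlen, hlen', hout⟩ := hl s₁.tables ha₁
  have htab₂ : s₂.tables = s₁.tables := by
    funext a i
    simp only [State.tables, ha₂, writeTable]
    rw [if_neg (by omega)]
  refine ⟨t₁ + (t₂ + (t₃ + 1)), _, ?_, Run.seq hr₁ (Run.seq hr₂ (Run.seq hr₃ (Run.copy 0 9 s₃))),
    ?_⟩
  · rw [hN] at ht₁
    rw [h0] at ht₂
    rw [h0'] at ht₃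
    simp only [eval_add, eval_one]
    omega
  · have hlast : (s₃.setReg 0 (s₃.reg 9)).reg 0 = l'.length := by
      rw [State.setReg_reg_self, hv₃, h0', htab₂, hlen']
    apply List.ext_getElem
    · rw [State.setReg_reg_self] at hlast
      simp [State.output, hlast]
    · intro j hj hj'
      have hjN : j < l.length := by omega
      simp only [State.output, List.getElem_map, List.getElem_range, State.setReg_arr, ha₃, ha₂,
        writeTable, h0]
      rw [if_pos ⟨trivial, lt_of_lt_of_le hjN (Nat.le_mul_self _)⟩, Nat.div_eq_of_lt hjN,
        Nat.mod_eq_of_lt hjN]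
      exact hout j hj'

end RAM

/-! ### Infinite words and runs of partial deterministic transition systems -/

section Words

variable {α Q Q' : Type*}

/-- The prefix of length `i` of an infinite word. -/
abbrev pre (w : ℕ → α) (i : ℕ) : List α := (List.range i).map w

/-- The infinite word without its first `i` letters. -/
abbrev shift (w : ℕ → α) (i : ℕ) : ℕ → α := fun j => w (i + j)

theorem pre_succ (w : ℕ → α) (i : ℕ) : pre w (i + 1) = pre w i ++ [w i] := by
  simp [pre, List.range_succ]

theorem shift_shift (w : ℕ → α) (i j : ℕ) : shift (shift w i) j = shift w (i + j) := by
  funext l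
  simp [shift, add_assoc]

theorem shift_zero (w : ℕ → α) : shift w 0 = w := by
  funext l
  simp [shift]

theorem pre_add (w : ℕ → α) (i j : ℕ) : pre w (i + j) = pre w i ++ pre (shift w i) j := by
  simp [pre, List.range_add, Function.comp_def]

/-- The run of a partial transition function on a finite word. -/
def drun (f : Q → α → Option Q) (q : Q) (u : List α) : Option Q :=
  u.foldl (fun o a => o.bind fun p => f p a) (some q)

variable {f : Q → α → Option Q} {g : Q' → α → Option Q'}

theorem foldl_bind_none (u : List α) :
    u.foldl (fun o a => o.bind fun p => f p a) none = none := by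
  induction u with
  | nil => rfl
  | cons a u ih => simpa using ih

theorem drun_cons (q : Q) (a : α) (u : List α) :
    drun f q (a :: u) = (f q a).bind fun p => drun f p u := by
  unfold drun
  rw [List.foldl_cons, Option.bind_some]
  cases f q a with
  | none => exact foldl_bind_none u
  | some p => rfl

theorem drun_append (q : Q) (u v : List α) :
    drun f q (u ++ v) = (drun f q u).bind fun p => drun f p v := by
  induction u generalizing q with
  | nil => rfl
  | cons a u ih =>
    rw [List.cons_append, drun_cons, drun_cons]
    cases f q a with
    | none => rfl
    | some p => exact ih p

theorem drun_append_of {q p : Q} {u : List α} (v : List α) (h : drun f q u = some p) :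
    drun f q (u ++ v) = drun f p v := by
  rw [drun_append, h]
  rfl

theorem drun_single (q : Q) (a : α) : drun f q [a] = f q a := rfl

theorem drun_cons_of {q p : Q} {a : α} (u : List α) (h : f q a = some p) :
    drun f q (a :: u) = drun f p u := by
  rw [drun_cons, h]
  rfl

theorem drun_pre_succ {q p : Q} {w : ℕ → α} {i : ℕ} (h : drun f q (pre w i) = some p) :
    drun f q (pre w (i + 1)) = f p (w i) := by
  rw [pre_succ, drun_append_of _ h, drun_single]

theorem drun_pre_add {q p : Q} {w : ℕ → α} {i : ℕ} (j : ℕ) (h : drun f q (pre w i) = some p) :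
    drun f q (pre w (i + j)) = drun f p (pre (shift w i) j) := by
  rw [pre_add, drun_append_of _ h]

/-- An invariant `P` of the transitions, and a map `h` that respects the transitions between states
with this invariant, carry over to runs. -/
theorem drun_map {P : Q → Prop} {h : Q → Q'}
    (H : ∀ q a q', P q → f q a = some q' → P q' ∧ g (h q) a = some (h q'))
    {q q' : Q} {u : List α} (hq : P q) (hu : drun f q u = some q') :
    P q' ∧ drun g (h q) u = some (h q') := by
  induction u generalizing q with
  | nil =>
    obtain rfl : q = q' := Option.some.inj hu
    exact ⟨hq, rfl⟩
  | cons a u ih =>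
    rw [drun_cons, Option.bind_eq_some_iff] at hu
    obtain ⟨p, hp, hu⟩ := hu
    obtain ⟨h1, h2⟩ := H _ _ _ hq hp
    rw [drun_cons_of _ h2]
    exact ih h1 hu

theorem drun_inv {P : Q → Prop} (H : ∀ q a q', P q → f q a = some q' → P q')
    {q q' : Q} {u : List α} (hq : P q) (hu : drun f q u = some q') : P q' :=
  (drun_map (g := f) (h := id) (fun q a q' h1 h2 => ⟨H q a q' h1 h2, h2⟩) hq hu).1

/-- The infinite word `w` labels an infinite run from `q`. -/
def Live (f : Q → α → Option Q) (q : Q) (w : ℕ → α) : Prop := ∀ i, (drun f q (pre w i)).isSome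

theorem Live.exists_run {q : Q} {w : ℕ → α} (h : Live f q w) (i : ℕ) :
    ∃ p, drun f q (pre w i) = some p := Option.isSome_iff_exists.1 (h i)

theorem Live.of_run {q p : Q} {w : ℕ → α} {i : ℕ} (h : Live f q w)
    (hp : drun f q (pre w i) = some p) : Live f p (shift w i) := by
  intro j
  rw [← drun_pre_add j hp]
  exact h _

theorem live_of_path {w : ℕ → α} {ρ : ℕ → Q} (h : ∀ i, f (ρ i) (w i) = some (ρ (i + 1))) (i : ℕ) :
    drun f (ρ 0) (pre w i) = some (ρ i) := by
  induction i with
  | zero => rfl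
  | succ i ih => rw [drun_pre_succ ih, h]

theorem live_iff {q : Q} {w : ℕ → α} :
    Live f q w ↔ ∃ ρ : ℕ → Q, ρ 0 = q ∧ ∀ i, f (ρ i) (w i) = some (ρ (i + 1)) := by
  constructor
  · intro h
    choose ρ hρ using h.exists_run
    refine ⟨ρ, ?_, fun i => ?_⟩
    · exact (Option.some.inj (hρ 0)).symm
    · rw [← drun_pre_succ (hρ i), hρ]
  · rintro ⟨ρ, rfl, h⟩ i
    rw [live_of_path h]
    rfl

theorem Live.map {P : Q → Prop} {h : Q → Q'}
    (H : ∀ q a q', P q → f q a = some q' → P q' ∧ g (h q) a = some (h q'))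
    {q : Q} {w : ℕ → α} (hq : P q) (hw : Live f q w) : Live g (h q) w := by
  intro i
  obtain ⟨p, hp⟩ := hw.exists_run i
  rw [(drun_map H hq hp).2]
  rfl

theorem Live.mono {q : Q} {q' : Q'} (h : ∀ u, (drun f q u).isSome → (drun g q' u).isSome)
    {w : ℕ → α} (hw : Live f q w) : Live g q' w := fun i => h _ (hw i)

/-- A set of words that behaves like the residuals of a language along the transitions does so
along runs. -/
theorem mem_iff_of_run {P : Q → Prop} (hP : ∀ q a q', P q → f q a = some q' → P q')
    {Λ : Q → Set (ℕ → α)}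
    (H : ∀ q w q', P q → f q (w 0) = some q' → (w ∈ Λ q ↔ shift w 1 ∈ Λ q')) {q q' : Q}
    {w : ℕ → α} {i : ℕ} (hq : P q) (h : drun f q (pre w i) = some q') :
    w ∈ Λ q ↔ shift w i ∈ Λ q' := by
  induction i generalizing q' with
  | zero =>
    obtain rfl : q = q' := Option.some.inj h
    rw [shift_zero]
  | succ i ih =>
    rw [pre_succ, drun_append, Option.bind_eq_some_iff] at h
    obtain ⟨p, hp, h⟩ := h
    rw [ih hp, H p (shift w i) q' (drun_inv hP hq hp) h, shift_shift]

end Words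

/-! ### The language of a consistent automaton -/

namespace LayeredAutomaton

variable {α Q : Type*} (A : LayeredAutomaton α Q)

theorem anc_layer (q : Q) : A.anc (A.layer q) q = q := by
  simp [anc]

theorem parent_anc (q : Q) (x : ℕ) (h : x + 1 ≤ A.layer q) :
    A.parent (A.anc (x + 1) q) = A.anc x q := by
  unfold anc
  rw [← Function.iterate_succ_apply' A.parent]
  congr 1
  omega

theorem anc_anc (q : Q) (x y : ℕ) (h1 : 1 ≤ x) (hxy : x ≤ y) (hy : y ≤ A.layer q) :
    A.anc x (A.anc y q) = A.anc x q := by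
  conv_lhs => rw [anc, A.layer_anc q y (by omega) hy]
  unfold anc
  rw [← Function.iterate_add_apply]
  congr 1
  omega

theorem anc_step {q q' : Q} {a : α} {x : ℕ} (h1 : 1 ≤ x) (hx : x ≤ A.layer q)
    (h : A.step q a = some q') : A.step (A.anc x q) a = some (A.anc x q') := by
  have key : ∀ n q q', n < A.layer q → A.step q a = some q' →
      A.step (A.parent^[n] q) a = some (A.parent^[n] q') := by
    intro n
    induction n with
    | zero => exact fun q q' _ h => h
    | succ n ih =>
      intro q q' hn h
      rw [Function.iterate_succ_apply, Function.iterate_succ_apply]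
      have := A.parent_layer q (by omega)
      exact ih _ _ (by omega) (A.parent_step q a q' (by omega) h)
  unfold anc
  rw [A.step_layer q a q' h]
  exact key _ _ _ (by omega) h

theorem mem_safe_iff (x : ℕ) (q : Q) (w : ℕ → α) :
    Sum.inr w ∈ A.safe x q ↔ Live A.step (A.anc x q) w := live_iff.symm

theorem inl_mem_safe_iff (x : ℕ) (q : Q) (u : List α) :
    Sum.inl u ∈ A.safe x q ↔ (drun A.step (A.anc x q) u).isSome :=
  Option.isSome_iff_exists.symm

theorem stronglySafe_iff (p : Q) (w : ℕ → α) :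
    A.StronglySafe p w ↔ Live A.step p w ∧ ∀ i c, A.layer c = A.layer p + 1 →
      drun A.step p (pre w i) = some (A.parent c) → ¬ Live A.step c (shift w i) := by
  have hanc : ∀ c, A.layer c = A.layer p + 1 →
      A.anc (A.layer p) c = A.parent c ∧ A.anc (A.layer p + 1) c = c := by
    intro c hc
    constructor
    · rw [← A.parent_anc c _ hc.ge, ← hc, anc_layer]
    · rw [← hc, anc_layer]
  unfold StronglySafe
  rw [mem_safe_iff, anc_layer]
  refine and_congr Iff.rfl (forall_congr' fun i => ⟨fun h c hc hr hl => h ⟨c, hc, ?_, ?_⟩, ?_⟩)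
  · rw [(hanc c hc).1]
    exact hr
  · rw [mem_safe_iff, (hanc c hc).2]
    exact hl
  · rintro h ⟨c, hc, hr, hl⟩
    rw [mem_safe_iff, (hanc c hc).2] at hl
    rw [(hanc c hc).1] at hr
    exact h c hc hr hl

/-- The sets `Λ q`, for `q` on the first layer, are the languages of a family of residuals that
fits the automaton: they are compatible with the transitions, and they contain the word `w`
whenever some state above strongly accepts it, and do not contain it whenever some state above
strongly rejects it. -/
structure Cert (Λ : Q → Set (ℕ → α)) : Prop where
  res : ∀ q w q', A.layer q = 1 → A.step q (w 0) = some q' → (w ∈ Λ q ↔ shift w 1 ∈ Λ q')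
  strong : ∀ p w, A.StronglySafe p w → (w ∈ Λ (A.anc 1 p) ↔ Even (A.layer p))

variable {A}

theorem Cert.mem_iff {Λ : Q → Set (ℕ → α)} (h : A.Cert Λ) {q q' : Q} {w : ℕ → α} {i : ℕ}
    (hq : A.layer q = 1) (hr : drun A.step q (pre w i) = some q') :
    w ∈ Λ q ↔ shift w i ∈ Λ q' :=
  mem_iff_of_run (P := fun q => A.layer q = 1)
    (fun q a q' h1 h2 => by rw [A.step_layer q a q' h2, h1]) h.res hq hr

theorem Cert.consistent {Λ : Q → Set (ℕ → α)} (h : A.Cert Λ) : A.Consistent := by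
  rintro ⟨p, p', w, ⟨-, -, hs⟩, ⟨he, h1⟩, ⟨ho, h2⟩⟩
  have h3 := (h.strong p w h1).2 he
  rw [hs, h.strong p' w h2] at h3
  exact (Nat.not_even_iff_odd.2 ho) h3

/-- A run of the semantics automaton whose least priority that occurs infinitely often is `x`, and
which, whenever it uses a transition of priority `x`, goes to a leaf state whose ancestor on layer
`x + 1` is live on the remaining word, provided there is such a successor. Then `x` has the right
parity: from some point on, the ancestor of the run on layer `x` is strongly safe. -/
theorem Cert.mem_iff_even {Λ : Q → Set (ℕ → α)} (h : A.Cert Λ) {w : ℕ → α}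
    {ρ : ℕ → {q : Q // A.IsLeaf q}} {pr : ℕ → ℕ}
    (hρ : ∀ i, A.sem.trans (ρ i) (w i) (pr i) (ρ (i + 1))) {x : ℕ}
    (hfreq : ∃ᶠ i in Filter.atTop, pr i = x) (hev : ∀ᶠ i in Filter.atTop, x ≤ pr i)
    (hbest : ∀ i, pr i = x → (∃ s, A.sem.trans (ρ i) (w i) x s ∧ x + 1 ≤ A.layer s.1 ∧
        Live A.step (A.anc (x + 1) s.1) (shift w (i + 1))) →
      x + 1 ≤ A.layer (ρ (i + 1)).1 ∧
        Live A.step (A.anc (x + 1) (ρ (i + 1)).1) (shift w (i + 1))) :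
    w ∈ Λ (A.anc 1 (ρ 0).1) ↔ Even x := by
  obtain ⟨j, hj⟩ := Filter.eventually_atTop.1 hev
  obtain ⟨i₀, -, hi₀⟩ := (Filter.frequently_atTop.1 hfreq) 0
  have hprio : ∀ i, pr i = A.prio (ρ i).1 (w i) := fun i => (hρ i).1
  have hx1 : 1 ≤ x := by rw [← hi₀, hprio]; exact (A.prio_spec _ _).1.1
  have hle : ∀ i, pr i ≤ A.layer (ρ i).1 := fun i => by rw [hprio]; exact (A.prio_spec _ _).2
  -- The ancestors on every layer up to the current priority make a step.
  have hstep : ∀ y i, 1 ≤ y → y ≤ pr i →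
      A.step (A.anc y (ρ i).1) (w i) = some (A.anc y (ρ (i + 1)).1) := by
    intro y i hy1 hy
    have h1 := A.anc_step hy1 (by rw [A.layer_anc _ _ (hy1.trans hy) (hle i)]; exact hy) (hρ i).2.2
    rwa [A.anc_anc _ _ _ hy1 hy (hle i), A.anc_anc _ _ _ hy1 hy (hρ i).2.1] at h1
  have hrun1 : drun A.step (A.anc 1 (ρ 0).1) (pre w j) = some (A.anc 1 (ρ j).1) :=
    live_of_path (ρ := fun i => A.anc 1 (ρ i).1) (fun i => hstep 1 i le_rfl (by
      rw [hprio]; exact (A.prio_spec _ _).1.1)) j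
  have hrunx : ∀ i, drun A.step (A.anc x (ρ j).1) (pre (shift w j) i) =
      some (A.anc x (ρ (j + i)).1) := fun i =>
    live_of_path (ρ := fun i => A.anc x (ρ (j + i)).1) (w := shift w j)
      (fun i => hstep x (j + i) hx1 (hj _ (by omega))) i
  have hlj : ∀ i, j ≤ i → x ≤ A.layer (ρ i).1 := fun i hi => (hj i hi).trans (hle i)
  have hstrong : A.StronglySafe (A.anc x (ρ j).1) (shift w j) := by
    rw [stronglySafe_iff, A.layer_anc _ _ hx1 (hlj j le_rfl)]
    refine ⟨fun i => by rw [hrunx]; rfl, fun i c hc hrun hl => ?_⟩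
    rw [hrunx, Option.some_inj] at hrun
    rw [shift_shift] at hl
    obtain ⟨l, hl1, hl2⟩ := (Filter.frequently_atTop.1 hfreq) (j + i)
    obtain ⟨m, rfl⟩ := Nat.exists_eq_add_of_le hl1
    -- `c'` is where the child `c` has got to after the next transition of priority `x`.
    obtain ⟨c', hc'⟩ := hl.exists_run (m + 1)
    have hmap := drun_map (P := fun q => A.layer q = x + 1) (h := A.parent) (f := A.step)
      (g := A.step) (fun q a q' h1 h2 => ⟨by rw [A.step_layer q a q' h2, h1],
        A.parent_step q a q' (by omega) h2⟩) hc hc'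
    have hpar : A.parent c' = A.anc x (ρ (j + i + (m + 1))).1 := by
      have h1 := hrunx (i + (m + 1))
      rw [drun_pre_add (m + 1) (hrunx i), shift_shift, hrun, hmap.2, Option.some_inj] at h1
      rw [h1, ← add_assoc j]
    obtain ⟨s, hs, hcs⟩ := A.exists_leaf c'
    rw [IsAncestor, hmap.1] at hcs
    have hgood := hbest (j + i + m) hl2 ⟨⟨s, hs⟩, ⟨by rw [← hl2]; exact hprio _, by
        have := hcs.1; simp only; omega, by
        rw [hstep x _ hx1 hl2.ge]
        congr 1
        rw [add_assoc, ← hpar, ← hcs.2, A.parent_anc _ _ hcs.1]⟩, hcs.1, by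
        rw [hcs.2, add_assoc (j + i)]
        have := hl.of_run hc'
        rwa [shift_shift] at this⟩
    -- From then on the layer `x + 1` is never left.
    have hlater : ∀ k, x + 1 ≤ A.layer (ρ (j + i + m + 1 + k)).1 ∧
        Live A.step (A.anc (x + 1) (ρ (j + i + m + 1 + k)).1) (shift w (j + i + m + 1 + k)) := by
      intro k
      induction k with
      | zero => exact hgood
      | succ k ih =>
        obtain ⟨ih1, ih2⟩ := ih
        have hpr : x + 1 ≤ pr (j + i + m + 1 + k) := by
          rw [hprio]
          refine Nat.le_findGreatest ih1 ⟨by omega, ?_⟩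
          exact ih2 1
        have h1 := hstep (x + 1) _ (by omega) hpr
        refine ⟨hpr.trans (hρ _).2.1, ?_⟩
        have := ih2.of_run (i := 1) (p := A.anc (x + 1) (ρ (j + i + m + 1 + (k + 1))).1) h1
        rwa [shift_shift] at this
    obtain ⟨l, hl1, hl2'⟩ := (Filter.frequently_atTop.1 hfreq) (j + i + m + 1)
    obtain ⟨k, rfl⟩ := Nat.exists_eq_add_of_le hl1
    have hpr : x + 1 ≤ pr (j + i + m + 1 + k) := by
      rw [hprio]
      refine Nat.le_findGreatest (hlater k).1 ⟨by omega, (hlater k).2 1⟩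
    omega
  have h2 := h.strong _ _ hstrong
  rw [A.layer_anc _ _ hx1 (hlj j le_rfl), A.anc_anc _ _ _ le_rfl hx1 (hlj j le_rfl)] at h2
  rw [← h2]
  exact h.mem_iff (A.layer_anc _ _ le_rfl (A.one_le_layer _)) hrun1

/-- A bounded sequence of priorities has a least element that occurs infinitely often. -/
theorem exists_liminf {pr : ℕ → ℕ} {d : ℕ} (h : ∀ i, pr i ≤ d) :
    ∃ x, (∃ᶠ i in Filter.atTop, pr i = x) ∧ ∀ᶠ i in Filter.atTop, x ≤ pr i := by
  classical
  have hex : ∃ x, ∃ᶠ i in Filter.atTop, pr i = x := by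
    by_contra hno
    push Not at hno
    have h1 : ∀ᶠ i in Filter.atTop, ∀ x ∈ Finset.range (d + 1), pr i ≠ x :=
      (Finset.eventually_all _).2 fun x _ => hno x
    obtain ⟨i, hi⟩ := h1.exists
    exact hi (pr i) (by simpa [Nat.lt_succ_iff] using h i) rfl
  refine ⟨Nat.find hex, Nat.find_spec hex, ?_⟩
  have h1 : ∀ᶠ i in Filter.atTop, ∀ x ∈ Finset.range (Nat.find hex), pr i ≠ x :=
    (Finset.eventually_all _).2 fun x hx =>
      Filter.not_frequently.1 (Nat.find_min hex (by simpa using hx))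
  filter_upwards [h1] with i hi
  by_contra hlt
  exact hi (pr i) (by simpa using hlt) rfl

/-- The language of every leaf state is the set belonging to its ancestor on the first layer. Both
players have the same positional strategy: at a transition of priority `x`, go below a state of
layer `x + 1` that is live on the remaining word, if possible. -/
theorem Cert.language_eq {Λ : Q → Set (ℕ → α)} (h : A.Cert Λ) (l : {q : Q // A.IsLeaf q}) :
    A.sem.language l = Λ (A.anc 1 l.1) := by
  classical
  ext w
  have hbest : ∀ (i : ℕ) (s : {q : Q // A.IsLeaf q}), ∃ s',
      A.sem.trans s (w i) (A.prio s.1 (w i)) s' ∧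
      ((∃ s', A.sem.trans s (w i) (A.prio s.1 (w i)) s' ∧ A.prio s.1 (w i) + 1 ≤ A.layer s'.1 ∧
        Live A.step (A.anc (A.prio s.1 (w i) + 1) s'.1) (shift w (i + 1))) →
      A.prio s.1 (w i) + 1 ≤ A.layer s'.1 ∧
        Live A.step (A.anc (A.prio s.1 (w i) + 1) s'.1) (shift w (i + 1))) := by
    intro i s
    by_cases hg : ∃ s', A.sem.trans s (w i) (A.prio s.1 (w i)) s' ∧
        A.prio s.1 (w i) + 1 ≤ A.layer s'.1 ∧
        Live A.step (A.anc (A.prio s.1 (w i) + 1) s'.1) (shift w (i + 1))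
    · obtain ⟨s', h1, h2⟩ := hg
      exact ⟨s', h1, fun _ => h2⟩
    · obtain ⟨x, s', hs'⟩ := A.sem.complete s (w i)
      obtain rfl : x = _ := hs'.1
      exact ⟨s', hs', fun h => absurd h hg⟩
  choose best hb1 hb2 using hbest
  have hprle : ∀ (ρ : ℕ → {q : Q // A.IsLeaf q}) (pr : ℕ → ℕ),
      (∀ i, A.sem.trans (ρ i) (w i) (pr i) (ρ (i + 1))) → ∀ i, pr i ≤ A.d := by
    intro ρ pr hρ i
    rw [(hρ i).1]
    exact (A.prio_spec _ _).2.trans (A.layer_le _)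
  constructor
  · rintro ⟨σ, hσ, hwin⟩
    -- The play in which Adam follows `best`, with its history.
    let next : List {q : Q // A.IsLeaf q} × {q : Q // A.IsLeaf q} →
        List {q : Q // A.IsLeaf q} × {q : Q // A.IsLeaf q} := fun c =>
      (c.1 ++ [c.2], if Odd (A.prio c.2.1 (w c.1.length)) then σ c.1 c.2 else best c.1.length c.2)
    let play : ℕ → List {q : Q // A.IsLeaf q} × {q : Q // A.IsLeaf q} := fun i => next^[i] ([], l)
    have hsucc : ∀ i, play (i + 1) = next (play i) := fun i =>
      Function.iterate_succ_apply' next i _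
    have hhist : ∀ i, (play i).1 = (List.range i).map fun j => (play j).2 := by
      intro i
      induction i with
      | zero => rfl
      | succ i ih =>
        rw [hsucc, List.range_succ, List.map_append, ← ih]
        rfl
    have hlen : ∀ i, (play i).1.length = i := fun i => by rw [hhist]; simp
    let ρ : ℕ → {q : Q // A.IsLeaf q} := fun i => (play i).2
    let pr : ℕ → ℕ := fun i => A.prio (ρ i).1 (w i)
    have hnext : ∀ i, ρ (i + 1) =
        if Odd (pr i) then σ ((List.range i).map ρ) (ρ i) else best i (ρ i) := by
      intro i
      have h1 : ρ (i + 1) = (next (play i)).2 := by rw [← hsucc]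
      rw [h1]
      simp only [next, hlen]
      rw [hhist]
    have hρ : ∀ i, A.sem.trans (ρ i) (w i) (pr i) (ρ (i + 1)) := by
      intro i
      rw [hnext]
      split_ifs with hodd
      · have := hσ ((List.range i).map ρ) (ρ i) (pr i) hodd
        simp only [List.length_map, List.length_range] at this
        exact this ⟨_, hb1 i (ρ i)⟩
      · exact hb1 i (ρ i)
    obtain ⟨x, hx, hfreq, hev⟩ := hwin ρ pr ⟨rfl, hρ⟩ (fun i hi => by rw [hnext, if_pos hi])
    refine (h.mem_iff_even hρ hfreq hev fun i hi => ?_).2 hx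
    rw [hnext, if_neg (by rw [hi]; exact Nat.not_odd_iff_even.2 hx), ← hi]
    exact hb2 i (ρ i)
  · intro hw
    refine ⟨fun past s => best past.length s, ?_, ?_⟩
    · rintro past s x - ⟨s', hs'⟩
      obtain rfl : x = _ := hs'.1
      exact hb1 _ _
    · rintro ρ pr ⟨rfl, hρ⟩ hfol
      obtain ⟨x, hfreq, hev⟩ := exists_liminf (hprle ρ pr hρ)
      refine ⟨x, ?_, hfreq, hev⟩
      by_contra hx
      refine hx ((h.mem_iff_even hρ hfreq hev fun i hi => ?_).1 hw)
      have h1 := hfol i (by rw [hi]; exact Nat.not_even_iff_odd.1 hx)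
      rw [h1, ← hi, (hρ i).1]
      simpa using hb2 i (ρ i)

theorem StronglySafe.of_run {p p' : Q} {w : ℕ → α} {i : ℕ} (h : A.StronglySafe p w)
    (hr : drun A.step p (pre w i) = some p') : A.StronglySafe p' (shift w i) := by
  rw [stronglySafe_iff] at h ⊢
  have hl : A.layer p' = A.layer p :=
    drun_inv (P := fun q => A.layer q = A.layer p)
      (fun q a q' h1 h2 => by rw [A.step_layer q a q' h2, h1]) rfl hr
  refine ⟨h.1.of_run hr, fun j c hc hj => ?_⟩
  rw [shift_shift]
  exact h.2 (i + j) c (by rw [hc, hl]) (by rw [drun_pre_add j hr, hj])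

theorem drun_anc {p p' : Q} {u : List α} (hr : drun A.step p u = some p') :
    drun A.step (A.anc 1 p) u = some (A.anc 1 p') :=
  (drun_map (P := fun _ => True) (h := A.anc 1)
    (fun _ _ _ _ h2 => ⟨trivial, A.anc_step le_rfl (A.one_le_layer _) h2⟩) trivial hr).2

/-- In a consistent automaton, the words that are eventually strongly accepted form the
languages of the states of the first layer. -/
theorem Consistent.exists_cert (h : A.Consistent) : ∃ Λ, A.Cert Λ := by
  refine ⟨fun q => {w | ∃ i p, Even (A.layer p) ∧ A.StronglySafe p (shift w i) ∧
    drun A.step q (pre w i) = some (A.anc 1 p)}, ?_, ?_⟩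
  · intro q w q' hq hstep
    have h1 : drun A.step q (pre w 1) = some q' := hstep
    constructor
    · rintro ⟨i, p, he, hs, hr⟩
      cases i with
      | zero =>
        obtain rfl : q = A.anc 1 p := Option.some.inj hr
        rw [shift_zero] at hs
        obtain ⟨p', hp'⟩ := ((A.stronglySafe_iff _ _).1 hs).1.exists_run 1
        have hl : A.layer p' = A.layer p := A.step_layer p (w 0) p' hp'
        refine ⟨0, p', by rwa [hl], ?_, ?_⟩
        · rw [shift_zero]
          exact hs.of_run hp'
        · rw [drun_anc hp', Option.some_inj] at h1
          rw [h1]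
          rfl
      | succ i =>
        refine ⟨i, p, he, by rwa [shift_shift, add_comm], ?_⟩
        rw [← drun_pre_add i h1, add_comm, hr]
    · rintro ⟨i, p, he, hs, hr⟩
      exact ⟨1 + i, p, he, by rwa [shift_shift] at hs, by rw [drun_pre_add i h1, hr]⟩
  · intro p w hs
    refine ⟨?_, fun he => ⟨0, p, he, by rwa [shift_zero], rfl⟩⟩
    rintro ⟨i, p', he, hs', hr⟩
    by_contra ho
    obtain ⟨p₁, hp₁⟩ := ((A.stronglySafe_iff _ _).1 hs).1.exists_run i
    have hl : A.layer p₁ = A.layer p :=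
      drun_inv (P := fun q => A.layer q = A.layer p)
        (fun q a q' h1 h2 => by rw [A.step_layer q a q' h2, h1]) rfl hp₁
    refine h ⟨p', p₁, shift w i, ⟨A.one_le_layer _, A.one_le_layer _, ?_⟩, ⟨he, hs'⟩,
      ⟨by rw [hl]; exact Nat.not_even_iff_odd.1 ho, hs.of_run hp₁⟩⟩
    rw [drun_anc hp₁, Option.some_inj] at hr
    exact hr.symm

end LayeredAutomaton

/-! ### Layered automata inside a fixed set of states -/

/-- The data of a layered automaton whose states are natural numbers; `lay q` is the layer of the
state `q`, and `0` if `q` is not a state. -/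
structure PLA (α : Type*) where
  lay : ℕ → ℕ
  par : ℕ → ℕ
  st : ℕ → α → Option ℕ
  init : ℕ

namespace PLA

variable {α : Type*}

/-- `R` is a layered automaton with states below `N` and at most `d` layers. The layers are also
required to be below `N`, so that they can be used as entries and indices of tables of size `N`. -/
structure Valid (R : PLA α) (N d : ℕ) : Prop where
  lt : ∀ q, R.lay q ≠ 0 → q < N
  lay_lt : ∀ q, R.lay q < N
  lay_le : ∀ q, R.lay q ≤ d
  st_dead : ∀ q a, R.lay q = 0 → R.st q a = none
  st_lay : ∀ q a q', R.st q a = some q' → R.lay q' = R.lay q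
  par_root : ∀ q, R.lay q = 1 → R.par q = q
  par_lay : ∀ q, 1 < R.lay q → R.lay (R.par q) + 1 = R.lay q
  par_st : ∀ q a q', 1 < R.lay q → R.st q a = some q' → R.st (R.par q) a = some (R.par q')
  complete : ∀ q a, R.lay q = 1 → (R.st q a).isSome
  init_lay : R.lay R.init = 1
  reach : ∀ q, R.lay q = 1 → ∃ u, drun R.st R.init u = some q

variable (R : PLA α)

/-- The ancestor of a state on the first layer. -/
def root (q : ℕ) : ℕ := R.par^[R.lay q - 1] q

/-- `Anc p q` means that `p` is an ancestor of the state `q`. -/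
inductive Anc (p : ℕ) : ℕ → Prop
  | refl (h : R.lay p ≠ 0) : Anc p p
  | step (q : ℕ) (h : 1 < R.lay q) (hp : Anc p (R.par q)) : Anc p q

/-- `q` is reachable from `p` within the layer of `p`. -/
def Reach (p q : ℕ) : Prop := ∃ u, drun R.st p u = some q

/-- Some ancestor of `q` is reachable from `p`. -/
def Under (p q : ℕ) : Prop := ∃ s, R.Anc s q ∧ R.Reach p s

/-- Inclusion of the sets of finite words that are safe from `p` and from `q`, each on its own
layer. -/
def SafeLE (p q : ℕ) : Prop := ∀ u, (drun R.st p u).isSome → (drun R.st q u).isSome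

/-- Strong acceptance or rejection, depending on the parity of the layer of `p`. -/
structure Strong (p : ℕ) (w : ℕ → α) : Prop where
  lay : R.lay p ≠ 0
  live : Live R.st p w
  not_live : ∀ i c, R.lay c = R.lay p + 1 → drun R.st p (pre w i) = some (R.par c) →
    ¬ Live R.st c (shift w i)

/-- The analogue of `LayeredAutomaton.Cert`: `Λ` assigns to the states of the first layer
languages that are compatible with the transitions and with strong acceptance and rejection. -/
structure Cert (Λ : ℕ → Set (ℕ → α)) : Prop where
  res : ∀ q w q', R.lay q = 1 → R.st q (w 0) = some q' → (w ∈ Λ q ↔ shift w 1 ∈ Λ q')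
  strong : ∀ p w, R.Strong p w → (w ∈ Λ (R.root p) ↔ Even (R.lay p))

/-- Above the first layer, all transitions lie on cycles, and every state has a transition. -/
structure Recurrent : Prop where
  back : ∀ q a q', 1 < R.lay q → R.st q a = some q' → R.Reach q' q
  succ : ∀ q, 1 < R.lay q → ∃ a q', R.st q a = some q'

variable {R} {N d : ℕ}

theorem Reach.refl (p : ℕ) : R.Reach p p := ⟨[], rfl⟩

theorem Reach.trans {p q r : ℕ} (h₁ : R.Reach p q) (h₂ : R.Reach q r) : R.Reach p r := by
  obtain ⟨u, hu⟩ := h₁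
  obtain ⟨v, hv⟩ := h₂
  exact ⟨u ++ v, by rw [drun_append_of _ hu, hv]⟩

theorem Reach.of_st {p q : ℕ} {a : α} (h : R.st p a = some q) : R.Reach p q := ⟨[a], h⟩

theorem Reach.head {p q r : ℕ} {a : α} (h : R.st p a = some q) (h' : R.Reach q r) : R.Reach p r :=
  (Reach.of_st h).trans h'

theorem Valid.drun_lay (h : R.Valid N d) {p q : ℕ} {u : List α} (hr : drun R.st p u = some q) :
    R.lay q = R.lay p :=
  drun_inv (P := fun q => R.lay q = R.lay p)
    (fun q a q' h1 h2 => by rw [h.st_lay q a q' h2, h1]) rfl hr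

theorem Valid.reach_lay (h : R.Valid N d) {p q : ℕ} (hr : R.Reach p q) : R.lay q = R.lay p := by
  obtain ⟨u, hu⟩ := hr
  exact h.drun_lay hu

theorem Valid.drun_par (h : R.Valid N d) {p q : ℕ} {u : List α} (hp : 1 < R.lay p)
    (hr : drun R.st p u = some q) : drun R.st (R.par p) u = some (R.par q) :=
  (drun_map (P := fun q => 1 < R.lay q) (h := R.par) (fun q a q' h1 h2 =>
    ⟨by rwa [h.st_lay q a q' h2], h.par_st q a q' h1 h2⟩) hp hr).2

theorem Valid.reach_par (h : R.Valid N d) {p q : ℕ} (hp : 1 < R.lay p) (hr : R.Reach p q) :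
    R.Reach (R.par p) (R.par q) := by
  obtain ⟨u, hu⟩ := hr
  exact ⟨u, h.drun_par hp hu⟩

theorem root_of_lay_le {q : ℕ} (h : R.lay q ≤ 1) : R.root q = q := by
  rw [root, Nat.sub_eq_zero_of_le h]
  rfl

theorem Valid.root_par (h : R.Valid N d) {q : ℕ} (hq : 1 < R.lay q) :
    R.root (R.par q) = R.root q := by
  have := h.par_lay q hq
  rw [root, root, ← Function.iterate_succ_apply]
  congr 1
  omega

theorem Valid.par_induction (h : R.Valid N d) {P : ℕ → Prop} (h1 : ∀ q, R.lay q = 1 → P q)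
    (hs : ∀ q, 1 < R.lay q → P (R.par q) → P q) (q : ℕ) (hq : R.lay q ≠ 0) : P q := by
  generalize hx : R.lay q = x at hq
  induction x generalizing q with
  | zero => exact absurd rfl hq
  | succ x ih =>
    rcases Nat.eq_zero_or_pos x with rfl | hx0
    · exact h1 q hx
    · have := h.par_lay q (by omega)
      exact hs q (by omega) (ih _ (by omega) (by omega))

theorem Valid.lay_root (h : R.Valid N d) {q : ℕ} (hq : R.lay q ≠ 0) : R.lay (R.root q) = 1 := by
  refine h.par_induction (P := fun q => R.lay (R.root q) = 1) ?_ ?_ q hq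
  · intro q hq
    rwa [root_of_lay_le hq.le]
  · intro q hq ih
    rwa [h.root_par hq] at ih

theorem Valid.st_root (h : R.Valid N d) {q q' : ℕ} {a : α} (hs : R.st q a = some q') :
    R.st (R.root q) a = some (R.root q') := by
  have hq : R.lay q ≠ 0 := fun h0 => by simp [h.st_dead q a h0] at hs
  revert q'
  show ∀ q', R.st q a = some q' → R.st (R.root q) a = some (R.root q')
  refine h.par_induction (P := fun q => ∀ q', R.st q a = some q' →
    R.st (R.root q) a = some (R.root q')) ?_ ?_ q hq
  · intro q hq q' hs
    rwa [root_of_lay_le hq.le, root_of_lay_le (by rw [h.st_lay q a q' hs, hq])]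
  · intro q hq ih q' hs
    have := ih _ (h.par_st q a q' hq hs)
    rwa [h.root_par hq, h.root_par (by rwa [h.st_lay q a q' hs])] at this

theorem Valid.drun_root (h : R.Valid N d) {p q : ℕ} {u : List α} (hr : drun R.st p u = some q) :
    drun R.st (R.root p) u = some (R.root q) :=
  (drun_map (P := fun _ => True) (h := R.root) (fun _ _ _ _ h2 => ⟨trivial, h.st_root h2⟩)
    trivial hr).2

theorem Anc.lay_ne {p q : ℕ} (h : R.Anc p q) : R.lay q ≠ 0 := by
  cases h with
  | refl h => exact h
  | step _ h _ => omega

theorem Valid.anc_lay (h : R.Valid N d) {p q : ℕ} (ha : R.Anc p q) :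
    R.lay p ≠ 0 ∧ R.lay p ≤ R.lay q ∧ (R.lay p = R.lay q → p = q) := by
  induction ha with
  | refl hq => exact ⟨hq, le_rfl, fun _ => rfl⟩
  | step q hq hp ih =>
    have := h.par_lay q hq
    exact ⟨ih.1, by omega, by omega⟩

theorem Anc.trans {p q r : ℕ} (h₁ : R.Anc p q) (h₂ : R.Anc q r) : R.Anc p r := by
  induction h₂ with
  | refl hq => exact h₁
  | step r hr hp ih => exact .step _ hr ih

theorem Valid.anc_linear (h : R.Valid N d) {p q r : ℕ} (h₁ : R.Anc p r) (h₂ : R.Anc q r)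
    (hl : R.lay p ≤ R.lay q) : R.Anc p q := by
  induction h₂ with
  | refl hq => exact h₁
  | step r hr hp ih =>
    cases h₁ with
    | refl hr' =>
      have h1 := (h.anc_lay hp).2.1
      have h2 := h.par_lay _ hr
      omega
    | step _ _ h1 => exact ih h1

theorem Valid.exists_anc (h : R.Valid N d) {q : ℕ} (x : ℕ) (hx : 1 ≤ x) (hq : x ≤ R.lay q) :
    ∃ p, R.Anc p q ∧ R.lay p = x := by
  revert hq
  by_cases h0 : R.lay q = 0
  · intro hq
    omega
  refine h.par_induction (P := fun q => x ≤ R.lay q → ∃ p, R.Anc p q ∧ R.lay p = x) ?_ ?_ q h0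
  · intro q hq hxq
    exact ⟨q, .refl (by omega), by omega⟩
  · intro q hq ih hxq
    by_cases hxq' : x = R.lay q
    · exact ⟨q, .refl (by omega), hxq'.symm⟩
    · have := h.par_lay q hq
      obtain ⟨p, hp, hpx⟩ := ih (by omega)
      exact ⟨p, .step _ hq hp, hpx⟩

theorem Valid.anc_root (h : R.Valid N d) {q : ℕ} (hq : R.lay q ≠ 0) : R.Anc (R.root q) q := by
  refine h.par_induction (P := fun q => R.Anc (R.root q) q) ?_ ?_ q hq
  · intro q hq
    rw [root_of_lay_le hq.le]
    exact .refl (by omega)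
  · intro q hq ih
    rw [h.root_par hq] at ih
    exact .step _ hq ih

theorem Valid.root_of_anc (h : R.Valid N d) {p q : ℕ} (ha : R.Anc p q) :
    R.root p = R.root q := by
  induction ha with
  | refl => rfl
  | step q hq hp ih => rw [ih, h.root_par hq]

theorem Valid.anc_st (h : R.Valid N d) {p q q' : ℕ} {a : α} (ha : R.Anc p q)
    (hs : R.st q a = some q') : ∃ p', R.st p a = some p' ∧ R.Anc p' q' := by
  induction ha generalizing q' with
  | refl hq => exact ⟨q', hs, .refl (by rwa [h.st_lay _ a q' hs])⟩
  | step q hq hp ih =>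
    obtain ⟨p', h1, h2⟩ := ih (h.par_st q a q' hq hs)
    exact ⟨p', h1, .step _ (by rwa [h.st_lay q a q' hs]) h2⟩

theorem Recurrent.symm (hr : R.Recurrent) (h : R.Valid N d) {p q : ℕ} (hp : 1 < R.lay p)
    (hpq : R.Reach p q) : R.Reach q p := by
  obtain ⟨u, hu⟩ := hpq
  induction u generalizing p with
  | nil =>
    obtain rfl : p = q := Option.some.inj hu
    exact .refl _
  | cons a u ih =>
    rw [drun_cons, Option.bind_eq_some_iff] at hu
    obtain ⟨p', hp', hu⟩ := hu
    exact (ih (by rwa [h.st_lay p a p' hp']) hu).trans (hr.back p a p' hp hp')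

theorem Valid.strong_of_run (h : R.Valid N d) {p p' : ℕ} {w : ℕ → α} {i : ℕ} (hs : R.Strong p w)
    (hr : drun R.st p (pre w i) = some p') : R.Strong p' (shift w i) := by
  have hl := h.drun_lay hr
  refine ⟨by rw [hl]; exact hs.lay, hs.live.of_run hr, fun j c hc hj => ?_⟩
  rw [shift_shift]
  exact hs.not_live (i + j) c (by rw [hc, hl]) (by rw [drun_pre_add j hr, hj])

theorem Cert.mem_iff (h : R.Valid N d) {Λ : ℕ → Set (ℕ → α)} (hc : R.Cert Λ) {p q : ℕ}
    {w : ℕ → α} {i : ℕ} (hp : R.lay p = 1) (hr : drun R.st p (pre w i) = some q) :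
    w ∈ Λ p ↔ shift w i ∈ Λ q :=
  mem_iff_of_run (P := fun q => R.lay q = 1)
    (fun q a q' h1 h2 => by rw [h.st_lay q a q' h2, h1]) hc.res hp hr

/-- A live state that is not strongly safe has a live child at some later time. -/
theorem exists_child {p : ℕ} {w : ℕ → α} (hp : R.lay p ≠ 0) (hl : Live R.st p w)
    (hs : ¬ R.Strong p w) : ∃ i c, R.lay c = R.lay p + 1 ∧
      drun R.st p (pre w i) = some (R.par c) ∧ Live R.st c (shift w i) := by
  by_contra hno
  push Not at hno
  exact hs ⟨hp, hl, hno⟩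

/-! ### Deleting states and transitions -/

/-- `R'` arises from `R` by deleting states and transitions; the layers may change, but the
ancestor relation between the remaining states does not. -/
structure SubStep (R R' : PLA α) : Prop where
  init : R'.init = R.init
  alive : ∀ q, R'.lay q ≠ 0 → R.lay q ≠ 0
  st : ∀ q a q', R'.st q a = some q' → R.st q a = some q'
  par : ∀ q, 1 < R'.lay q → R.Anc (R'.par q) q
  anc : ∀ p q, R'.lay p ≠ 0 → R'.lay q ≠ 0 → R.Anc p q → R'.Anc p q

theorem SubStep.drun {R' : PLA α} (h : SubStep R R') {p q : ℕ} {u : List α}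
    (hr : drun R'.st p u = some q) : drun R.st p u = some q :=
  (drun_map (P := fun _ => True) (h := id) (fun q a q' _ h2 => ⟨trivial, h.st q a q' h2⟩)
    trivial hr).2

theorem SubStep.live {R' : PLA α} (h : SubStep R R') {p : ℕ} {w : ℕ → α}
    (hl : Live R'.st p w) : Live R.st p w :=
  hl.map (P := fun _ => True) (h := id) (fun q a q' _ h2 => ⟨trivial, h.st q a q' h2⟩) trivial

theorem SubStep.drun_of_live {R' : PLA α} (h : SubStep R R') {p q : ℕ} {w : ℕ → α} {i : ℕ}
    (hl : Live R'.st p w) (hr : _root_.drun R.st p (pre w i) = some q) :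
    _root_.drun R'.st p (pre w i) = some q := by
  obtain ⟨q', hq'⟩ := hl.exists_run i
  rw [hq', ← h.drun hq', hr]

open Classical in
/-- Keep only the states with the property `keep`, and between them only the transitions whose
ends satisfy `ok`. -/
noncomputable def restrict (R : PLA α) (keep : ℕ → Prop) (ok : ℕ → ℕ → Prop) : PLA α where
  lay q := if keep q then R.lay q else 0
  par := R.par
  st q a := if keep q then (R.st q a).filter fun q' => ok q q' else none
  init := R.init

section Restrict

variable {keep : ℕ → Prop} {ok : ℕ → ℕ → Prop}

theorem restrict_lay {q : ℕ} (hq : keep q) : (R.restrict keep ok).lay q = R.lay q := if_pos hq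

theorem restrict_lay_ne {q : ℕ} (hq : (R.restrict keep ok).lay q ≠ 0) : keep q ∧ R.lay q ≠ 0 := by
  simp only [restrict] at hq
  split_ifs at hq with h
  · exact ⟨h, hq⟩
  · exact absurd rfl hq

theorem restrict_st {q q' : ℕ} {a : α} :
    (R.restrict keep ok).st q a = some q' ↔ keep q ∧ R.st q a = some q' ∧ ok q q' := by
  simp only [restrict]
  split_ifs with h
  · simp [Option.filter_eq_some_iff, h]
  · simp [h]

/-- The conditions under which `restrict` yields an automaton again. -/
structure Restrictable (R : PLA α) (keep : ℕ → Prop) (ok : ℕ → ℕ → Prop) : Prop where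
  root : ∀ q, R.lay q = 1 → keep q
  ok_root : ∀ q q', R.lay q = 1 → ok q q'
  par : ∀ q, keep q → 1 < R.lay q → keep (R.par q)
  st : ∀ q a q', keep q → R.st q a = some q' → ok q q' → keep q'
  ok_par : ∀ q a q', keep q → 1 < R.lay q → R.st q a = some q' → ok q q' →
    ok (R.par q) (R.par q')

theorem Valid.restrict (h : R.Valid N d) (hk : R.Restrictable keep ok) :
    (R.restrict keep ok).Valid N d := by
  have hle : ∀ q, (R.restrict keep ok).lay q ≤ R.lay q := fun q => by
    simp only [PLA.restrict]
    split_ifs <;> omega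
  have hone : ∀ q, (R.restrict keep ok).lay q = 1 → R.lay q = 1 := fun q hq => by
    rw [← restrict_lay (restrict_lay_ne (by rw [hq]; exact one_ne_zero)).1, hq]
  have hroot : ∀ q a q', R.lay q = 1 → R.st q a = some q' →
      (R.restrict keep ok).st q a = some q' := fun q a q' hq hs =>
    restrict_st.2 ⟨hk.root q hq, hs, hk.ok_root q q' hq⟩
  refine ⟨fun q hq => h.lt q (restrict_lay_ne hq).2, fun q => (hle q).trans_lt (h.lay_lt q),
    fun q => (hle q).trans (h.lay_le q), ?_, ?_, fun q hq => h.par_root q (hone q hq), ?_, ?_, ?_,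
    ?_, ?_⟩
  · intro q a hq
    rcases hs : (R.restrict keep ok).st q a with _ | q'
    · rfl
    · obtain ⟨h1, h2, -⟩ := restrict_st.1 hs
      rw [restrict_lay h1] at hq
      rw [h.st_dead q a hq] at h2
      exact h2.symm
  · intro q a q' hs
    obtain ⟨h1, h2, h3⟩ := restrict_st.1 hs
    rw [restrict_lay h1, restrict_lay (hk.st q a q' h1 h2 h3), h.st_lay q a q' h2]
  · intro q hq
    obtain ⟨h1, -⟩ := restrict_lay_ne (R := R) (keep := keep) (ok := ok) (q := q)
      (ne_of_gt (zero_lt_one.trans hq))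
    rw [restrict_lay h1] at hq ⊢
    have : (R.restrict keep ok).lay (R.par q) = R.lay (R.par q) := restrict_lay (hk.par q h1 hq)
    exact (congrArg (· + 1) this).trans (h.par_lay q hq)
  · intro q a q' hq hs
    obtain ⟨h1, h2, h3⟩ := restrict_st.1 hs
    rw [restrict_lay h1] at hq
    exact restrict_st.2 ⟨hk.par q h1 hq, h.par_st q a q' hq h2, hk.ok_par q a q' h1 hq h2 h3⟩
  · intro q a hq
    obtain ⟨q', hq'⟩ := Option.isSome_iff_exists.1 (h.complete q a (hone q hq))
    rw [hroot q a q' (hone q hq) hq']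
    rfl
  · have : (R.restrict keep ok).lay R.init = R.lay R.init := restrict_lay (hk.root _ h.init_lay)
    exact this.trans h.init_lay
  · intro q hq
    obtain ⟨u, hu⟩ := h.reach q (hone q hq)
    exact ⟨u, (drun_map (P := fun q => R.lay q = 1) (h := id) (fun q a q' h1 h2 =>
      ⟨by rw [h.st_lay q a q' h2, h1], hroot q a q' h1 h2⟩) h.init_lay hu).2⟩

theorem Valid.subStep_restrict (h : R.Valid N d) (hk : R.Restrictable keep ok) :
    SubStep R (R.restrict keep ok) := by
  refine ⟨rfl, fun q hq => (restrict_lay_ne hq).2, fun q a q' hs => (restrict_st.1 hs).2.1, ?_, ?_⟩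
  · intro q hq
    rw [restrict_lay (restrict_lay_ne (ne_of_gt (zero_lt_one.trans hq))).1] at hq
    have := h.par_lay q hq
    exact .step _ hq (.refl (by
      show R.lay (R.par q) ≠ 0
      omega))
  · intro p q hp hq ha
    induction ha with
    | refl _ => exact .refl hp
    | step q h1 h2 ih =>
      obtain ⟨h3, -⟩ := restrict_lay_ne hq
      have hlp := h.par_lay q h1
      refine .step q (by rwa [restrict_lay h3]) (ih ?_)
      rw [restrict_lay (hk.par q h3 h1)]
      omega

theorem restrict_root {q : ℕ}
    (hq : (R.restrict keep ok).lay q ≠ 0) : (R.restrict keep ok).root q = R.root q := by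
  rw [PLA.root, PLA.root, restrict_lay (restrict_lay_ne hq).1]
  rfl

/-- To check that a restriction has the right languages, it suffices to look at words that are
strongly safe from `p` only because of the deletions, that is, to refute the case that a deleted
child is live. -/
theorem Cert.restrict (h : R.Valid N d) {Λ : ℕ → Set (ℕ → α)} (hc : R.Cert Λ)
    (hk : R.Restrictable keep ok)
    (H : ∀ p w i c, (R.restrict keep ok).Strong p w → R.lay c = R.lay p + 1 →
      drun R.st p (pre w i) = some (R.par c) → Live R.st c (shift w i) → False) :
    (R.restrict keep ok).Cert Λ := by
  constructor
  · intro q w q' hq hs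
    have hq' := restrict_lay_ne (R := R) (keep := keep) (ok := ok) (q := q) (by omega)
    rw [restrict_lay hq'.1] at hq
    exact hc.res q w q' hq (restrict_st.1 hs).2.1
  · intro p w hs
    have hp := restrict_lay_ne hs.lay
    rw [restrict_root hs.lay, restrict_lay hp.1]
    apply hc.strong
    by_contra hns
    obtain ⟨i, c, h1, h2, h3⟩ := exists_child hp.2 ((h.subStep_restrict hk).live hs.live) hns
    exact H p w i c hs h1 h2 h3

end Restrict

/-- Above the first layer, delete all transitions that do not lie on a cycle, and all states
without transitions. -/
noncomputable def trim (R : PLA α) : PLA α :=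
  R.restrict (fun q => R.lay q = 1 ∨ ∃ a q', R.st q a = some q' ∧ R.Reach q' q)
    (fun q q' => R.lay q = 1 ∨ R.Reach q' q)

theorem Valid.restrictable_trim (h : R.Valid N d) :
    R.Restrictable (fun q => R.lay q = 1 ∨ ∃ a q', R.st q a = some q' ∧ R.Reach q' q)
      (fun q q' => R.lay q = 1 ∨ R.Reach q' q) := by
  refine ⟨fun q hq => .inl hq, fun q _ hq => .inl hq, ?_, ?_, ?_⟩
  · rintro q (h1 | ⟨a, q', h1, h2⟩) hq
    · omega
    · exact .inr ⟨a, R.par q', h.par_st q a q' hq h1, h.reach_par (by rwa [h.st_lay q a q' h1]) h2⟩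
  · rintro q a q' hk hs (h1 | h1)
    · exact .inl (by rw [h.st_lay q a q' hs, h1])
    · obtain ⟨u, hu⟩ := h1
      cases u with
      | nil =>
        obtain rfl : q' = q := Option.some.inj hu
        exact .inr ⟨a, q', hs, .refl _⟩
      | cons b u =>
        rw [drun_cons, Option.bind_eq_some_iff] at hu
        obtain ⟨p, hp, hu⟩ := hu
        exact .inr ⟨b, p, hp, Reach.trans ⟨u, hu⟩ (.of_st hs)⟩
  · rintro q a q' - hq hs (h1 | h1)
    · omega
    · exact .inr (h.reach_par (by rwa [h.st_lay q a q' hs]) h1)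

/-- A live state of a finite automaton comes to a point from which on only transitions on cycles
are used. -/
theorem Valid.exists_live_trim (h : R.Valid N d) {c : ℕ} {w : ℕ → α} (hc : 1 < R.lay c)
    (hl : Live R.st c w) : ∃ j c', drun R.st c (pre w j) = some c' ∧ R.trim.lay c' = R.lay c ∧
      Live R.trim.st c' (shift w j) := by
  choose ρ hρ using hl.exists_run
  have hst : ∀ i, R.st (ρ i) (w i) = some (ρ (i + 1)) := fun i => by
    rw [← drun_pre_succ (hρ i), hρ]
  have hlay : ∀ i, R.lay (ρ i) = R.lay c := fun i => h.drun_lay (hρ i)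
  obtain ⟨x, hx, -⟩ := LayeredAutomaton.exists_liminf (pr := ρ) (d := N) fun i =>
    (h.lt _ (by rw [hlay]; omega)).le
  obtain ⟨j, -, hj⟩ := Filter.frequently_atTop.1 hx 0
  have hreach : ∀ i l, R.Reach (ρ i) (ρ (i + l)) := by
    intro i l
    induction l with
    | zero => exact .refl _
    | succ l ih => exact ih.trans (.of_st (hst (i + l)))
  have hback : ∀ l, R.Reach (ρ (j + l + 1)) (ρ (j + l)) := by
    intro l
    obtain ⟨m, hm, hm'⟩ := Filter.frequently_atTop.1 hx (j + l + 1)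
    obtain ⟨k, rfl⟩ := Nat.exists_eq_add_of_le hm
    have h1 := hreach (j + l + 1) k
    rw [hm', ← hj] at h1
    exact h1.trans (hreach j l)
  refine ⟨j, ρ j, hρ j, ?_, ?_⟩
  · rw [← hlay j]
    exact restrict_lay (.inr ⟨w j, _, hst j, hback 0⟩)
  · refine live_iff.2 ⟨fun l => ρ (j + l), rfl, fun l => restrict_st.2
      ⟨.inr ⟨_, _, hst (j + l), hback l⟩, hst (j + l), .inr (hback l)⟩⟩

theorem Valid.trim (h : R.Valid N d) : R.trim.Valid N d := h.restrict h.restrictable_trim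

theorem Valid.subStep_trim (h : R.Valid N d) : SubStep R R.trim :=
  h.subStep_restrict h.restrictable_trim

/-- A deleted child that is live eventually stays on recurrent transitions, hence gives rise to a
live child in the trimmed automaton: no word is decided on a lower layer than before. -/
theorem Cert.trim (h : R.Valid N d) {Λ : ℕ → Set (ℕ → α)} (hc : R.Cert Λ) : R.trim.Cert Λ := by
  refine hc.restrict h h.restrictable_trim ?_
  intro p w i c hs hcl hr hl
  obtain ⟨hp1, hp2⟩ := restrict_lay_ne hs.lay
  obtain ⟨j, c', h1, h2, h3⟩ := h.exists_live_trim (by omega) hl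
  rw [shift_shift] at h3
  refine hs.not_live (i + j) c' (h2.trans (hcl.trans (by rw [restrict_lay hp1]))) ?_ h3
  refine h.subStep_trim.drun_of_live hs.live ?_
  rw [drun_pre_add j hr]
  exact h.drun_par (by omega) h1

theorem Valid.recurrent_trim (h : R.Valid N d) : R.trim.Recurrent := by
  have key : ∀ p q, 1 < R.lay p → R.Reach p q → R.Reach q p → R.trim.Reach p q := by
    rintro p q hp ⟨u, hu⟩ hqp
    induction u generalizing p with
    | nil => exact ⟨[], hu⟩
    | cons a u ih =>
      rw [drun_cons, Option.bind_eq_some_iff] at hu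
      obtain ⟨p', hp', hu⟩ := hu
      have h1 : R.Reach p' p := Reach.trans ⟨u, hu⟩ hqp
      exact Reach.head (restrict_st.2 ⟨.inr ⟨a, p', hp', h1⟩, hp', .inr h1⟩)
        (ih p' (by rwa [h.st_lay p a p' hp']) hu (hqp.trans (.of_st hp')))
  constructor
  · intro q a q' hq hs
    obtain ⟨h1, h2, h3⟩ := restrict_st.1 hs
    have h4 : R.trim.lay q = R.lay q := restrict_lay h1
    rw [h4] at hq
    rcases h3 with h3 | h3
    · omega
    · exact key q' q (by rwa [h.st_lay q a q' h2]) h3 (.of_st h2)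
  · intro q hq
    obtain ⟨h1, -⟩ := restrict_lay_ne (R := R) (q := q) (ne_of_gt (zero_lt_one.trans hq))
    have h4 : R.trim.lay q = R.lay q := restrict_lay h1
    rcases h1 with h1 | ⟨a, q', h1, h2⟩
    · omega
    · exact ⟨a, q', restrict_st.2 ⟨.inr ⟨a, q', h1, h2⟩, h1, .inr h2⟩⟩

/-- Delete all states below the strongly connected component of `p`. -/
noncomputable def delete (R : PLA α) (p : ℕ) : PLA α :=
  R.restrict (fun q => ¬ R.Under p q) (fun _ _ => True)

theorem Valid.under_st (h : R.Valid N d) {p q q' : ℕ} {a : α} (hu : R.Under p q)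
    (hs : R.st q a = some q') : R.Under p q' := by
  obtain ⟨s, h1, h2⟩ := hu
  obtain ⟨s', h3, h4⟩ := h.anc_st h1 hs
  exact ⟨s', h4, h2.trans (.of_st h3)⟩

theorem Under.of_reach {p q : ℕ} (hq : R.lay q ≠ 0) (h : R.Reach p q) : R.Under p q :=
  ⟨q, .refl hq, h⟩

theorem Under.of_par {p q : ℕ} (hq : 1 < R.lay q) (hu : R.Under p (R.par q)) : R.Under p q := by
  obtain ⟨s, h1, h2⟩ := hu
  exact ⟨s, .step _ hq h1, h2⟩

theorem Valid.under_lay (h : R.Valid N d) {p q : ℕ} (hu : R.Under p q) :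
    R.lay p ≤ R.lay q ∧ R.lay q ≠ 0 ∧ R.lay p ≠ 0 ∧ (R.lay p = R.lay q → R.Reach p q) ∧
      (R.lay p ≠ R.lay q → R.Under p (R.par q)) := by
  obtain ⟨s, h1, h2⟩ := hu
  have h3 := h.reach_lay h2
  obtain ⟨h4, h5, h6⟩ := h.anc_lay h1
  refine ⟨by omega, h1.lay_ne, by omega, fun h7 => ?_, fun h7 => ?_⟩
  · rw [← h6 (by omega)]
    exact h2
  · cases h1 with
    | refl => omega
    | step _ _ h8 => exact ⟨s, h8, h2⟩

theorem Recurrent.under_st (hr : R.Recurrent) (h : R.Valid N d) {p q q' : ℕ} {a : α}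
    (hp : 1 < R.lay p) (hs : R.st q a = some q') (hu : R.Under p q') : R.Under p q := by
  have hl := h.st_lay q a q' hs
  have h1 := h.under_lay hu
  obtain ⟨u, hback⟩ := hr.back q a q' (by omega) hs
  -- Go back from `q'` to `q` along the cycle.
  exact drun_inv (P := fun r => R.Under p r) (fun r a r' h4 h5 => h.under_st h4 h5)
    hu hback

theorem Valid.restrictable_delete (h : R.Valid N d) (hr : R.Recurrent) {p : ℕ}
    (hp : 1 < R.lay p ∨ R.lay p = 0) :
    R.Restrictable (fun q => ¬ R.Under p q) (fun _ _ => True) := by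
  refine ⟨?_, fun _ _ _ => trivial, ?_, ?_, fun _ _ _ _ _ _ _ => trivial⟩
  · intro q hq hu
    have := h.under_lay hu
    omega
  · intro q h1 h2 hu
    exact h1 (hu.of_par h2)
  · intro q a q' h1 h2 _ hu
    have := h.under_lay hu
    exact h1 (hr.under_st h (by omega) h2 hu)

theorem Recurrent.restrict_delete (h : R.Valid N d) (hr : R.Recurrent) {p : ℕ}
    (hp : 1 < R.lay p ∨ R.lay p = 0) : (R.delete p).Recurrent := by
  have hk := h.restrictable_delete hr hp
  have key : ∀ q q' u, ¬ R.Under p q → drun R.st q u = some q' → (R.delete p).Reach q q' := by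
    intro q q' u hq hu
    exact ⟨u, (drun_map (P := fun q => ¬ R.Under p q) (h := id) (fun q a q' h1 h2 =>
      ⟨hk.st q a q' h1 h2 trivial, restrict_st.2 ⟨h1, h2, trivial⟩⟩) hq hu).2⟩
  constructor
  · intro q a q' hq hs
    obtain ⟨h1, h2, -⟩ := restrict_st.1 hs
    have h4 : (R.delete p).lay q = R.lay q := restrict_lay h1
    obtain ⟨u, hu⟩ := hr.back q a q' (by omega) h2
    exact key _ _ u (hk.st q a q' h1 h2 trivial) hu
  · intro q hq
    obtain ⟨h1, -⟩ := restrict_lay_ne (R := R) (q := q) (ne_of_gt (zero_lt_one.trans hq))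
    have h4 : (R.delete p).lay q = R.lay q := restrict_lay h1
    obtain ⟨a, q', h5⟩ := hr.succ q (by omega)
    exact ⟨a, q', restrict_st.2 ⟨h1, h5, trivial⟩⟩

theorem Valid.delete (h : R.Valid N d) (hr : R.Recurrent) {p : ℕ}
    (hp : 1 < R.lay p ∨ R.lay p = 0) : (R.delete p).Valid N d :=
  h.restrict (h.restrictable_delete hr hp)

/-- If the safe language of `p` is contained in that of a state `q` with the same parent in
another component, then the component of `p` is redundant: whenever a state of it is live, so is
one of the component of `q`. -/
theorem Cert.delete (h : R.Valid N d) (hr : R.Recurrent) {Λ : ℕ → Set (ℕ → α)} (hc : R.Cert Λ)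
    {p q : ℕ} (hp : 1 < R.lay p) (hq : R.lay q = R.lay p) (hpar : R.par q = R.par p)
    (hle : R.SafeLE p q) (hn : ¬ R.Reach p q) : (R.delete p).Cert Λ := by
  have hk := h.restrictable_delete hr (.inl hp)
  refine hc.restrict h hk ?_
  intro t w i c hs hcl hrun hl
  obtain ⟨ht, ht0⟩ := restrict_lay_ne hs.lay
  have hrun' := (h.subStep_restrict hk).drun_of_live hs.live hrun
  have hparc : ¬ R.Under p (R.par c) :=
    drun_inv (P := fun q => ¬ R.Under p q) (fun q a q' h1 h2 =>
      hk.st q a q' h1 (restrict_st.1 h2).2.1 trivial) ht hrun'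
  have hlive : ∀ c, ¬ R.Under p c → Live R.st c (shift w i) →
      Live (R.delete p).st c (shift w i) := fun c h1 h2 =>
    h2.map (P := fun q => ¬ R.Under p q) (h := id) (fun q a q' h1 h2 =>
      ⟨hk.st q a q' h1 h2 trivial, restrict_st.2 ⟨h1, h2, trivial⟩⟩) h1
  by_cases hcu : R.Under p c
  · have hul := h.under_lay hcu
    have hlpc : R.lay p = R.lay c := by
      by_contra hne
      exact hparc (hul.2.2.2.2 hne)
    obtain ⟨u, hu⟩ := hul.2.2.2.1 hlpc
    obtain ⟨q', hq'⟩ := Option.isSome_iff_exists.1 (hle u (by rw [hu]; rfl))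
    have hparq : R.par q' = R.par c := by
      have h1 := h.drun_par hp hu
      rw [← hpar, h.drun_par (by omega) hq'] at h1
      exact Option.some.inj h1
    have hlq' := h.drun_lay hq'
    have hlq : Live R.st q' (shift w i) := by
      refine hl.mono fun v hv => ?_
      rw [← drun_append_of v hu] at hv
      rw [← drun_append_of v hq']
      exact hle _ hv
    have hnu : ¬ R.Under p q' := by
      intro hu'
      refine hn (((h.under_lay hu').2.2.2.1 (by omega)).trans ?_)
      exact hr.symm h (by omega) ⟨u, hq'⟩
    refine hs.not_live i q' ?_ (by rw [hrun', ← hparq]; rfl) (hlive q' hnu hlq)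
    rw [restrict_lay hnu, restrict_lay ht]
    omega
  · refine hs.not_live i c ?_ hrun' (hlive c hcu hl)
    rw [restrict_lay hcu, restrict_lay ht, hcl]

end PLA

namespace PLA

variable {α : Type*} {R : PLA α} {N d : ℕ}

theorem SubStep.anc_of_anc {R' : PLA α} (h : SubStep R R') {p q : ℕ} (ha : R'.Anc p q) :
    R.Anc p q := by
  induction ha with
  | refl hq => exact .refl (h.alive _ hq)
  | step q hq hp ih => exact ih.trans (h.par q hq)

theorem SubStep.root_eq {R' : PLA α} {N' d' : ℕ} (h : SubStep R R') (hv : R.Valid N d)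
    (hv' : R'.Valid N' d') (h1 : ∀ q, R'.lay q = 1 → R.lay q = 1) {q : ℕ} (hq : R'.lay q ≠ 0) :
    R'.root q = R.root q := by
  have h2 := h.anc_of_anc (hv'.anc_root hq)
  rw [← hv.root_of_anc h2, root_of_lay_le (h1 _ (hv'.lay_root hq)).le]

/-! ### Collapsing two layers -/

open Classical in
/-- Delete the states below `p` on the layer `x` of `p` and the layer `x + 1`, and move the
states below `p` on the higher layers down by two layers. -/
noncomputable def collapse (R : PLA α) (p : ℕ) : PLA α where
  lay q := if R.Under p q then (if R.lay q ≤ R.lay p + 1 then 0 else R.lay q - 2) else R.lay q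
  par q := if R.Under p q ∧ R.lay q = R.lay p + 2 then R.par (R.par (R.par q)) else R.par q
  st q a := if R.Under p q ∧ R.lay q ≤ R.lay p + 1 then none else R.st q a
  init := R.init

section Collapse

variable {p : ℕ}

theorem collapse_lay_under {q : ℕ} (hu : R.Under p q) (hq : R.lay p + 1 < R.lay q) :
    (R.collapse p).lay q + 2 = R.lay q := by
  simp only [collapse]
  rw [if_pos hu, if_neg (by omega)]
  omega

theorem collapse_lay_not {q : ℕ} (hu : ¬ R.Under p q) : (R.collapse p).lay q = R.lay q := by
  simp only [collapse]
  rw [if_neg hu]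

theorem collapse_lay_gone {q : ℕ} (hu : R.Under p q) (hq : R.lay q ≤ R.lay p + 1) :
    (R.collapse p).lay q = 0 := by
  simp only [collapse]
  rw [if_pos hu, if_pos hq]

theorem collapse_par_of {q : ℕ} (hu : R.Under p q) (hq : R.lay q = R.lay p + 2) :
    (R.collapse p).par q = R.par (R.par (R.par q)) := if_pos ⟨hu, hq⟩

theorem collapse_par_not {q : ℕ} (hu : ¬ (R.Under p q ∧ R.lay q = R.lay p + 2)) :
    (R.collapse p).par q = R.par q := if_neg hu

theorem collapse_st {q q' : ℕ} {a : α} : (R.collapse p).st q a = some q' ↔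
    ¬ (R.Under p q ∧ R.lay q ≤ R.lay p + 1) ∧ R.st q a = some q' := by
  simp only [collapse]
  split_ifs with h <;> simp [h]

/-- A state that is left after collapsing. -/
theorem collapse_cases {q : ℕ} (hq : (R.collapse p).lay q ≠ 0) :
    (¬ R.Under p q ∧ (R.collapse p).lay q = R.lay q) ∨
      (R.Under p q ∧ R.lay p + 1 < R.lay q ∧ (R.collapse p).lay q + 2 = R.lay q) := by
  by_cases hu : R.Under p q
  · by_cases hl : R.lay q ≤ R.lay p + 1
    · exact absurd (collapse_lay_gone hu hl) hq
    · exact .inr ⟨hu, by omega, collapse_lay_under hu (by omega)⟩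
  · exact .inl ⟨hu, collapse_lay_not hu⟩

theorem Recurrent.under_iff (hr : R.Recurrent) (h : R.Valid N d) {q q' : ℕ} {a : α}
    (hp : 1 < R.lay p) (hs : R.st q a = some q') : R.Under p q' ↔ R.Under p q :=
  ⟨hr.under_st h hp hs, fun hu => h.under_st hu hs⟩

/-- The third ancestor of a state on the lowest layer that is moved. -/
theorem Valid.collapse_par (h : R.Valid N d) (hp : 1 < R.lay p) {q : ℕ} (hu : R.Under p q)
    (hq : R.lay q = R.lay p + 2) : R.Under p (R.par q) ∧ R.lay (R.par q) = R.lay p + 1 ∧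
      R.Under p (R.par (R.par q)) ∧ R.lay (R.par (R.par q)) = R.lay p ∧
      ¬ R.Under p (R.par (R.par (R.par q))) ∧ R.lay (R.par (R.par (R.par q))) + 1 = R.lay p := by
  have h1 := h.par_lay q (by omega)
  have h2 := h.par_lay (R.par q) (by omega)
  have h3 := h.par_lay (R.par (R.par q)) (by omega)
  have h4 := (h.under_lay hu).2.2.2.2 (by omega)
  have h5 := (h.under_lay h4).2.2.2.2 (by omega)
  refine ⟨h4, by omega, h5, by omega, fun h6 => ?_, by omega⟩
  have := h.under_lay h6
  omega

theorem Valid.collapse (h : R.Valid N d) (hr : R.Recurrent) (hp : 1 < R.lay p) :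
    (R.collapse p).Valid N d := by
  have hle : ∀ q, (R.collapse p).lay q ≤ R.lay q := fun q => by
    by_cases hq : (R.collapse p).lay q = 0
    · omega
    · rcases collapse_cases hq with h1 | h1 <;> omega
  have hone : ∀ q, (R.collapse p).lay q = 1 → ¬ R.Under p q ∧ R.lay q = 1 := fun q hq => by
    rcases collapse_cases (R := R) (p := p) (q := q) (by omega) with h1 | h1
    · exact ⟨h1.1, by omega⟩
    · omega
  have hnot : ∀ q, R.lay q = 1 → ¬ R.Under p q := fun q hq hu => by
    have := h.under_lay hu
    omega
  refine ⟨fun q hq => h.lt q (by have := hle q; omega), fun q => (hle q).trans_lt (h.lay_lt q),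
    fun q => (hle q).trans (h.lay_le q), ?_, ?_, ?_, ?_, ?_, ?_, ?_, ?_⟩
  · intro q a hq
    rcases hs : (R.collapse p).st q a with _ | q'
    · rfl
    · obtain ⟨h1, h2⟩ := collapse_st.1 hs
      have h0 : R.lay q ≠ 0 := fun h0 => by simp [h.st_dead q a h0] at h2
      by_cases hu : R.Under p q
      · have h3 : R.lay p + 1 < R.lay q := by
          by_contra h3
          exact h1 ⟨hu, by omega⟩
        have h4 := collapse_lay_under hu h3
        omega
      · rw [collapse_lay_not hu] at hq
        exact absurd hq h0
  · intro q a q' hs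
    obtain ⟨h1, h2⟩ := collapse_st.1 hs
    have h3 := h.st_lay q a q' h2
    have h4 := hr.under_iff h hp h2
    by_cases hu : R.Under p q
    · have hlt : R.lay p + 1 < R.lay q := by
        by_contra h3
        exact h1 ⟨hu, by omega⟩
      have := collapse_lay_under hu hlt
      have := collapse_lay_under (h4.2 hu) (by omega)
      omega
    · rw [collapse_lay_not hu, collapse_lay_not (h4.not.2 hu), h3]
  · intro q hq
    obtain ⟨h1, h2⟩ := hone q hq
    rw [collapse_par_not (by tauto)]
    exact h.par_root q h2
  · intro q hq
    rcases collapse_cases (R := R) (p := p) (q := q) (by omega) with ⟨h1, h2⟩ | ⟨h1, h2, h3⟩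
    · rw [collapse_par_not (by tauto), collapse_lay_not fun hu => h1 (hu.of_par (by omega)), h2]
      exact h.par_lay q (by omega)
    · by_cases h4 : R.lay q = R.lay p + 2
      · have h5 := h.collapse_par hp h1 h4
        rw [collapse_par_of h1 h4, collapse_lay_not h5.2.2.2.2.1]
        omega
      · rw [collapse_par_not (by tauto)]
        have h5 := (h.under_lay h1).2.2.2.2 (by omega)
        have h6 := h.par_lay q (by omega)
        have := collapse_lay_under h5 (by omega)
        omega
  · intro q a q' hq hs
    obtain ⟨h1, h2⟩ := collapse_st.1 hs
    have h3 := h.st_lay q a q' h2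
    have h4 := hr.under_iff h hp h2
    rcases collapse_cases (R := R) (p := p) (q := q) (by omega) with ⟨h5, h6⟩ | ⟨h5, h6, h7⟩
    · rw [collapse_par_not (by tauto), collapse_par_not (by tauto)]
      exact collapse_st.2 ⟨fun h7 => h5 (h7.1.of_par (by omega)),
        h.par_st q a q' (by omega) h2⟩
    · by_cases h8 : R.lay q = R.lay p + 2
      · have h9 := h.collapse_par hp h5 h8
        rw [collapse_par_of h5 h8, collapse_par_of (h4.2 h5) (by omega)]
        refine collapse_st.2 ⟨fun h10 => h9.2.2.2.2.1 h10.1, ?_⟩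
        exact h.par_st _ a _ (by omega) (h.par_st _ a _ (by omega)
          (h.par_st q a q' (by omega) h2))
      · rw [collapse_par_not (by tauto), collapse_par_not (by omega)]
        have h9 := h.par_lay q (by omega)
        exact collapse_st.2 ⟨by omega, h.par_st q a q' (by omega) h2⟩
  · intro q a hq
    obtain ⟨h1, h2⟩ := hone q hq
    obtain ⟨q', hq'⟩ := Option.isSome_iff_exists.1 (h.complete q a h2)
    rw [collapse_st.2 ⟨by tauto, hq'⟩]
    rfl
  · exact (collapse_lay_not (hnot _ h.init_lay)).trans h.init_lay
  · intro q hq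
    obtain ⟨u, hu⟩ := h.reach q (hone q hq).2
    exact ⟨u, (drun_map (P := fun q => R.lay q = 1) (h := id) (fun q a q' h1 h2 =>
      ⟨by rw [h.st_lay q a q' h2, h1], collapse_st.2 ⟨by have := hnot q h1; tauto, h2⟩⟩)
      h.init_lay hu).2⟩

theorem Valid.subStep_collapse (h : R.Valid N d) (hp : 1 < R.lay p) :
    SubStep R (R.collapse p) := by
  refine ⟨rfl, fun q hq => ?_, fun q a q' hs => (collapse_st.1 hs).2, ?_, ?_⟩
  · rcases collapse_cases hq with h1 | h1 <;> omega
  · intro q hq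
    have hl : 1 < R.lay q := by
      rcases collapse_cases (R := R) (p := p) (q := q) (by omega) with h1 | h1 <;> omega
    have h1 := h.par_lay q hl
    by_cases h4 : R.Under p q ∧ R.lay q = R.lay p + 2
    · have h5 := h.collapse_par hp h4.1 h4.2
      rw [collapse_par_of h4.1 h4.2]
      exact .step _ hl (.step _ (by omega) (.step _ (by omega) (.refl (by omega))))
    · rw [collapse_par_not h4]
      exact .step _ hl (.refl (by omega))
  · intro r q hr hq ha
    generalize hx : R.lay q = x
    induction x using Nat.strong_induction_on generalizing q with
    | _ x ih =>
      cases ha with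
      | refl _ => exact .refl hr
      | step _ h1 h2 =>
        have h3 := h.par_lay q h1
        rcases collapse_cases hq with ⟨h5, h6⟩ | ⟨h5, h6, h7⟩
        · refine .step _ (by omega) ?_
          rw [collapse_par_not (by tauto)]
          refine ih _ (by omega) _ ?_ h2 rfl
          rw [collapse_lay_not fun hu => h5 (hu.of_par h1)]
          omega
        · refine .step _ (by omega) ?_
          by_cases h8 : R.lay q = R.lay p + 2
          · have h9 := h.collapse_par hp h5 h8
            rw [collapse_par_of h5 h8]
            -- The ancestors on the two layers in between are deleted.
            have h10 : R.Anc r (R.par (R.par q)) := by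
              cases h2 with
              | refl _ => exact absurd (collapse_lay_gone h9.1 (by omega)) hr
              | step _ _ h10 => exact h10
            have h11 : R.Anc r (R.par (R.par (R.par q))) := by
              cases h10 with
              | refl _ => exact absurd (collapse_lay_gone h9.2.2.1 (by omega)) hr
              | step _ _ h10 => exact h10
            refine ih _ (by omega) _ ?_ h11 rfl
            rw [collapse_lay_not h9.2.2.2.2.1]
            omega
          · rw [collapse_par_not (by tauto)]
            refine ih _ (by omega) _ ?_ h2 rfl
            have h9 := (h.under_lay h5).2.2.2.2 (by omega)
            have := collapse_lay_under h9 (by omega)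
            omega

theorem Recurrent.collapse_inv (hr : R.Recurrent) (h : R.Valid N d) (hp : 1 < R.lay p)
    {q q' : ℕ} {a : α} (hq : ¬ (R.Under p q ∧ R.lay q ≤ R.lay p + 1))
    (hs : R.st q a = some q') : ¬ (R.Under p q' ∧ R.lay q' ≤ R.lay p + 1) ∧
      (R.collapse p).st (id q) a = some (id q') := by
  refine ⟨?_, collapse_st.2 ⟨hq, hs⟩⟩
  rwa [hr.under_iff h hp hs, h.st_lay q a q' hs]

theorem Recurrent.collapse (h : R.Valid N d) (hr : R.Recurrent) (hp : 1 < R.lay p) :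
    (R.collapse p).Recurrent := by
  constructor
  · intro q a q' hq hs
    obtain ⟨h1, h2⟩ := collapse_st.1 hs
    have hl : 1 < R.lay q := by
      rcases collapse_cases (R := R) (p := p) (q := q) (by omega) with h1 | h1 <;> omega
    obtain ⟨u, hu⟩ := hr.back q a q' hl h2
    exact ⟨u, (drun_map (h := id) (fun q a q' h3 h4 => hr.collapse_inv h hp h3 h4)
      (hr.collapse_inv h hp h1 h2).1 hu).2⟩
  · intro q hq
    have h1 : ¬ (R.Under p q ∧ R.lay q ≤ R.lay p + 1) := by
      rcases collapse_cases (R := R) (p := p) (q := q) (by omega) with h1 | h1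
      · tauto
      · omega
    have hl : 1 < R.lay q := by
      rcases collapse_cases (R := R) (p := p) (q := q) (by omega) with h1 | h1 <;> omega
    obtain ⟨a, q', h5⟩ := hr.succ q hl
    exact ⟨a, q', collapse_st.2 ⟨h1, h5⟩⟩

/-- If the child `c₀` of `p` has the same safe words as `p`, then every state of the component of
`p`, on the layer `x`, has a child that is live on every word on which the state is, so that no
word is decided on the layer `x` there. The words that were decided on the deleted layer `x + 1`
are now decided on the layer `x - 1`, of the same parity, and the layers above keep their parity
when they are moved by two. -/
theorem Cert.collapse (h : R.Valid N d) (hr : R.Recurrent) {Λ : ℕ → Set (ℕ → α)} (hc : R.Cert Λ)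
    (hp : 1 < R.lay p) {c₀ : ℕ} (hc₀ : R.lay c₀ = R.lay p + 1) (hpar₀ : R.par c₀ = p)
    (hle : R.SafeLE p c₀) : (R.collapse p).Cert Λ := by
  have hsub := h.subStep_collapse hp
  have hv := h.collapse hr hp
  have hone : ∀ q, (R.collapse p).lay q = 1 → R.lay q = 1 := fun q hq => by
    rcases collapse_cases (R := R) (p := p) (q := q) (by omega) with h1 | h1
    · omega
    · omega
  have hlive : ∀ {q : ℕ} {w : ℕ → α}, ¬ (R.Under p q ∧ R.lay q ≤ R.lay p + 1) → Live R.st q w →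
      Live (R.collapse p).st q w := fun hq hl =>
    hl.map (h := id) (fun q a q' h3 h4 => hr.collapse_inv h hp h3 h4) hq
  constructor
  · intro q w q' hq hs
    exact hc.res q w q' (hone q hq) (hsub.st _ _ _ hs)
  · intro t w hs
    rw [hsub.root_eq h hv hone hs.lay]
    have hl := hsub.live hs.live
    rcases collapse_cases hs.lay with ⟨h1, h2⟩ | ⟨h1, h2, h3⟩
    · rw [h2]
      have ht0 : R.lay t ≠ 0 := h2 ▸ hs.lay
      by_cases hst : R.Strong t w
      · exact hc.strong t w hst
      obtain ⟨i, c, hcl, hrun, hcw⟩ := exists_child ht0 hl hst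
      have hrun' := hsub.drun_of_live hs.live hrun
      have hparc : ¬ R.Under p (R.par c) :=
        drun_inv (P := fun q => ¬ R.Under p q) (fun q a q' h1 h2 => by
          rwa [hr.under_iff h hp h2]) h1 hrun
      by_cases hcu : R.Under p c
      · -- The live child is in the component of `p`, so the corresponding child `c'` is live.
        have hlpc : R.lay p = R.lay c := by
          by_contra hne
          exact hparc ((h.under_lay hcu).2.2.2.2 hne)
        obtain ⟨u, hu⟩ := (h.under_lay hcu).2.2.2.1 hlpc
        obtain ⟨c', hc'⟩ := Option.isSome_iff_exists.1 (hle u (by rw [hu]; rfl))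
        have hparc' : R.par c' = c := by
          have := h.drun_par (by omega) hc'
          rw [hpar₀, hu] at this
          exact (Option.some.inj this).symm
        have hlc' := h.drun_lay hc'
        have hc'w : Live R.st c' (shift w i) := by
          refine hcw.mono fun v hv => ?_
          rw [← drun_append_of v hu] at hv
          rw [← drun_append_of v hc']
          exact hle _ hv
        by_cases hst' : R.Strong c' (shift w i)
        · have h4 := hc.strong _ _ hst'
          rw [← h.root_par (by omega), hparc', ← h.root_par (by omega)] at h4
          rw [hc.mem_iff h (h.lay_root ht0) (h.drun_root hrun), h4, hlc', hc₀, hlpc, hcl]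
          simp [Nat.even_add_one]
        · exfalso
          obtain ⟨j, f, hfl, hfrun, hfw⟩ := exists_child (by omega) hc'w hst'
          rw [shift_shift] at hfw
          have hpc' : R.Under p (R.par f) := by
            refine drun_inv (P := fun q => R.Under p q) (fun q a q' h1 h2 => h.under_st h1 h2)
              ?_ hfrun
            refine Under.of_par (by omega) ?_
            rwa [hparc']
          have hfu : R.Under p f := hpc'.of_par (by omega)
          refine hs.not_live (i + j) f ?_ ?_ (hlive (by omega) hfw)
          · have := collapse_lay_under hfu (by omega)
            omega
          · rw [collapse_par_of hfu (by omega)]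
            refine hsub.drun_of_live hs.live ?_
            rw [drun_pre_add j hrun]
            have h4 := h.drun_par (by omega) hfrun
            rw [hparc'] at h4
            exact h.drun_par (by omega) h4
      · exfalso
        refine hs.not_live i c ?_ ?_ (hlive (by tauto) hcw)
        · rw [collapse_lay_not hcu, h2, hcl]
        · rw [hrun', collapse_par_not (by tauto)]
    · have hst : R.Strong t w := by
        by_contra hst
        obtain ⟨i, c, hcl, hrun, hcw⟩ := exists_child (by omega) hl hst
        have hparc : R.Under p (R.par c) :=
          drun_inv (P := fun q => R.Under p q) (fun q a q' h1 h2 => h.under_st h1 h2) h1 hrun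
        have hcu : R.Under p c := hparc.of_par (by omega)
        refine hs.not_live i c ?_ ?_ (hlive (by omega) hcw)
        · have := collapse_lay_under hcu (by omega)
          omega
        · rw [collapse_par_not (by omega)]
          exact hsub.drun_of_live hs.live hrun
      rw [hc.strong t w hst, ← h3]
      simp [Nat.even_add]

end Collapse

/-! ### Quotients -/

open Classical in
/-- The least number with the property `P`, or `N` if no number below `N` has it. -/
noncomputable def leastBelow (N : ℕ) (P : ℕ → Prop) : ℕ :=
  ∑ x ∈ Finset.range N, if ∃ y ≤ x, P y then 0 else 1

theorem leastBelow_spec {N : ℕ} {P : ℕ → Prop} (h : ∃ x < N, P x) :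
    P (leastBelow N P) ∧ ∀ y, P y → leastBelow N P ≤ y := by
  classical
  obtain ⟨x, hx, hPx⟩ := h
  have hex : ∃ x, P x := ⟨x, hPx⟩
  have hfind : leastBelow N P = Nat.find hex := by
    have h1 : ∀ y, (∃ z ≤ y, P z) ↔ Nat.find hex ≤ y := fun y =>
      ⟨fun ⟨z, hz, hPz⟩ => (Nat.find_le hPz).trans hz, fun hy => ⟨_, hy, Nat.find_spec hex⟩⟩
    have h2 : Nat.find hex < N := (Nat.find_le hPx).trans_lt hx
    unfold leastBelow
    simp only [h1]
    rw [Finset.sum_ite]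
    simp only [Finset.sum_const_zero, zero_add, Finset.sum_const, smul_eq_mul, mul_one, not_le]
    rw [show (Finset.range N).filter (fun y => y < Nat.find hex) = Finset.range (Nat.find hex) by
      ext y
      simp only [Finset.mem_filter, Finset.mem_range]
      omega]
    simp
  rw [hfind]
  exact ⟨Nat.find_spec hex, fun y hy => Nat.find_le hy⟩

theorem leastBelow_of_not {N : ℕ} {P : ℕ → Prop} (h : ¬ ∃ x < N, P x) : leastBelow N P = N := by
  unfold leastBelow
  rw [Finset.sum_congr rfl (g := fun _ => 1)]
  · simp
  · intro x hx
    rw [if_neg]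
    rintro ⟨y, hy, hP⟩
    exact h ⟨y, by simp at hx; omega, hP⟩

/-- A choice of representatives of the classes of a congruence. -/
structure IsRep (R : PLA α) (rep : ℕ → ℕ) : Prop where
  lay : ∀ q, R.lay (rep q) = R.lay q
  idem : ∀ q, rep (rep q) = rep q
  st : ∀ q a, (R.st (rep q) a).map rep = (R.st q a).map rep
  par : ∀ q, 1 < R.lay q → rep (R.par (rep q)) = rep (R.par q)

open Classical in
/-- The quotient with respect to a congruence with the representatives `rep`. -/
noncomputable def quot (R : PLA α) (rep : ℕ → ℕ) : PLA α where
  lay q := if rep q = q then R.lay q else 0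
  par q := rep (R.par q)
  st q a := if rep q = q then (R.st q a).map rep else none
  init := rep R.init

section Quot

variable {rep : ℕ → ℕ}

theorem IsRep.lay_rep (hrep : R.IsRep rep) (q : ℕ) : (R.quot rep).lay (rep q) = R.lay q := by
  simp only [quot]
  rw [if_pos (hrep.idem q), hrep.lay]

theorem quot_lay_ne {q : ℕ} (h : (R.quot rep).lay q ≠ 0) :
    rep q = q ∧ (R.quot rep).lay q = R.lay q := by
  simp only [quot] at h ⊢
  split_ifs at h ⊢ with h1
  · exact ⟨h1, rfl⟩
  · exact absurd rfl h

theorem IsRep.st_rep (hrep : R.IsRep rep) {q q' : ℕ} {a : α} (h : R.st q a = some q') :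
    (R.quot rep).st (rep q) a = some (rep q') := by
  simp only [quot]
  rw [if_pos (hrep.idem q), hrep.st, h]
  rfl

theorem IsRep.exists_st (hrep : R.IsRep rep) {q r : ℕ} {a : α}
    (h : (R.quot rep).st (rep q) a = some r) : ∃ q', R.st q a = some q' ∧ rep q' = r := by
  simp only [quot] at h
  rw [if_pos (hrep.idem q), hrep.st, Option.map_eq_some_iff] at h
  exact h

theorem quot_st {q r : ℕ} {a : α} (h : (R.quot rep).st q a = some r) :
    rep q = q ∧ ∃ q', R.st q a = some q' ∧ rep q' = r := by
  simp only [quot] at h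
  split_ifs at h with h1
  · exact ⟨h1, Option.map_eq_some_iff.1 h⟩

theorem IsRep.drun_rep (hrep : R.IsRep rep) {q q' : ℕ} {u : List α}
    (h : drun R.st q u = some q') : drun (R.quot rep).st (rep q) u = some (rep q') :=
  (drun_map (P := fun _ => True) (h := rep) (fun _ _ _ _ h2 => ⟨trivial, hrep.st_rep h2⟩)
    trivial h).2

theorem IsRep.exists_drun (hrep : R.IsRep rep) {q r : ℕ} {u : List α}
    (h : drun (R.quot rep).st (rep q) u = some r) :
    ∃ q', drun R.st q u = some q' ∧ rep q' = r := by
  induction u generalizing q with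
  | nil => exact ⟨q, rfl, Option.some.inj h⟩
  | cons a u ih =>
    rw [drun_cons, Option.bind_eq_some_iff] at h
    obtain ⟨p, hp, h⟩ := h
    obtain ⟨q', h1, rfl⟩ := hrep.exists_st hp
    rw [drun_cons_of u h1]
    exact ih h

theorem IsRep.isSome_iff (hrep : R.IsRep rep) (q : ℕ) (u : List α) :
    (drun (R.quot rep).st (rep q) u).isSome ↔ (drun R.st q u).isSome := by
  simp only [Option.isSome_iff_exists]
  constructor
  · rintro ⟨r, hr⟩
    obtain ⟨q', h, -⟩ := hrep.exists_drun hr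
    exact ⟨q', h⟩
  · rintro ⟨q', h⟩
    exact ⟨_, hrep.drun_rep h⟩

theorem Valid.quot (h : R.Valid N d) (hrep : R.IsRep rep) : (R.quot rep).Valid N d := by
  have hle : ∀ q, (R.quot rep).lay q ≤ R.lay q := fun q => by
    simp only [PLA.quot]
    split_ifs <;> omega
  refine ⟨fun q hq => h.lt q (by have := hle q; omega), fun q => (hle q).trans_lt (h.lay_lt q),
    fun q => (hle q).trans (h.lay_le q), ?_, ?_, ?_, ?_, ?_, ?_, ?_, ?_⟩
  · intro q a hq
    rcases hs : (R.quot rep).st q a with _ | r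
    · rfl
    · obtain ⟨h1, q', h2, -⟩ := quot_st hs
      rw [← h1, hrep.lay_rep] at hq
      simp [h.st_dead q a hq] at h2
  · intro q a r hs
    obtain ⟨h1, q', h2, rfl⟩ := quot_st hs
    rw [hrep.lay_rep, h.st_lay q a q' h2, ← hrep.lay_rep q, h1]
  · intro q hq
    obtain ⟨h1, h2⟩ := quot_lay_ne (R := R) (rep := rep) (q := q) (by omega)
    show rep (R.par q) = q
    rw [h.par_root q (by omega), h1]
  · intro q hq
    obtain ⟨h1, h2⟩ := quot_lay_ne (R := R) (rep := rep) (q := q) (by omega)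
    show (R.quot rep).lay (rep (R.par q)) + 1 = _
    rw [hrep.lay_rep, h2]
    exact h.par_lay q (by omega)
  · intro q a r hq hs
    obtain ⟨h1, h2⟩ := quot_lay_ne (R := R) (rep := rep) (q := q) (by omega)
    obtain ⟨-, q', h3, rfl⟩ := quot_st hs
    have h4 := hrep.st_rep (h.par_st q a q' (by omega) h3)
    have h5 := hrep.par q' (by rw [h.st_lay q a q' h3]; omega)
    show (R.quot rep).st (rep (R.par q)) a = some (rep (R.par (rep q')))
    rw [h4, h5]
  · intro q a hq
    obtain ⟨h1, h2⟩ := quot_lay_ne (R := R) (rep := rep) (q := q) (by omega)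
    obtain ⟨q', hq'⟩ := Option.isSome_iff_exists.1 (h.complete q a (by omega))
    rw [← h1, hrep.st_rep hq']
    rfl
  · exact (hrep.lay_rep _).trans h.init_lay
  · intro q hq
    obtain ⟨h1, h2⟩ := quot_lay_ne (R := R) (rep := rep) (q := q) (by omega)
    obtain ⟨u, hu⟩ := h.reach q (by omega)
    refine ⟨u, ?_⟩
    have := hrep.drun_rep hu
    rwa [h1] at this

theorem Valid.root_rep (h : R.Valid N d) (hrep : R.IsRep rep) {q : ℕ} (hq : R.lay q ≠ 0) :
    (R.quot rep).root (rep q) = rep (R.root q) := by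
  refine h.par_induction (P := fun q => (R.quot rep).root (rep q) = rep (R.root q)) ?_ ?_ q hq
  · intro q hq
    rw [root_of_lay_le hq.le, root_of_lay_le]
    rw [hrep.lay_rep, hq]
  · intro q hq ih
    rw [h.root_par hq, ← hrep.par q hq] at ih
    rw [← ih]
    exact ((h.quot hrep).root_par (by rwa [hrep.lay_rep])).symm

/-- Passing to representatives changes neither the runs nor the liveness of the children, hence not
the layers on which words are decided. -/
theorem Cert.quot (h : R.Valid N d) {Λ : ℕ → Set (ℕ → α)} (hc : R.Cert Λ) (hrep : R.IsRep rep)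
    (hΛ : ∀ q, R.lay q = 1 → Λ (rep q) = Λ q) : (R.quot rep).Cert Λ := by
  constructor
  · intro q w r hq hs
    obtain ⟨h1, h2⟩ := quot_lay_ne (R := R) (rep := rep) (q := q) (by omega)
    obtain ⟨-, q', h3, rfl⟩ := quot_st hs
    rw [hΛ q' (by rw [h.st_lay _ _ _ h3]; omega)]
    exact hc.res q w q' (by omega) h3
  · intro p w hs
    obtain ⟨h1, h2⟩ := quot_lay_ne hs.lay
    have hp : R.lay p ≠ 0 := h2 ▸ hs.lay
    have hs' : R.Strong p w := by
      refine ⟨hp, hs.live.mono fun u hu => ?_, fun i c hcl hrun hl => ?_⟩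
      · rwa [← hrep.isSome_iff, h1]
      · refine hs.not_live i (rep c) (by rw [hrep.lay_rep, hcl, h2]) ?_
          (hl.mono fun u hu => (hrep.isSome_iff c u).2 hu)
        have := hrep.drun_rep hrun
        rw [h1] at this
        rw [this]
        exact congrArg some (hrep.par c (by omega)).symm
    have h3 := h.root_rep hrep hp
    rw [h1] at h3
    rw [h3, hΛ _ (h.lay_root hp), h2]
    exact hc.strong p w hs'

theorem Recurrent.quot (hr : R.Recurrent) (hrep : R.IsRep rep) : (R.quot rep).Recurrent := by
  constructor
  · intro q a r hq hs
    obtain ⟨h1, h2⟩ := quot_lay_ne (R := R) (rep := rep) (q := q) (by omega)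
    obtain ⟨-, q', h3, rfl⟩ := quot_st hs
    obtain ⟨u, hu⟩ := hr.back q a q' (by omega) h3
    refine ⟨u, ?_⟩
    have := hrep.drun_rep hu
    rwa [h1] at this
  · intro q hq
    obtain ⟨h1, h2⟩ := quot_lay_ne (R := R) (rep := rep) (q := q) (by omega)
    obtain ⟨a, q', h3⟩ := hr.succ q (by omega)
    refine ⟨a, rep q', ?_⟩
    have := hrep.st_rep h3
    rwa [h1] at this

/-- The equivalence relations by which an automaton can be divided. -/
structure IsCongr (R : PLA α) (E : ℕ → ℕ → Prop) : Prop where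
  lay : ∀ p q, E p q → R.lay p = R.lay q ∧ R.lay q ≠ 0
  refl : ∀ q, R.lay q ≠ 0 → E q q
  symm : ∀ p q, E p q → E q p
  trans : ∀ p q r, E p q → E q r → E p r
  st : ∀ p q a p', E p q → R.st p a = some p' → ∃ q', R.st q a = some q' ∧ E p' q'
  par : ∀ p q, E p q → 1 < R.lay p → E (R.par p) (R.par q)

open Classical in
/-- The least state that is equivalent to `q`. -/
noncomputable def repOf (R : PLA α) (N : ℕ) (E : ℕ → ℕ → Prop) (q : ℕ) : ℕ :=
  if R.lay q = 0 then q else leastBelow N fun p => E p q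

theorem Valid.repOf_spec (h : R.Valid N d) {E : ℕ → ℕ → Prop} (hE : R.IsCongr E) {q : ℕ}
    (hq : R.lay q ≠ 0) : E (R.repOf N E q) q ∧ ∀ p, E p q → R.repOf N E q ≤ p := by
  rw [repOf, if_neg hq]
  exact leastBelow_spec (P := fun p => E p q) ⟨q, h.lt q hq, hE.refl q hq⟩

theorem Valid.repOf_congr (h : R.Valid N d) {E : ℕ → ℕ → Prop} (hE : R.IsCongr E) {p q : ℕ}
    (hpq : E p q) : R.repOf N E p = R.repOf N E q := by
  have hq := (hE.lay p q hpq).2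
  have hp : R.lay p ≠ 0 := by rw [(hE.lay p q hpq).1]; exact hq
  obtain ⟨h1, h2⟩ := h.repOf_spec hE hp
  obtain ⟨h3, h4⟩ := h.repOf_spec hE hq
  exact le_antisymm (h2 _ (hE.trans _ _ _ h3 (hE.symm _ _ hpq))) (h4 _ (hE.trans _ _ _ h1 hpq))

theorem Valid.isRep_repOf (h : R.Valid N d) {E : ℕ → ℕ → Prop} (hE : R.IsCongr E) :
    R.IsRep (R.repOf N E) := by
  have hdead : ∀ q, R.lay q = 0 → R.repOf N E q = q := fun q hq => by rw [repOf, if_pos hq]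
  refine ⟨fun q => ?_, fun q => ?_, fun q a => ?_, fun q hq => ?_⟩
  · by_cases hq : R.lay q = 0
    · rw [hdead q hq]
    · exact (hE.lay _ _ (h.repOf_spec hE hq).1).1
  · by_cases hq : R.lay q = 0
    · rw [hdead q hq, hdead q hq]
    · exact h.repOf_congr hE (h.repOf_spec hE hq).1
  · by_cases hq : R.lay q = 0
    · rw [hdead q hq]
    · have h1 := (h.repOf_spec hE hq).1
      rcases hs : R.st q a with _ | q'
      · rcases hs' : R.st (R.repOf N E q) a with _ | q''
        · rfl
        · obtain ⟨p, hp, -⟩ := hE.st _ _ a _ h1 hs'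
          rw [hs] at hp
          simp at hp
      · obtain ⟨p, hp, hp'⟩ := hE.st _ _ a _ (hE.symm _ _ h1) hs
        rw [hp]
        exact congrArg some (h.repOf_congr hE (hE.symm _ _ hp'))
  · have h1 := (h.repOf_spec hE (q := q) (by omega)).1
    refine h.repOf_congr hE (hE.par _ _ h1 ?_)
    rwa [(hE.lay _ _ h1).1]

end Quot

end PLA

namespace PLA

variable {α : Type*} {R : PLA α} {N d : ℕ}

/-! ### The minimisation procedure -/

/-- `p` violates the second condition of normality. -/
def CollapseDefect (R : PLA α) (p : ℕ) : Prop :=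
  1 < R.lay p ∧ ∃ c, 1 < R.lay c ∧ R.par c = p ∧ R.SafeLE p c

/-- `p` violates centralisation. -/
def DeleteDefect (R : PLA α) (p : ℕ) : Prop :=
  1 < R.lay p ∧ ∃ q, R.lay q = R.lay p ∧ R.par q = R.par p ∧ R.SafeLE p q ∧ ¬ R.Reach p q

/-- `p` and `q` are siblings with the same safe language. -/
def MergeRel (R : PLA α) (p q : ℕ) : Prop :=
  R.lay p ≠ 0 ∧ R.lay p = R.lay q ∧ R.par p = R.par q ∧ R.SafeLE p q ∧ R.SafeLE q p

/-- Collapse at the first state that violates the second condition of normality, if any. -/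
noncomputable def collapseFirst (R : PLA α) (N : ℕ) : PLA α :=
  R.collapse (leastBelow N R.CollapseDefect)

/-- Delete the component of the first state that violates centralisation, if any. -/
noncomputable def deleteFirst (R : PLA α) (N : ℕ) : PLA α :=
  R.delete (leastBelow N R.DeleteDefect)

/-- Identify siblings with the same safe language. -/
noncomputable def merge (R : PLA α) (N : ℕ) : PLA α := R.quot (R.repOf N R.MergeRel)

/-- One round of the minimisation procedure. -/
noncomputable def round (N : ℕ) (R : PLA α) : PLA α := ((R.collapseFirst N).deleteFirst N).merge N

/-- Nothing is left to be done by a round. -/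
structure Stable (R : PLA α) : Prop where
  collapse : ∀ p, ¬ R.CollapseDefect p
  delete : ∀ p, ¬ R.DeleteDefect p
  merge : ∀ p q, R.MergeRel p q → p = q

theorem SafeLE.refl (p : ℕ) : R.SafeLE p p := fun _ h => h

theorem SafeLE.trans {p q r : ℕ} (h₁ : R.SafeLE p q) (h₂ : R.SafeLE q r) : R.SafeLE p r :=
  fun u h => h₂ u (h₁ u h)

theorem SafeLE.of_st {p q p' q' : ℕ} {a : α} (h : R.SafeLE p q) (hp : R.st p a = some p')
    (hq : R.st q a = some q') : R.SafeLE p' q' := by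
  intro u hu
  have := h (a :: u)
  rw [drun_cons_of u hp, drun_cons_of u hq] at this
  exact this hu

theorem SafeLE.exists_st {p q p' : ℕ} {a : α} (h : R.SafeLE p q) (hp : R.st p a = some p') :
    ∃ q', R.st q a = some q' := by
  have := h [a]
  rw [drun_single, drun_single, hp] at this
  exact Option.isSome_iff_exists.1 (this rfl)

theorem Valid.isCongr_mergeRel (h : R.Valid N d) : R.IsCongr R.MergeRel := by
  refine ⟨fun p q hE => ⟨hE.2.1, hE.2.1 ▸ hE.1⟩, fun q hq => ⟨hq, rfl, rfl, .refl q, .refl q⟩,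
    fun p q hE => ⟨hE.2.1 ▸ hE.1, hE.2.1.symm, hE.2.2.1.symm, hE.2.2.2.2, hE.2.2.2.1⟩,
    fun p q r h₁ h₂ => ⟨h₁.1, h₁.2.1.trans h₂.2.1, h₁.2.2.1.trans h₂.2.2.1,
      h₁.2.2.2.1.trans h₂.2.2.2.1, h₂.2.2.2.2.trans h₁.2.2.2.2⟩, ?_, ?_⟩
  · rintro p q a p' ⟨h1, h2, h3, h4, h5⟩ hp
    obtain ⟨q', hq⟩ := h4.exists_st hp
    have hlp := h.st_lay p a p' hp
    have hlq := h.st_lay q a q' hq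
    have hpar : R.par p' = R.par q' := by
      rcases (by omega : R.lay p = 1 ∨ 1 < R.lay p) with h6 | h6
      · rw [h.par_root p h6, h.par_root q (by omega)] at h3
        subst h3
        rw [hp] at hq
        rw [Option.some.inj hq]
      · have h7 := h.par_st p a p' h6 hp
        rw [h3, h.par_st q a q' (by omega) hq] at h7
        exact (Option.some.inj h7).symm
    exact ⟨q', hq, by omega, by omega, hpar, h4.of_st hp hq, h5.of_st hq hp⟩
  · rintro p q ⟨h1, h2, h3, h4, h5⟩ hp
    have := h.par_lay p hp
    rw [← h3]
    exact ⟨by omega, rfl, rfl, .refl _, .refl _⟩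

theorem Valid.collapseFirst_or (h : R.Valid N d) :
    ((∀ p, ¬ R.CollapseDefect p) ∧ R.collapseFirst N = R) ∨
      ∃ p, R.CollapseDefect p ∧ R.collapseFirst N = R.collapse p := by
  by_cases hex : ∃ p < N, R.CollapseDefect p
  · exact .inr ⟨_, (leastBelow_spec hex).1, rfl⟩
  · refine .inl ⟨fun p hp => hex ⟨p, h.lt p (by have := hp.1; omega), hp⟩, ?_⟩
    have hno : ∀ q, ¬ R.Under (leastBelow N R.CollapseDefect) q := by
      intro q hq
      rw [leastBelow_of_not hex] at hq
      have := h.lt _ (h.under_lay hq).2.2.1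
      omega
    rw [collapseFirst, PLA.collapse]
    simp [hno]

theorem Valid.deleteFirst_or (h : R.Valid N d) :
    ((∀ p, ¬ R.DeleteDefect p) ∧ R.deleteFirst N = R) ∨
      ∃ p, R.DeleteDefect p ∧ R.deleteFirst N = R.delete p := by
  by_cases hex : ∃ p < N, R.DeleteDefect p
  · exact .inr ⟨_, (leastBelow_spec hex).1, rfl⟩
  · refine .inl ⟨fun p hp => hex ⟨p, h.lt p (by have := hp.1; omega), hp⟩, ?_⟩
    have hno : ∀ q, ¬ R.Under (leastBelow N R.DeleteDefect) q := by
      intro q hq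
      rw [leastBelow_of_not hex] at hq
      have := h.lt _ (h.under_lay hq).2.2.1
      omega
    have hfilter : ∀ o : Option ℕ, o.filter (fun _ => true) = o := by
      intro o
      cases o <;> rfl
    rw [deleteFirst, PLA.delete, PLA.restrict]
    simp [hno, hfilter]

theorem Valid.merge_eq (h : R.Valid N d) (hm : ∀ p q, R.MergeRel p q → p = q) :
    R.merge N = R := by
  have hrep : ∀ q, R.repOf N R.MergeRel q = q := by
    intro q
    by_cases hq : R.lay q = 0
    · rw [repOf, if_pos hq]
    · exact hm _ _ (h.repOf_spec h.isCongr_mergeRel hq).1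
  rw [merge, PLA.quot]
  have : R.repOf N R.MergeRel = id := funext hrep
  rw [this]
  simp

/-- A property that is preserved by the three kinds of steps. -/
theorem Valid.round_induction (h : R.Valid N d) (hr : R.Recurrent) {P : PLA α → Prop} (hP : P R)
    (hc : ∀ R : PLA α, R.Valid N d → R.Recurrent → P R → ∀ p, R.CollapseDefect p →
      P (R.collapse p))
    (hd : ∀ R : PLA α, R.Valid N d → R.Recurrent → P R → ∀ p, R.DeleteDefect p → P (R.delete p))
    (hm : ∀ R : PLA α, R.Valid N d → R.Recurrent → P R → P (R.merge N)) :
    (R.round N).Valid N d ∧ (R.round N).Recurrent ∧ P (R.round N) := by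
  have h1 : (R.collapseFirst N).Valid N d ∧ (R.collapseFirst N).Recurrent ∧
      P (R.collapseFirst N) := by
    rcases h.collapseFirst_or with ⟨-, he⟩ | ⟨p, hp, he⟩ <;> rw [he]
    · exact ⟨h, hr, hP⟩
    · exact ⟨h.collapse hr hp.1, hr.collapse h hp.1, hc R h hr hP p hp⟩
  obtain ⟨h1, h2, h3⟩ := h1
  have h4 : ((R.collapseFirst N).deleteFirst N).Valid N d ∧
      ((R.collapseFirst N).deleteFirst N).Recurrent ∧ P ((R.collapseFirst N).deleteFirst N) := by
    rcases h1.deleteFirst_or with ⟨-, he⟩ | ⟨p, hp, he⟩ <;> rw [he]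
    · exact ⟨h1, h2, h3⟩
    · exact ⟨h1.delete h2 (.inl hp.1), h2.restrict_delete h1 (.inl hp.1), hd _ h1 h2 h3 p hp⟩
  obtain ⟨h4, h5, h6⟩ := h4
  have hrep := h4.isRep_repOf h4.isCongr_mergeRel
  exact ⟨h4.quot hrep, h5.quot hrep, hm _ h4 h5 h6⟩

theorem collapse_alive {p q : ℕ} (hq : (R.collapse p).lay q ≠ 0) : R.lay q ≠ 0 := by
  rcases collapse_cases hq with h1 | h1 <;> omega

/-- A round that removes no state changes nothing, and has nothing to do. -/
theorem Valid.stable_of_alive (h : R.Valid N d) (hr : R.Recurrent)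
    (ha : ∀ q, R.lay q ≠ 0 → (R.round N).lay q ≠ 0) : R.Stable ∧ R.round N = R := by
  have ham : ∀ q, (R.round N).lay q ≠ 0 → ((R.collapseFirst N).deleteFirst N).lay q ≠ 0 :=
    fun q hq => by
      have := (quot_lay_ne hq).2
      rw [← this]
      exact hq
  rcases h.collapseFirst_or with ⟨hc, he⟩ | ⟨p, hp, he⟩
  · rw [round, he] at ha ⊢
    rw [round, he] at ham
    rcases h.deleteFirst_or with ⟨hd, he'⟩ | ⟨p, hp, he'⟩
    · rw [he'] at ha ⊢
      have hm : ∀ p q, R.MergeRel p q → p = q := by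
        have hrep : ∀ q, R.lay q ≠ 0 → R.repOf N R.MergeRel q = q := fun q hq =>
          (quot_lay_ne (ha q hq)).1
        intro p q hpq
        rw [← hrep p hpq.1, ← hrep q (hpq.2.1 ▸ hpq.1)]
        exact h.repOf_congr h.isCongr_mergeRel hpq
      exact ⟨⟨hc, hd, hm⟩, h.merge_eq hm⟩
    · have h1 := ham p (ha p (by have := hp.1; omega))
      rw [he'] at h1
      exact absurd (Under.of_reach (by have := hp.1; omega) (.refl p)) (restrict_lay_ne h1).1
  · have h0 : R.lay p ≠ 0 := by have := hp.1; omega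
    have h1 := ham p (ha p h0)
    have hgone : (R.collapse p).lay p = 0 :=
      collapse_lay_gone (Under.of_reach h0 (.refl p)) (by omega)
    rw [he] at h1
    have hv := h.collapse hr hp.1
    rcases hv.deleteFirst_or with
      ⟨-, he'⟩ | ⟨p', -, he'⟩
    · rw [he'] at h1
      exact absurd hgone h1
    · rw [he'] at h1
      exact absurd hgone (restrict_lay_ne h1).2

theorem Valid.round_alive (h : R.Valid N d) (hr : R.Recurrent) {q : ℕ}
    (hq : (R.round N).lay q ≠ 0) : R.lay q ≠ 0 := by
  refine (h.round_induction hr (P := fun R' => R'.lay q ≠ 0 → R.lay q ≠ 0) (fun h => h)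
    (fun R' _ _ hP p _ h1 => hP (collapse_alive h1)) (fun R' _ _ hP p _ h1 =>
      hP (restrict_lay_ne h1).2) (fun R' _ _ hP h1 => hP ?_)).2.2 hq
  rw [← (quot_lay_ne h1).2]
  exact h1

/-- After sufficiently many rounds nothing is left to be done. -/
theorem Valid.stable_iterate (h : R.Valid N d) (hr : R.Recurrent) {P : PLA α → Prop} (hP : P R)
    (hc : ∀ R : PLA α, R.Valid N d → R.Recurrent → P R → ∀ p, R.CollapseDefect p →
      P (R.collapse p))
    (hd : ∀ R : PLA α, R.Valid N d → R.Recurrent → P R → ∀ p, R.DeleteDefect p → P (R.delete p))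
    (hm : ∀ R : PLA α, R.Valid N d → R.Recurrent → P R → P (R.merge N)) :
    ((round N)^[N] R).Valid N d ∧ ((round N)^[N] R).Recurrent ∧ P ((round N)^[N] R) ∧
      ((round N)^[N] R).Stable := by
  classical
  have key : ∀ n (R : PLA α), R.Valid N d → R.Recurrent → P R →
      ((Finset.range N).filter fun q => R.lay q ≠ 0).card ≤ n →
      ((round N)^[n] R).Valid N d ∧ ((round N)^[n] R).Recurrent ∧ P ((round N)^[n] R) ∧
      ((round N)^[n] R).Stable := by
    intro n
    induction n with
    | zero =>
      intro R h hr hP hcard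
      refine ⟨h, hr, hP, (h.stable_of_alive hr fun q hq => ?_).1⟩
      rw [Nat.le_zero, Finset.card_eq_zero, Finset.filter_eq_empty_iff] at hcard
      exact absurd hq (hcard (by simpa using h.lt q hq))
    | succ n ih =>
      intro R h hr hP hcard
      rw [Function.iterate_succ_apply]
      by_cases ha : ∀ q, R.lay q ≠ 0 → (R.round N).lay q ≠ 0
      · obtain ⟨hs, he⟩ := h.stable_of_alive hr ha
        have : ∀ m, (round N)^[m] R = R := fun m => Function.iterate_fixed he m
        rw [he, this]
        exact ⟨h, hr, hP, hs⟩
      · push Not at ha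
        obtain ⟨q, hq, hq'⟩ := ha
        obtain ⟨h1, h2, h3⟩ := h.round_induction hr hP hc hd hm
        refine ih _ h1 h2 h3 ?_
        have hlt : ((Finset.range N).filter fun q => (R.round N).lay q ≠ 0).card <
            ((Finset.range N).filter fun q => R.lay q ≠ 0).card := by
          apply Finset.card_lt_card
          rw [Finset.ssubset_iff_of_subset]
          · exact ⟨q, by simp [hq, h.lt q hq], by simp [hq']⟩
          · intro r hr'
            simp only [Finset.mem_filter] at hr' ⊢
            exact ⟨hr'.1, h.round_alive hr hr'.2⟩
        omega
  refine key N R h hr hP ?_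
  calc _ ≤ (Finset.range N).card := Finset.card_filter_le _ _
    _ = N := Finset.card_range N

/-! ### Images of subautomata -/

/-- `φ`, defined on the set `K` of states of `A`, exhibits `R` as the image of a subautomaton of
`A` under a surjective strong morphism. The subautomaton is determined by `K` and `φ`: its states
are those in `K`, with the layers of their images, and its transitions are those of `A` that
`φ` maps to transitions of `R`. -/
structure SubQuot (A R : PLA α) (K : ℕ → Prop) (φ : ℕ → ℕ) : Prop where
  alive : ∀ q, K q → A.lay q ≠ 0 ∧ R.lay (φ q) ≠ 0
  init : K A.init ∧ φ A.init = R.init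
  surj : ∀ r, R.lay r ≠ 0 → ∃ q, K q ∧ φ q = r
  st : ∀ q a r, K q → R.st (φ q) a = some r → ∃ q', K q' ∧ A.st q a = some q' ∧ φ q' = r
  par : ∀ q, K q → 1 < R.lay (φ q) → ∃ p, K p ∧ A.Anc p q ∧ φ p = R.par (φ q)
  anc : ∀ p q, K p → K q → A.Anc p q → R.Anc (φ p) (φ q) ∧ (p ≠ q → φ p ≠ φ q)

section SubQuot

variable {A : PLA α} {K : ℕ → Prop} {φ : ℕ → ℕ}

theorem SubQuot.refl (h : R.Valid N d) : SubQuot R R (fun q => R.lay q ≠ 0) id := by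
  refine ⟨fun q hq => ⟨hq, hq⟩, ⟨by rw [h.init_lay]; exact one_ne_zero, rfl⟩,
    fun r hr => ⟨r, hr, rfl⟩, fun q a r hq hs => ⟨r, ?_, hs, rfl⟩, fun q hq h1 => ?_,
    fun p q _ _ ha => ⟨ha, fun hne => hne⟩⟩
  · show R.lay r ≠ 0
    rwa [h.st_lay q a r hs]
  · have h2 : R.lay (R.par q) + 1 = R.lay q := h.par_lay q h1
    have h1' : 1 < R.lay q := h1
    exact ⟨R.par q, by omega, .step _ h1 (.refl (by omega)), rfl⟩

theorem SubQuot.exists_anc (h : SubQuot A R K φ) {q r : ℕ} (hq : K q)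
    (ha : R.Anc r (φ q)) : ∃ p, K p ∧ A.Anc p q ∧ φ p = r := by
  generalize hx : φ q = x at ha
  induction ha generalizing q with
  | refl _ => exact ⟨q, hq, .refl (h.alive q hq).1, hx⟩
  | step x h1 h2 ih =>
    subst hx
    obtain ⟨p, hp, h3, h4⟩ := h.par q hq h1
    obtain ⟨p', h5, h6, h7⟩ := ih hp h4
    exact ⟨p', h5, h6.trans h3, h7⟩

theorem SubQuot.sub (h : SubQuot A R K φ) {R' : PLA α} (hv' : R'.Valid N d)
    (hs : SubStep R R') : SubQuot A R' (fun q => K q ∧ R'.lay (φ q) ≠ 0) φ := by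
  refine ⟨fun q hq => ⟨(h.alive q hq.1).1, hq.2⟩, ⟨⟨h.init.1, ?_⟩, ?_⟩, fun r hr => ?_,
    fun q a r hq hst => ?_, fun q hq h1 => ?_, fun p q hp hq ha => ?_⟩
  · rw [h.init.2, ← hs.init, hv'.init_lay]
    exact one_ne_zero
  · rw [h.init.2, hs.init]
  · obtain ⟨q, hq, rfl⟩ := h.surj r (hs.alive r hr)
    exact ⟨q, ⟨hq, hr⟩, rfl⟩
  · obtain ⟨q', h1, h2, rfl⟩ := h.st q a r hq.1 (hs.st _ _ _ hst)
    refine ⟨q', ⟨h1, ?_⟩, h2, rfl⟩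
    rw [hv'.st_lay _ _ _ hst]
    exact hq.2
  · obtain ⟨p, h2, h3, h4⟩ := h.exists_anc hq.1 (hs.par _ h1)
    refine ⟨p, ⟨h2, ?_⟩, h3, h4⟩
    have := hv'.par_lay _ h1
    rw [h4]
    omega
  · obtain ⟨h1, h2⟩ := h.anc p q hp.1 hq.1 ha
    exact ⟨hs.anc _ _ hp.2 hq.2 h1, h2⟩

theorem SubQuot.quot (h : SubQuot A R K φ) (hv : R.Valid N d) {rep : ℕ → ℕ}
    (hrep : R.IsRep rep) : SubQuot A (R.quot rep) K (fun q => rep (φ q)) := by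
  have hanc : ∀ p q, R.Anc p q → (R.quot rep).Anc (rep p) (rep q) := by
    intro p q ha
    induction ha with
    | refl hp => exact .refl (by rwa [hrep.lay_rep])
    | step q h1 h2 ih =>
      refine .step _ (by rwa [hrep.lay_rep]) ?_
      show (R.quot rep).Anc (rep p) (rep (R.par (rep q)))
      rwa [hrep.par q h1]
  refine ⟨fun q hq => ⟨(h.alive q hq).1, by rw [hrep.lay_rep]; exact (h.alive q hq).2⟩,
    ⟨h.init.1, congrArg rep h.init.2⟩, fun r hr => ?_, fun q a r hq hst => ?_, fun q hq h1 => ?_,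
    fun p q hp hq ha => ?_⟩
  · obtain ⟨h1, h2⟩ := quot_lay_ne hr
    obtain ⟨q, hq, rfl⟩ := h.surj r (h2 ▸ hr)
    exact ⟨q, hq, h1⟩
  · obtain ⟨r', h1, rfl⟩ := hrep.exists_st hst
    obtain ⟨q', h2, h3, rfl⟩ := h.st q a r' hq h1
    exact ⟨q', h2, h3, rfl⟩
  · rw [hrep.lay_rep] at h1
    obtain ⟨p, h2, h3, h4⟩ := h.par q hq h1
    refine ⟨p, h2, h3, ?_⟩
    show rep (φ p) = rep (R.par (rep (φ q)))
    rw [hrep.par _ h1, h4]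
  · obtain ⟨h1, h2⟩ := h.anc p q hp hq ha
    refine ⟨hanc _ _ h1, fun hne heq => h2 hne ?_⟩
    have h3 := congrArg R.lay heq
    rw [hrep.lay, hrep.lay] at h3
    exact (hv.anc_lay h1).2.2 h3

end SubQuot

/-- What the minimisation procedure preserves, for an input automaton `A`. -/
structure Reduct (A R : PLA α) (Λ : ℕ → Set (ℕ → α)) : Prop where
  init : Λ R.init = Λ A.init
  cert : R.Cert Λ
  minimal : ∀ p q, R.lay p = 1 → R.lay q = 1 → Λ p = Λ q → p = q
  subQuot : ∃ K φ, SubQuot A R K φ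

/-- The procedure turns a reduct whose transitions above the first layer are recurrent into a
reduct to which no step applies any more. -/
theorem Reduct.stable_iterate {A : PLA α} {Λ : ℕ → Set (ℕ → α)} (h : R.Valid N d)
    (hr : R.Recurrent) (hred : Reduct A R Λ) :
    ((round N)^[N] R).Valid N d ∧ ((round N)^[N] R).Recurrent ∧
      Reduct A ((round N)^[N] R) Λ ∧ ((round N)^[N] R).Stable := by
  refine h.stable_iterate (P := fun R => Reduct A R Λ) hr hred ?_ ?_ ?_
  · rintro R h hr ⟨hi, hc, hm, K, φ, hs⟩ p ⟨h1, c, h2, h3, h4⟩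
    have h5 := h.par_lay c h2
    refine ⟨hi, hc.collapse h hr h1 (by rw [h3] at h5; exact h5.symm) h3 h4, fun p' q' hp hq => ?_,
      _, _, hs.sub (h.collapse hr h1) (h.subStep_collapse h1)⟩
    have hone : ∀ q, (R.collapse p).lay q = 1 → R.lay q = 1 := fun q hq => by
      rcases collapse_cases (R := R) (p := p) (q := q) (by omega) with h1 | h1
      · omega
      · omega
    exact hm p' q' (hone _ hp) (hone _ hq)
  · rintro R h hr ⟨hi, hc, hm, K, φ, hs⟩ p ⟨h1, q, h2, h3, h4, h5⟩
    have hv := h.delete hr (.inl h1)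
    refine ⟨hi, hc.delete h hr h1 h2 h3 h4 h5, fun p' q' hp hq => ?_,
      _, _, hs.sub hv (h.subStep_restrict (h.restrictable_delete hr (.inl h1)))⟩
    have hone : ∀ q, (R.delete p).lay q = 1 → R.lay q = 1 := fun q hq => by
      rw [← hq]
      exact (restrict_lay (restrict_lay_ne (R := R)
        (ne_of_eq_of_ne hq one_ne_zero)).1).symm
    exact hm p' q' (hone _ hp) (hone _ hq)
  · rintro R h hr ⟨hi, hc, hm, K, φ, hs⟩
    have hrep := h.isRep_repOf h.isCongr_mergeRel
    have hΛ : ∀ q, R.lay q = 1 → Λ (R.repOf N R.MergeRel q) = Λ q := fun q hq => by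
      have h1 := (h.repOf_spec h.isCongr_mergeRel (q := q) (by omega)).1
      have h2 := h1.2.2.1
      rw [h.par_root q hq, h.par_root _ (by rw [h1.2.1, hq])] at h2
      rw [h2]
    refine ⟨(hΛ _ h.init_lay).trans hi, hc.quot h hrep hΛ, fun p' q' hp hq => ?_,
      _, _, hs.quot h hrep⟩
    · have hone : ∀ q, (R.merge N).lay q = 1 → R.lay q = 1 := fun q hq => by
        rw [← hq]
        exact (quot_lay_ne (R := R) (ne_of_eq_of_ne hq one_ne_zero)).2.symm
      exact hm p' q' (hone _ hp) (hone _ hq)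

end PLA

/-! ### Passing between layered automata and their encodings by numbers -/

namespace PLA

variable {α Q Q' : Type*} {N d : ℕ}

/-- The states of `A` are numbered by `e` so that `A` becomes `R`. -/
structure Models (A : LayeredAutomaton α Q) (R : PLA α) (e : Q → ℕ) : Prop where
  inj : Function.Injective e
  surj : ∀ r, R.lay r ≠ 0 → ∃ q, e q = r
  lay : ∀ q, R.lay (e q) = A.layer q
  par : ∀ q, R.par (e q) = e (A.parent q)
  st : ∀ q a, R.st (e q) a = (A.step q a).map e
  init : R.init = e A.init

namespace Models

variable {A : LayeredAutomaton α Q} {R : PLA α} {e : Q → ℕ} (hm : Models A R e)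

include hm

theorem lay_ne (q : Q) : R.lay (e q) ≠ 0 := by
  rw [hm.lay]
  have := A.one_le_layer q
  omega

theorem st_iff (q q' : Q) (a : α) : R.st (e q) a = some (e q') ↔ A.step q a = some q' := by
  rw [hm.st, Option.map_eq_some_iff]
  exact ⟨fun ⟨p, h1, h2⟩ => by rw [h1, hm.inj h2], fun h => ⟨q', h, rfl⟩⟩

theorem exists_st {q : Q} {a : α} {r : ℕ} (h : R.st (e q) a = some r) :
    ∃ q', A.step q a = some q' ∧ e q' = r := by
  rwa [hm.st, Option.map_eq_some_iff] at h

theorem drun_eq (q : Q) (u : List α) : drun R.st (e q) u = (drun A.step q u).map e := by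
  induction u generalizing q with
  | nil => rfl
  | cons a u ih =>
    rw [drun_cons, drun_cons, hm.st]
    cases A.step q a with
    | none => rfl
    | some p => exact ih p

theorem drun_iff (q q' : Q) (u : List α) :
    drun R.st (e q) u = some (e q') ↔ drun A.step q u = some q' := by
  rw [hm.drun_eq, Option.map_eq_some_iff]
  exact ⟨fun ⟨p, h1, h2⟩ => by rw [h1, hm.inj h2], fun h => ⟨q', h, rfl⟩⟩

theorem isSome_iff (q : Q) (u : List α) :
    (drun R.st (e q) u).isSome ↔ (drun A.step q u).isSome := by
  rw [hm.drun_eq]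
  simp

theorem live_iff (q : Q) (w : ℕ → α) : Live R.st (e q) w ↔ Live A.step q w :=
  forall_congr' fun _ => hm.isSome_iff q _

theorem par_iterate (q : Q) (n : ℕ) : R.par^[n] (e q) = e (A.parent^[n] q) := by
  induction n generalizing q with
  | zero => rfl
  | succ n ih => rw [Function.iterate_succ_apply, Function.iterate_succ_apply, hm.par, ih]

theorem root_eq (q : Q) : R.root (e q) = e (A.anc 1 q) := by
  rw [PLA.root, hm.lay, hm.par_iterate]
  rfl

theorem reach_iff (p q : Q) : R.Reach (e p) (e q) ↔ ∃ u, A.run p u = some q :=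
  exists_congr fun _ => hm.drun_iff _ _ _

theorem anc_iff (h : R.Valid N d) (p q : Q) : R.Anc (e p) (e q) ↔ A.IsAncestor p q := by
  have hpar : ∀ q, 1 < A.layer q → A.layer (A.parent q) + 1 = A.layer q := A.parent_layer
  constructor
  · intro ha
    generalize hr : e q = r at ha
    induction ha generalizing q with
    | refl _ =>
      obtain rfl := hm.inj hr
      exact ⟨le_rfl, A.anc_layer q⟩
    | step r h1 h2 ih =>
      subst hr
      have h3 := ih (A.parent q) (hm.par q).symm
      rw [hm.lay] at h1
      have h4 := hpar q h1
      refine ⟨by have := h3.1; omega, ?_⟩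
      rw [← A.anc_parent q _ (A.one_le_layer p) (by have := h3.1; omega)]
      exact h3.2
  · rintro ⟨h1, h2⟩
    obtain ⟨r, hr, hl⟩ := h.exists_anc (q := e q) (A.layer p) (A.one_le_layer p)
      (by rwa [hm.lay])
    obtain ⟨p', rfl⟩ := hm.surj r (h.anc_lay hr).1
    have key : ∀ (r : ℕ), R.Anc (e p') r → ∀ q, e q = r → A.anc (A.layer p') q = p' := by
      intro r ha
      induction ha with
      | refl _ =>
        intro q hq
        rw [hm.inj hq, A.anc_layer]
      | step r h1 h2 ih =>
        rintro q rfl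
        have h3 := ih (A.parent q) (hm.par q).symm
        have h4 := (h.anc_lay h2).2.1
        rw [hm.lay] at h1
        rw [hm.lay, hm.par, hm.lay] at h4
        have h5 := hpar q h1
        rw [← A.anc_parent q _ (A.one_le_layer p') (by omega)]
        exact h3
    rw [hm.lay] at hl
    have h3 := key _ hr q rfl
    rw [hl, h2] at h3
    rwa [h3]

theorem strong_iff (q : Q) (w : ℕ → α) : R.Strong (e q) w ↔ A.StronglySafe q w := by
  rw [LayeredAutomaton.stronglySafe_iff]
  constructor
  · rintro ⟨-, h1, h2⟩
    refine ⟨(hm.live_iff q w).1 h1, fun i c hc hr hl => ?_⟩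
    exact h2 i (e c) (by rw [hm.lay, hm.lay, hc]) (by rw [hm.par, hm.drun_iff, hr])
      ((hm.live_iff c _).2 hl)
  · rintro ⟨h1, h2⟩
    refine ⟨hm.lay_ne q, (hm.live_iff q w).2 h1, fun i c hc hr hl => ?_⟩
    obtain ⟨c, rfl⟩ := hm.surj c (by omega)
    rw [hm.par, hm.drun_iff] at hr
    rw [hm.lay, hm.lay] at hc
    exact h2 i c hc hr ((hm.live_iff c _).1 hl)

theorem cert {Λ : ℕ → Set (ℕ → α)} (hc : R.Cert Λ) : A.Cert fun q => Λ (e q) := by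
  constructor
  · intro q w q' hq hs
    exact hc.res (e q) w (e q') (by rw [hm.lay, hq]) ((hm.st_iff _ _ _).2 hs)
  · intro p w hs
    rw [← hm.root_eq, hc.strong _ _ ((hm.strong_iff p w).2 hs), hm.lay]

theorem exists_cert {Λ : Q → Set (ℕ → α)} (hc : A.Cert Λ) :
    ∃ Λ' : ℕ → Set (ℕ → α), R.Cert Λ' ∧ ∀ q, Λ' (e q) = Λ q := by
  have he : ∀ q, {w | ∃ q', e q' = e q ∧ w ∈ Λ q'} = Λ q := by
    intro q
    ext w
    constructor
    · rintro ⟨q', h1, h2⟩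
      rwa [← hm.inj h1]
    · intro h
      exact ⟨q, rfl, h⟩
  refine ⟨fun r => {w | ∃ q, e q = r ∧ w ∈ Λ q}, ⟨?_, ?_⟩, he⟩
  · intro r w r' hr hs
    obtain ⟨q, rfl⟩ := hm.surj r (by omega)
    obtain ⟨q', h1, rfl⟩ := hm.exists_st hs
    rw [hm.lay] at hr
    have := hc.res q w q' hr h1
    rwa [← he q, ← he q'] at this
  · intro r w hs
    obtain ⟨q, rfl⟩ := hm.surj r hs.lay
    have := hc.strong q w ((hm.strong_iff q w).1 hs)
    rw [← he] at this
    rwa [hm.root_eq, hm.lay]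

theorem isMorphism (h : R.Valid N d) {B : LayeredAutomaton α Q'} {R' : PLA α} {e' : Q' → ℕ}
    {N' d' : ℕ} (h' : R'.Valid N' d') (hm' : Models B R' e') {ψ : Q → Q'} {f : ℕ → ℕ}
    (hψ : ∀ q, e' (ψ q) = f (e q)) (hinit : f R.init = R'.init)
    (hst : ∀ q a q', R.st q a = some q' → R'.st (f q) a = some (f q'))
    (hanc : ∀ p q, R.Anc p q → R'.Anc (f p) (f q)) : A.IsMorphism B ψ := by
  refine ⟨hm'.inj ?_, fun q a q' hs => ?_, fun p q ha => ?_⟩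
  · rw [hψ, ← hm.init, hinit, hm'.init]
  · rw [← hm'.st_iff, hψ, hψ]
    exact hst _ _ _ ((hm.st_iff _ _ _).2 hs)
  · rw [← hm'.anc_iff h', hψ, hψ]
    exact hanc _ _ ((hm.anc_iff h _ _).2 ha)

theorem eq_of_isLeaf {l : Q} (hl : A.IsLeaf l) {r : ℕ} (ha : R.Anc (e l) r) : e l = r := by
  induction ha with
  | refl _ => rfl
  | step r h1 h2 ih =>
    obtain ⟨q, rfl⟩ := hm.surj r (by omega)
    refine absurd ⟨q, by rwa [← hm.lay], hm.inj ?_⟩ hl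
    rw [ih, hm.par]

end Models

/-- The encoding of an automaton whose states are `0, …, n - 1`. -/
def ofLA {n : ℕ} (A : LayeredAutomaton α (Fin n)) : PLA α where
  lay q := if h : q < n then A.layer ⟨q, h⟩ else 0
  par q := if h : q < n then (A.parent ⟨q, h⟩ : ℕ) else 0
  st q a := if h : q < n then (A.step ⟨q, h⟩ a).map Fin.val else none
  init := A.init

theorem models_ofLA {n : ℕ} (A : LayeredAutomaton α (Fin n)) :
    Models A (ofLA A) (fun q => (q : ℕ)) := by
  refine ⟨Fin.val_injective, fun r hr => ?_, fun q => ?_, fun q => ?_, fun q a => ?_, rfl⟩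
  · simp only [ofLA] at hr
    split_ifs at hr with h
    · exact ⟨⟨r, h⟩, rfl⟩
    · exact absurd rfl hr
  · simp [ofLA]
  · simp [ofLA]
  · simp only [ofLA, dif_pos q.2]

/-- The number of layers that occur is at most the number of states. -/
theorem layer_le_card {n : ℕ} (A : LayeredAutomaton α (Fin n)) (q : Fin n) : A.layer q ≤ n := by
  have hinj : Function.Injective fun x : Fin (A.layer q) => A.anc (x + 1) q := by
    intro x y hxy
    have := congrArg A.layer hxy
    simp only at this
    rw [A.layer_anc _ _ (by omega) (by omega), A.layer_anc _ _ (by omega) (by omega)] at this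
    exact Fin.ext (by omega)
  simpa using Fintype.card_le_of_injective _ hinj

theorem valid_ofLA {n : ℕ} (A : LayeredAutomaton α (Fin n)) (hN : n < N) :
    (ofLA A).Valid N A.d := by
  have hm := models_ofLA A
  have hlt : ∀ q, (ofLA A).lay q ≠ 0 → ∃ p : Fin n, (p : ℕ) = q := fun q hq => hm.surj q hq
  refine ⟨fun q hq => ?_, fun q => ?_, fun q => ?_, fun q a hq => ?_, fun q a q' hs => ?_,
    fun q hq => ?_, fun q hq => ?_, fun q a q' hq hs => ?_, fun q a hq => ?_, ?_, fun q hq => ?_⟩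
  · obtain ⟨p, rfl⟩ := hlt q hq
    omega
  · by_cases hq : (ofLA A).lay q = 0
    · omega
    · obtain ⟨p, rfl⟩ := hlt q hq
      have := layer_le_card A p
      have h2 : (ofLA A).lay p = _ := hm.lay p
      omega
  · by_cases hq : (ofLA A).lay q = 0
    · omega
    · obtain ⟨p, rfl⟩ := hlt q hq
      exact (hm.lay p).trans_le (A.layer_le p)
  · by_cases h : q < n
    · simp only [ofLA, dif_pos h] at hq
      have := A.one_le_layer ⟨q, h⟩
      omega
    · simp [ofLA, h]
  · by_cases h : q < n
    · obtain ⟨p, h1, rfl⟩ := hm.exists_st (q := ⟨q, h⟩) hs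
      exact ((hm.lay p).trans (A.step_layer _ _ _ h1)).trans (hm.lay ⟨q, h⟩).symm
    · simp [ofLA, h] at hs
  · obtain ⟨p, rfl⟩ := hlt q (by omega)
    have h1 := hm.lay p
    have h2 := hm.par p
    rw [h2, A.parent_root p (by omega)]
  · obtain ⟨p, rfl⟩ := hlt q (by omega)
    have h1 := hm.lay p
    have h2 := hm.par p
    have h3 := hm.lay (A.parent p)
    rw [h2, h3, h1, A.parent_layer p (by omega)]
  · obtain ⟨p, rfl⟩ := hlt q (by omega)
    obtain ⟨p', h4, rfl⟩ := hm.exists_st hs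
    have h1 := hm.lay p
    have h2 := hm.par p
    have h3 := hm.par p'
    rw [h2, h3]
    exact (hm.st_iff _ _ _).2 (A.parent_step p a p' (by omega) h4)
  · obtain ⟨p, rfl⟩ := hlt q (by omega)
    have h1 := hm.lay p
    have h2 := hm.st p a
    rw [h2, Option.isSome_map]
    exact A.complete_one p a (by omega)
  · exact (hm.lay A.init).trans A.init_layer
  · obtain ⟨p, rfl⟩ := hlt q (by omega)
    have h1 := hm.lay p
    obtain ⟨u, hu⟩ := A.reachable_one p (by omega)
    exact ⟨u, (hm.drun_iff A.init p u).2 hu⟩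

section ToLA

variable {R : PLA α} {ι : Type*}

open Classical in
/-- The automaton encoded by `R`, with the states renamed. -/
noncomputable def toLA (h : R.Valid N d) (e : ι ≃ {q // R.lay q ≠ 0}) : LayeredAutomaton α ι :=
  have hst : ∀ i a i', ((R.st (e i) a).bind fun q' =>
      if h : R.lay q' ≠ 0 then some (e.symm ⟨q', h⟩) else none) = some i' ↔
        R.st (e i) a = some (e i').1 := by
    intro i a i'
    rw [Option.bind_eq_some_iff]
    constructor
    · rintro ⟨q', h1, h2⟩
      split_ifs at h2 with h3
      · rw [← Option.some.inj h2, h1]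
        simp
    · intro h1
      exact ⟨_, h1, by rw [dif_pos (e i').2]; simp⟩
  have hpar : ∀ i, ((if h : R.lay (R.par (e i)) ≠ 0 then e.symm ⟨_, h⟩ else i : ι) : ι) =
      e.symm ⟨R.par (e i), by
        have h1 := (e i).2
        rcases (by omega : R.lay (e i).1 = 1 ∨ 1 < R.lay (e i).1) with h2 | h2
        · rwa [h.par_root _ h2]
        · intro h3
          have := h.par_lay _ h2
          omega⟩ := by
    intro i
    rw [dif_pos]
  { d := d
    layer := fun i => R.lay (e i)
    one_le_layer := fun i => Nat.one_le_iff_ne_zero.2 (e i).2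
    layer_le := fun i => h.lay_le _
    step := fun i a => (R.st (e i) a).bind fun q' =>
      if h : R.lay q' ≠ 0 then some (e.symm ⟨q', h⟩) else none
    step_layer := fun i a i' hs => h.st_lay _ a _ ((hst i a i').1 hs)
    parent := fun i => if h : R.lay (R.par (e i)) ≠ 0 then e.symm ⟨_, h⟩ else i
    parent_root := fun i hi => by
      rw [hpar, Equiv.symm_apply_eq]
      exact Subtype.ext (h.par_root _ hi)
    parent_layer := fun i hi => by
      rw [hpar, Equiv.apply_symm_apply]
      exact h.par_lay _ hi
    parent_step := fun i a i' hi hs => by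
      rw [hst] at hs ⊢
      rw [hpar, hpar, Equiv.apply_symm_apply, Equiv.apply_symm_apply]
      exact h.par_st _ a _ hi hs
    complete_one := fun i a hi => by
      obtain ⟨q', hq'⟩ := Option.isSome_iff_exists.1 (h.complete _ a hi)
      have h1 : R.lay q' ≠ 0 := by rw [h.st_lay _ _ _ hq']; exact (e i).2
      rw [(hst i a (e.symm ⟨q', h1⟩)).2 (by simpa using hq')]
      rfl
    init := e.symm ⟨R.init, by rw [h.init_lay]; exact one_ne_zero⟩
    init_layer := by simpa using h.init_lay
    reachable_one := fun i hi => by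
      obtain ⟨u, hu⟩ := h.reach _ hi
      refine ⟨u, ?_⟩
      have h0 : R.lay R.init ≠ 0 := by rw [h.init_lay]; exact one_ne_zero
      have key : ∀ (u : List α) (q : ℕ) (hq : R.lay q ≠ 0), drun R.st q u = some (e i).1 →
          drun (fun i a => (R.st (e i) a).bind fun q' =>
            if h : R.lay q' ≠ 0 then some (e.symm ⟨q', h⟩) else none) (e.symm ⟨q, hq⟩) u =
            some i := by
        intro u
        induction u with
        | nil =>
          intro q hq hu
          refine congrArg some ?_
          rw [Equiv.symm_apply_eq]
          exact Subtype.ext (Option.some.inj hu)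
        | cons a u ih =>
          intro q hq hu
          rw [drun_cons, Option.bind_eq_some_iff] at hu
          obtain ⟨p, hp, hu⟩ := hu
          have hp0 : R.lay p ≠ 0 := by rwa [h.st_lay _ _ _ hp]
          rw [drun_cons_of u ((hst _ a (e.symm ⟨p, hp0⟩)).2 (by simpa using hp))]
          exact ih p hp0 hu
      exact key u _ h0 hu }

theorem models_toLA (h : R.Valid N d) (e : ι ≃ {q // R.lay q ≠ 0}) :
    Models (toLA h e) R (fun i => (e i : ℕ)) := by
  refine ⟨Subtype.val_injective.comp e.injective, fun r hr => ⟨e.symm ⟨r, hr⟩, by simp⟩,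
    fun i => rfl, fun i => ?_, fun i a => ?_, ?_⟩
  · have h1 := (e i).2
    have h2 : R.lay (R.par (e i)) ≠ 0 := by
      rcases (by omega : R.lay (e i).1 = 1 ∨ 1 < R.lay (e i).1) with h2 | h2
      · rwa [h.par_root _ h2]
      · have := h.par_lay _ h2
        intro h3
        omega
    simp only [toLA]
    rw [dif_pos h2, Equiv.apply_symm_apply]
  · simp only [toLA]
    rcases hs : R.st (e i) a with _ | q'
    · rfl
    · have h1 : R.lay q' ≠ 0 := by rw [h.st_lay _ _ _ hs]; exact (e i).2
      simp [h1]
  · simp [toLA]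

end ToLA

end PLA

/-! ### The properties of the minimised automaton -/

namespace PLA

variable {α Q Q' : Type*} {N d : ℕ} {A : LayeredAutomaton α Q} {R : PLA α} {e : Q → ℕ}

theorem Models.lang_eq (hm : Models A R e) {Λ : ℕ → Set (ℕ → α)} (hc : R.Cert Λ) (p : Q) :
    A.lang p = Λ (R.root (e p)) := by
  have hcA := hm.cert hc
  have hroot : ∀ l, A.IsAncestor p l → A.anc 1 l = A.anc 1 p := by
    rintro l ⟨h1, h2⟩
    rw [← h2, A.anc_anc _ _ _ le_rfl (A.one_le_layer _) h1]
  ext w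
  rw [hm.root_eq]
  constructor
  · rintro ⟨l, h1, h2⟩
    rw [hcA.language_eq, hroot _ h1] at h2
    exact h2
  · intro h
    obtain ⟨l, h1, h2⟩ := A.exists_leaf p
    refine ⟨⟨l, h1⟩, h2, ?_⟩
    rw [hcA.language_eq, hroot _ h2]
    exact h

theorem Models.equivalent {A' : LayeredAutomaton α Q'} {R' : PLA α} {e' : Q' → ℕ}
    (hm : Models A R e) (hm' : Models A' R' e') {Λ : ℕ → Set (ℕ → α)} (hc : R.Cert Λ)
    (hc' : R'.Cert Λ) (hinit : Λ R.init = Λ R'.init) : A.Equivalent A' := by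
  intro l l' h h'
  have h1 := h.2
  have h2 := h'.2
  rw [A.init_layer] at h1
  rw [A'.init_layer] at h2
  rw [(hm.cert hc).language_eq, (hm'.cert hc').language_eq, h1, h2, ← hm.init, ← hm'.init, hinit]

theorem Models.normal (hm : Models A R e) (h : R.Valid N d) (hr : R.Recurrent)
    (hs : ∀ p, ¬ R.CollapseDefect p) : A.Normal := by
  constructor
  · intro q q' hq hu
    have hlq : 1 < R.lay (e q) := by rw [hm.lay]; omega
    have h1 := (hm.reach_iff q q').2 hu
    have hlq' : 1 < R.lay (e q') := by rwa [h.reach_lay h1]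
    -- A nonempty cycle through `q'`, followed by a path back to `q`.
    obtain ⟨a, r, har⟩ := hr.succ _ hlq'
    obtain ⟨u, hu⟩ := hr.back _ _ _ hlq' har
    obtain ⟨v, hv⟩ := hr.symm h hlq h1
    refine ⟨a :: (u ++ v), by simp, (hm.drun_iff _ _ _).1 ?_⟩
    rw [drun_cons_of _ har, drun_append_of _ hu, hv]
  · intro q p hq hp hpar
    by_contra hno
    push Not at hno
    refine hs (e q) ⟨by rw [hm.lay]; omega, e p, by rw [hm.lay]; omega, by rw [hm.par, hpar], ?_⟩
    intro u hu
    rw [hm.isSome_iff] at hu ⊢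
    exact Option.isSome_iff_ne_none.2 (hno u (Option.isSome_iff_exists.1 hu))

theorem Models.safeLE (hm : Models A R e) {x : ℕ} {p q : Q} (h : A.safe x p ⊆ A.safe x q) :
    R.SafeLE (e (A.anc x p)) (e (A.anc x q)) := by
  intro u hu
  rw [hm.isSome_iff, ← A.inl_mem_safe_iff] at hu ⊢
  exact h hu

theorem Models.centralised (hm : Models A R e) (h : R.Valid N d) (hr : R.Recurrent)
    (hs : ∀ p, ¬ R.DeleteDefect p) : A.Centralised := by
  rintro x p q hx rfl hq ⟨-, -, hpq⟩ hle
  have hpar : ∀ r, A.layer r = A.layer p → A.anc (A.layer p - 1) r = A.parent r := by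
    intro r hr
    have h1 := A.parent_layer r (by omega)
    rw [← A.anc_parent _ _ (by omega) (by omega),
      show A.layer p - 1 = A.layer (A.parent r) by omega, A.anc_layer]
  rw [hpar p rfl, hpar q hq] at hpq
  have hle' := hm.safeLE hle
  rw [A.anc_layer, ← hq, A.anc_layer] at hle'
  have hreach : R.Reach (e p) (e q) := by
    by_contra hno
    exact hs (e p) ⟨by rw [hm.lay]; omega, e q, by rw [hm.lay, hm.lay, hq],
      by rw [hm.par, hm.par, hpq], hle', hno⟩
  exact ⟨(hm.reach_iff _ _).1 hreach,
    (hm.reach_iff _ _).1 (hr.symm h (by rw [hm.lay]; omega) hreach)⟩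

theorem Models.safeMinimal (hm : Models A R e) {Λ : ℕ → Set (ℕ → α)} (hc : R.Cert Λ)
    (hmin : ∀ p q, R.lay p = 1 → R.lay q = 1 → Λ p = Λ q → p = q)
    (hs : ∀ p q, R.MergeRel p q → p = q) : A.SafeMinimal := by
  have key : ∀ (x : ℕ) (p q : Q), x + 1 ≤ A.layer p → x + 1 ≤ A.layer q →
      A.SafeEquiv (x + 1) p q → A.anc (x + 1) p = A.anc (x + 1) q := by
    intro x p q hp hq hE
    induction x with
    | zero =>
      have h1 : A.lang p = A.lang q := hE
      rw [hm.lang_eq hc, hm.lang_eq hc, hm.root_eq, hm.root_eq] at h1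
      refine hm.inj (hmin _ _ ?_ ?_ h1)
      · rw [hm.lay, A.layer_anc _ _ le_rfl (A.one_le_layer p)]
      · rw [hm.lay, A.layer_anc _ _ le_rfl (A.one_le_layer q)]
    | succ x ih =>
      obtain ⟨h1, h2⟩ := hE
      have h3 := ih (by omega) (by omega) h1
      refine hm.inj (hs _ _ ⟨hm.lay_ne _, ?_, ?_, hm.safeLE h2.le, hm.safeLE h2.ge⟩)
      · rw [hm.lay, hm.lay, A.layer_anc _ _ (by omega) hp, A.layer_anc _ _ (by omega) hq]
      · rw [hm.par, hm.par, A.parent_anc _ _ hp, A.parent_anc _ _ hq, h3]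
  intro x p q hx hp hq hE
  obtain ⟨y, rfl⟩ := Nat.exists_eq_add_of_le' hx
  have := key y p q hp.ge hq.ge hE
  rwa [← hp, A.anc_layer, hp, ← hq, A.anc_layer] at this

/-! ### The subautomaton that is mapped onto the minimised automaton -/

section SubQuot

variable {A : PLA α} {K : ℕ → Prop} {φ : ℕ → ℕ}

open Classical in
/-- The subautomaton of `A` that is determined by `K` and `φ`. -/
noncomputable def preimage (A R : PLA α) (K : ℕ → Prop) (φ : ℕ → ℕ) : PLA α where
  lay q := if K q then R.lay (φ q) else 0
  par q := if h : K q ∧ 1 < R.lay (φ q) ∧ ∃ p, K p ∧ A.Anc p q ∧ φ p = R.par (φ q) then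
    h.2.2.choose else q
  st q a := if K q ∧ (R.st (φ q) a).isSome then A.st q a else none
  init := A.init

theorem preimage_lay_ne {q : ℕ} (hq : (preimage A R K φ).lay q ≠ 0) :
    K q ∧ (preimage A R K φ).lay q = R.lay (φ q) := by
  simp only [preimage] at hq ⊢
  split_ifs at hq ⊢ with h
  · exact ⟨h, rfl⟩
  · exact absurd rfl hq

theorem SubQuot.preimage_lay (q : ℕ) (hq : K q) :
    (preimage A R K φ).lay q = R.lay (φ q) := if_pos hq

theorem SubQuot.preimage_par (h : SubQuot A R K φ) {q : ℕ} (hq : K q) (h1 : 1 < R.lay (φ q)) :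
    K ((preimage A R K φ).par q) ∧ A.Anc ((preimage A R K φ).par q) q ∧
      φ ((preimage A R K φ).par q) = R.par (φ q) := by
  have hex := h.par q hq h1
  simp only [preimage]
  rw [dif_pos ⟨hq, h1, hex⟩]
  exact hex.choose_spec

theorem SubQuot.preimage_st (h : SubQuot A R K φ) {q q' : ℕ} {a : α} :
    (preimage A R K φ).st q a = some q' ↔
      K q ∧ A.st q a = some q' ∧ K q' ∧ R.st (φ q) a = some (φ q') := by
  simp only [preimage]
  constructor
  · intro hs
    split_ifs at hs with h1
    · obtain ⟨r, hr⟩ := Option.isSome_iff_exists.1 h1.2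
      obtain ⟨q'', h2, h3, rfl⟩ := h.st q a r h1.1 hr
      rw [hs] at h3
      obtain rfl := Option.some.inj h3
      exact ⟨h1.1, hs, h2, hr⟩
  · rintro ⟨h1, h2, -, h3⟩
    rw [if_pos ⟨h1, by rw [h3]; rfl⟩, h2]

/-- The states of the subautomaton below a state of `A` are determined by their images. -/
theorem SubQuot.eq_of_anc (h : SubQuot A R K φ) (hA : A.Valid N d) {p p' q : ℕ} (hp : K p)
    (hp' : K p') (h1 : A.Anc p q) (h2 : A.Anc p' q) (he : φ p = φ p') : p = p' := by
  by_contra hne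
  rcases le_total (A.lay p) (A.lay p') with hl | hl
  · exact (h.anc p p' hp hp' (hA.anc_linear h1 h2 hl)).2 hne he
  · exact (h.anc p' p hp' hp (hA.anc_linear h2 h1 hl)).2 (Ne.symm hne) he.symm

theorem SubQuot.valid_preimage {N' d' : ℕ} (h : SubQuot A R K φ) (hA : A.Valid N d)
    (hR : R.Valid N' d') : (preimage A R K φ).Valid (max N N') d' := by
  have hdead : ∀ q, (preimage A R K φ).lay q = 0 → ¬ K q := fun q hq hK => by
    rw [SubQuot.preimage_lay q hK] at hq
    exact (h.alive q hK).2 hq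
  have halive : ∀ q, (preimage A R K φ).lay q ≠ 0 ↔ K q :=
    fun q => ⟨fun hq => (preimage_lay_ne hq).1, fun hK hq => hdead _ hq hK⟩
  have hlay := fun q hK => SubQuot.preimage_lay (A := A) (R := R) (K := K) (φ := φ) q hK
  refine ⟨fun q hq => ?_, fun q => ?_, fun q => ?_, fun q a hq => ?_, fun q a q' hs => ?_,
    fun q hq => ?_, fun q hq => ?_, fun q a q' hq hs => ?_, fun q a hq => ?_, ?_, fun q hq => ?_⟩
  · exact lt_max_of_lt_left (hA.lt q (h.alive q ((halive q).1 hq)).1)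
  · by_cases hq : (preimage A R K φ).lay q = 0
    · have := hA.lay_lt q
      rw [hq]
      exact lt_max_of_lt_left (by omega)
    · rw [hlay q ((halive q).1 hq)]
      exact lt_max_of_lt_right (hR.lay_lt _)
  · by_cases hq : (preimage A R K φ).lay q = 0
    · omega
    · rw [hlay q ((halive q).1 hq)]
      exact hR.lay_le _
  · simp [preimage, hdead q hq]
  · obtain ⟨h1, -, h2, h3⟩ := h.preimage_st.1 hs
    rw [hlay q h1, hlay q' h2, hR.st_lay _ _ _ h3]
  · have h1 := (halive q).1 (by omega)
    rw [hlay q h1] at hq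
    simp only [preimage]
    rw [dif_neg (by omega)]
  · have h1 := (halive q).1 (by omega)
    rw [hlay q h1] at hq ⊢
    obtain ⟨h2, h3, h4⟩ := h.preimage_par h1 hq
    rw [hlay _ h2, h4, hR.par_lay _ hq]
  · obtain ⟨h1, h2, h3, h4⟩ := h.preimage_st.1 hs
    rw [hlay q h1] at hq
    obtain ⟨h5, h6, h7⟩ := h.preimage_par h1 hq
    obtain ⟨h8, h9, h10⟩ := h.preimage_par h3 (by rwa [hR.st_lay _ _ _ h4])
    have h11 := hR.par_st _ a _ hq h4
    rw [← h7] at h11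
    obtain ⟨r, h12, h13, h14⟩ := h.st _ a _ h5 h11
    obtain ⟨r', h15, h16⟩ := hA.anc_st h6 h2
    rw [h13] at h15
    obtain rfl := Option.some.inj h15
    -- Both `r` and the chosen parent are ancestors of `q'` with the same image.
    have h17 : r = (preimage A R K φ).par q' :=
      h.eq_of_anc hA h12 h8 h16 h9 (by rw [h14, h10])
    rw [← h17]
    refine h.preimage_st.2 ⟨h5, h13, h12, ?_⟩
    rw [h11, h14]
  · have h1 := (halive q).1 (by omega)
    rw [hlay q h1] at hq
    obtain ⟨r, hr⟩ := Option.isSome_iff_exists.1 (hR.complete _ a hq)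
    obtain ⟨q', h2, h3, rfl⟩ := h.st q a r h1 hr
    rw [h.preimage_st.2 ⟨h1, h3, h2, hr⟩]
    rfl
  · have : (preimage A R K φ).lay A.init = _ := hlay _ h.init.1
    exact this.trans (by rw [h.init.2, hR.init_lay])
  · have h1 := (halive q).1 (by omega)
    rw [hlay q h1] at hq
    obtain ⟨u, hu⟩ := hA.reach _ (hA.lay_root (h.alive q h1).1)
    have h2 := drun_map (P := fun q => K q ∧ R.lay (φ q) = 1) (h := id) (f := A.st)
      (g := (preimage A R K φ).st) (fun q a q' ⟨h3, h4⟩ h5 => by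
        obtain ⟨r, hr⟩ := Option.isSome_iff_exists.1 (hR.complete _ a h4)
        obtain ⟨q'', h6, h7, rfl⟩ := h.st q a r h3 hr
        rw [h5] at h7
        obtain rfl := Option.some.inj h7
        exact ⟨⟨h6, by rw [hR.st_lay _ _ _ hr, h4]⟩, h.preimage_st.2 ⟨h3, h5, h6, hr⟩⟩)
      ⟨h.init.1, by rw [h.init.2, hR.init_lay]⟩ hu
    -- A state whose image is on the first layer has no proper ancestor.
    have h3 : A.root q = q := by
      by_contra hne
      obtain ⟨h4, h5⟩ := h.anc _ _ h2.1.1 h1 (hA.anc_root (h.alive q h1).1)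
      exact h5 hne ((hR.anc_lay h4).2.2 (by rw [h2.1.2, hq]))
    rw [h3] at h2
    exact ⟨u, h2.2⟩

theorem SubQuot.anc_of_preimage (h : SubQuot A R K φ) {p q : ℕ}
    (ha : (preimage A R K φ).Anc p q) : K p ∧ A.Anc p q := by
  induction ha with
  | refl hp =>
    have := (preimage_lay_ne hp).1
    exact ⟨this, .refl (h.alive _ this).1⟩
  | step q hq hp ih =>
    obtain ⟨h1, h2⟩ := preimage_lay_ne (A := A) (R := R) (K := K) (φ := φ) (q := q) (by omega)
    exact ⟨ih.1, ih.2.trans (h.preimage_par h1 (by omega)).2.1⟩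

end SubQuot

theorem exists_equiv_fin (R : PLA α) (h : R.Valid N d) :
    ∃ j, Nonempty (Fin j ≃ {q // R.lay q ≠ 0}) := by
  have : Finite {q // R.lay q ≠ 0} :=
    Finite.of_injective (fun q => (⟨q.1, h.lt _ q.2⟩ : Fin N)) fun p q hpq => by
      simpa [Subtype.ext_iff] using hpq
  obtain ⟨j, ⟨e⟩⟩ := Finite.exists_equiv_fin {q // R.lay q ≠ 0}
  exact ⟨j, ⟨e.symm⟩⟩

/-- The subautomaton consists of the preimages of the states of `R`. As it maps onto `B`, `B` has
no more states than `A`; choosing for each leaf of `B` a leaf of `A` above a preimage gives the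
inequality between the numbers of leaves. -/
theorem SubQuot.exists_subautomaton {n m N' d' : ℕ} {A : LayeredAutomaton α (Fin n)}
    {K : ℕ → Prop} {φ : ℕ → ℕ} (h : SubQuot (ofLA A) R K φ) (hA : (ofLA A).Valid N d)
    (hR : R.Valid N' d') {B : LayeredAutomaton α (Fin m)} {e : Fin m → ℕ} (hm : Models B R e) :
    (∃ (j : ℕ) (A' : LayeredAutomaton α (Fin j)), A'.IsSubautomaton A ∧
      ∃ φ : Fin j → Fin m, A'.IsStrongMorphism B φ ∧ Function.Surjective φ) ∧
    m ≤ n ∧ B.numLeaves ≤ A.numLeaves := by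
  have hmA := models_ofLA A
  have hv := h.valid_preimage hA hR
  obtain ⟨j, ⟨e'⟩⟩ := exists_equiv_fin _ hv
  have hm' := models_toLA hv e'
  have hK : ∀ i, K (e' i) := fun i => (preimage_lay_ne (e' i).2).1
  have hι : ∀ q, K q → ∃ p : Fin n, (p : ℕ) = q := fun q hq => hmA.surj q (h.alive q hq).1
  have hφ : ∀ q, K q → ∃ r : Fin m, e r = φ q := fun q hq => hm.surj _ (h.alive q hq).2
  choose ι hι' using fun i => hι _ (hK i)
  choose ψ hψ using fun i => hφ _ (hK i)
  have hιinj : Function.Injective ι := fun i i' hii => by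
    refine hm'.inj ?_
    show ((e' i : ℕ)) = e' i'
    rw [← hι', ← hι', hii]
  have hψsurj : Function.Surjective ψ := by
    intro r
    obtain ⟨q, h1, h2⟩ := h.surj (e r) (hm.lay_ne r)
    have h3 : (preimage (ofLA A) R K φ).lay q ≠ 0 := by
      rw [SubQuot.preimage_lay q h1]
      exact (h.alive q h1).2
    refine ⟨e'.symm ⟨q, h3⟩, hm.inj ?_⟩
    rw [hψ, Equiv.apply_symm_apply, h2]
  refine ⟨⟨j, toLA hv e', ⟨ι, hιinj, ?_⟩, ψ, ⟨?_, ?_⟩, hψsurj⟩, ?_, ?_⟩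
  · exact hm'.isMorphism hv hA hmA (f := id) hι' rfl
      (fun q a q' hs => (h.preimage_st.1 hs).2.1) (fun p q ha => (h.anc_of_preimage ha).2)
  · refine hm'.isMorphism hv hR hm (f := φ) hψ h.init.2
      (fun q a q' hs => (h.preimage_st.1 hs).2.2.2) fun p q ha => ?_
    obtain ⟨h1, h2⟩ := h.anc_of_preimage ha
    exact (h.anc p q h1 (preimage_lay_ne ha.lay_ne).1 h2).1
  · intro i a hs
    by_contra hne
    obtain ⟨r, hr⟩ := Option.ne_none_iff_exists'.1 hne
    rw [← hm.st_iff, hψ] at hr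
    obtain ⟨q', h1, h2, h3⟩ := h.st _ a _ (hK i) hr
    have h4 := h.preimage_st.2 ⟨hK i, h2, h1, by rw [hr, h3]⟩
    obtain ⟨i', h5, -⟩ := hm'.exists_st h4
    rw [hs] at h5
    simp at h5
  · have h1 := Fintype.card_le_of_injective _ hιinj
    have h2 := Fintype.card_le_of_surjective _ hψsurj
    simp only [Fintype.card_fin] at h1 h2
    omega
  · -- Above a preimage of every leaf state of `B` there is a leaf state of `A`.
    have hex : ∀ l : {q // B.IsLeaf q}, ∃ c : {q // A.IsLeaf q}, ∃ q, K q ∧ φ q = e l.1 ∧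
        (ofLA A).Anc q c.1 := by
      intro l
      obtain ⟨q, h1, h2⟩ := h.surj (e l.1) (hm.lay_ne _)
      obtain ⟨p, rfl⟩ := hι q h1
      obtain ⟨c, hc, hpc⟩ := A.exists_leaf p
      exact ⟨⟨c, hc⟩, p, h1, h2, (hmA.anc_iff hA p c).2 hpc⟩
    choose c q hq hqe hqc using hex
    refine Nat.card_le_card_of_injective c fun l l' hll => ?_
    have h1 := hqc l
    have h2 := hqc l'
    rw [← hll] at h2
    refine Subtype.ext (hm.inj ?_)
    rcases le_total ((ofLA A).lay (q l)) ((ofLA A).lay (q l')) with hl | hl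
    · have h3 := (h.anc _ _ (hq l) (hq l') (hA.anc_linear h1 h2 hl)).1
      rw [hqe, hqe] at h3
      exact hm.eq_of_isLeaf l.2 h3
    · have h3 := (h.anc _ _ (hq l') (hq l) (hA.anc_linear h2 h1 hl)).1
      rw [hqe, hqe] at h3
      exact (hm.eq_of_isLeaf l'.2 h3).symm

end PLA

/-! ### Least fixpoints of operators on relations -/

/-- The least relation that is closed under `F`. -/
def Lfp (F : (ℕ → ℕ → Prop) → ℕ → ℕ → Prop) (i j : ℕ) : Prop :=
  ∀ X : ℕ → ℕ → Prop, F X ≤ X → X i j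

theorem Lfp.le {F : (ℕ → ℕ → Prop) → ℕ → ℕ → Prop} {Y : ℕ → ℕ → Prop} (h : F Y ≤ Y) :
    Lfp F ≤ Y := fun _ _ hl => hl Y h

theorem Lfp.map_le {F : (ℕ → ℕ → Prop) → ℕ → ℕ → Prop} (hF : Monotone F) : F (Lfp F) ≤ Lfp F :=
  fun i j h _ hX => hX i j (hF (Lfp.le hX) i j h)

theorem Lfp.le_map {F : (ℕ → ℕ → Prop) → ℕ → ℕ → Prop} (hF : Monotone F) : Lfp F ≤ F (Lfp F) :=
  Lfp.le (hF (Lfp.map_le hF))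

theorem Lfp.iff {F : (ℕ → ℕ → Prop) → ℕ → ℕ → Prop} (hF : Monotone F) (i j : ℕ) :
    Lfp F i j ↔ F (Lfp F) i j := ⟨Lfp.le_map hF i j, Lfp.map_le hF i j⟩

theorem Lfp.mono {F G : (ℕ → ℕ → Prop) → ℕ → ℕ → Prop} (h : ∀ X, F X ≤ G X) : Lfp F ≤ Lfp G :=
  fun _ _ hl X hX => hl X ((h X).trans hX)

/-- Chaining infinitely many nonempty extensions of finite words yields an infinite word. -/
theorem exists_word {α : Type*} {Good : List α → Prop} {Ext : List α → List α → Prop}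
    (h0 : Good []) (hext : ∀ u, Good u → ∃ v, v ≠ [] ∧ Good (u ++ v) ∧ Ext u v) :
    ∃ w : ℕ → α, ∀ n, ∃ l v, n ≤ l ∧ Good (pre w l) ∧ Ext (pre w l) v ∧
      v = pre (shift w l) v.length := by
  choose! g hg1 hg2 hg3 using hext
  let U : ℕ → List α := fun n => (fun u => u ++ g u)^[n] []
  have hU : ∀ n, U (n + 1) = U n ++ g (U n) := fun n => Function.iterate_succ_apply' _ _ _
  have hgood : ∀ n, Good (U n) := by
    intro n
    induction n with
    | zero => exact h0
    | succ n ih => rw [hU]; exact hg2 _ ih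
  have hlen : ∀ n, n ≤ (U n).length := by
    intro n
    induction n with
    | zero => exact Nat.zero_le _
    | succ n ih =>
      have := List.length_pos_iff.2 (hg1 _ (hgood n))
      rw [hU, List.length_append]
      omega
  have hpre : ∀ n m, n ≤ m → U n <+: U m := by
    intro n m h
    induction m, h using Nat.le_induction with
    | base => exact List.prefix_rfl
    | succ m _ ih => rw [hU]; exact ih.trans (List.prefix_append _ _)
  let w : ℕ → α := fun t => (U (t + 1))[t]'(hlen (t + 1))
  have hw : ∀ n, pre w (U n).length = U n := by
    intro n
    apply List.ext_getElem
    · simp [pre]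
    · intro t h1 h2
      simp only [pre, List.getElem_map, List.getElem_range]
      rcases le_total n (t + 1) with h | h
      · exact ((hpre _ _ h).getElem h2).symm
      · exact (hpre _ _ h).getElem (hlen (t + 1))
  refine ⟨w, fun n => ⟨(U n).length, g (U n), hlen n, ?_, ?_, ?_⟩⟩
  · rw [hw]; exact hgood n
  · rw [hw]; exact hg3 _ (hgood n)
  · have h1 := hw (n + 1)
    rw [hU, List.length_append, pre_add, hw] at h1
    exact (List.append_cancel_left h1).symm

namespace PLA

variable {α : Type*} {R : PLA α} {N d : ℕ}

theorem lfp_reach :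
    Lfp (fun X i j => i = j ∨ ∃ a k, R.st i a = some k ∧ X k j) = R.Reach := by
  apply le_antisymm
  · refine Lfp.le fun i j h => ?_
    rcases h with rfl | ⟨a, k, h1, h2⟩
    · exact Reach.refl i
    · exact h2.head h1
  · rintro i j ⟨u, hu⟩ X hX
    induction u generalizing i with
    | nil => exact hX _ _ (.inl (Option.some.inj hu))
    | cons a u ih =>
      rw [drun_cons, Option.bind_eq_some_iff] at hu
      obtain ⟨k, h1, h2⟩ := hu
      exact hX _ _ (.inr ⟨a, k, h1, ih k h2⟩)

theorem lfp_anc :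
    Lfp (fun X i j => (i = j ∧ R.lay i ≠ 0) ∨ (1 < R.lay j ∧ X i (R.par j))) = R.Anc := by
  apply le_antisymm
  · refine Lfp.le fun i j h => ?_
    rcases h with ⟨rfl, h⟩ | ⟨h1, h2⟩
    · exact .refl h
    · exact .step j h1 h2
  · intro i j h X hX
    induction h with
    | refl h => exact hX _ _ (.inl ⟨rfl, h⟩)
    | step j h1 h2 ih => exact hX _ _ (.inr ⟨h1, ih⟩)

theorem lfp_not_safeLE :
    Lfp (fun X i j => ∃ a i', R.st i a = some i' ∧ ∀ j', R.st j a = some j' → X i' j') =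
      fun i j => ¬ R.SafeLE i j := by
  apply le_antisymm
  · refine Lfp.le ?_
    rintro i j ⟨a, i', h1, h2⟩ hle
    obtain ⟨j', h3⟩ := hle.exists_st h1
    exact h2 j' h3 (hle.of_st h1 h3)
  · intro i j h X hX
    simp only [SafeLE, not_forall] at h
    obtain ⟨u, h1, h2⟩ := h
    induction u generalizing i j with
    | nil => exact absurd rfl h2
    | cons a u ih =>
      rcases hi : R.st i a with _ | i'
      · rw [drun_cons, hi] at h1
        cases h1
      · rw [drun_cons_of u hi] at h1
        refine hX _ _ ⟨a, i', hi, fun j' hj => ih i' j' h1 ?_⟩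
        rwa [drun_cons_of u hj] at h2

/-! ### Deciding the equality of the languages of two states of the first layer -/

/-- One step of `Kill`. -/
def killStep (R : PLA α) (X K : ℕ → ℕ → Prop) (c j : ℕ) : Prop :=
  1 < R.lay c ∧ ∃ a p' j', R.st (R.par c) a = some p' ∧ R.st j a = some j' ∧ ¬ X p' j' ∧
    ∀ c', R.st c a = some c' → K c' j'

/-- Some common path of the parent of `c` and of `j`, outside of `X`, is not a path of `c`. -/
def Kill (R : PLA α) (X : ℕ → ℕ → Prop) : ℕ → ℕ → Prop := Lfp (R.killStep X)

/-- The operator whose greatest fixpoint is, up to complements, the relation of having a common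
word that is strong for both states. -/
def clashStep (R : PLA α) (X : ℕ → ℕ → Prop) (i j : ℕ) : Prop :=
  ¬ ((∃ a i' j', R.st i a = some i' ∧ R.st j a = some j' ∧ ¬ X i' j' ∧ ¬ X j' i') ∧
    ∀ c, 1 < R.lay c → (R.par c = i → R.Kill X c j) ∧ (R.par c = j → R.Kill X c i))

/-- No word is strong for both `i` and `j`. -/
def NoClash (R : PLA α) : ℕ → ℕ → Prop := Lfp R.clashStep

/-- One step of `Differ`. -/
def differStep (R : PLA α) (X : ℕ → ℕ → Prop) (i j : ℕ) : Prop :=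
  (∃ p q, R.Anc i p ∧ R.Anc j q ∧ Odd (R.lay p + R.lay q) ∧ ¬ R.NoClash p q) ∨
    ∃ a i' j', R.st i a = some i' ∧ R.st j a = some j' ∧ X i' j'

/-- Some word leads from `i` and `j` to states that, in view of a common strong word of two states
above them, have different languages. -/
def Differ (R : PLA α) : ℕ → ℕ → Prop := Lfp R.differStep

theorem monotone_killStep (X : ℕ → ℕ → Prop) : Monotone (R.killStep X) := by
  rintro K K' h c j ⟨h1, a, p', j', h2, h3, h4, h5⟩
  exact ⟨h1, a, p', j', h2, h3, h4, fun c' hc => h _ _ (h5 c' hc)⟩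

theorem kill_anti {X Y : ℕ → ℕ → Prop} (h : X ≤ Y) : R.Kill Y ≤ R.Kill X := by
  refine Lfp.mono ?_
  rintro K c j ⟨h1, a, p', j', h2, h3, h4, h5⟩
  exact ⟨h1, a, p', j', h2, h3, fun hx => h4 (h _ _ hx), h5⟩

theorem monotone_clashStep : Monotone R.clashStep := by
  rintro X Y h i j hX ⟨⟨a, i', j', h1, h2, h3, h4⟩, h5⟩
  exact hX ⟨⟨a, i', j', h1, h2, fun hx => h3 (h _ _ hx), fun hx => h4 (h _ _ hx)⟩, fun c hc =>
    ⟨fun hi => kill_anti h _ _ ((h5 c hc).1 hi), fun hj => kill_anti h _ _ ((h5 c hc).2 hj)⟩⟩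

theorem monotone_differStep : Monotone R.differStep := by
  rintro X Y h i j (hX | ⟨a, i', j', h1, h2, h3⟩)
  · exact .inl hX
  · exact .inr ⟨a, i', j', h1, h2, h _ _ h3⟩

theorem NoClash.symm {i j : ℕ} (h : R.NoClash i j) : R.NoClash j i := by
  have h1 := (Lfp.iff monotone_clashStep i j).1 h
  refine (Lfp.iff monotone_clashStep j i).2 ?_
  rintro ⟨⟨a, j', i', h2, h3, h4, h5⟩, h6⟩
  exact h1 ⟨⟨a, i', j', h3, h2, h5, h4⟩, fun c hc => (h6 c hc).symm⟩

/-- Two states with a common strong word clash. -/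
theorem Valid.not_noClash (h : R.Valid N d) {i j : ℕ} {w : ℕ → α} (hi : R.Strong i w)
    (hj : R.Strong j w) : ¬ R.NoClash i j := by
  suffices R.NoClash ≤ fun i j => ∀ w, R.Strong i w → ¬ R.Strong j w from
    fun hn => this i j hn w hi hj
  have hstep : ∀ {i w}, R.Strong i w → ∃ i', R.st i (w 0) = some i' ∧ R.Strong i' (shift w 1) := by
    intro i w hi
    obtain ⟨i', hi'⟩ := hi.live.exists_run 1
    exact ⟨i', hi', h.strong_of_run hi hi'⟩
  -- A child dies along a word that is strong for its parent.
  have hkill : ∀ n c j w, drun R.st c (pre w n) = none → 1 < R.lay c → R.Strong (R.par c) w →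
      R.Strong j w → R.Kill (fun i j => ∀ w, R.Strong i w → ¬ R.Strong j w) c j := by
    intro n
    induction n with
    | zero => intro c j w hn; cases hn
    | succ n ih =>
      intro c j w hn hc hp hj
      obtain ⟨p', hp1, hp2⟩ := hstep hp
      obtain ⟨j', hj1, hj2⟩ := hstep hj
      refine (Lfp.iff (monotone_killStep _) _ _).2 ⟨hc, w 0, p', j', hp1, hj1,
        fun hno => hno _ hp2 hj2, fun c' hc' => ih c' j' (shift w 1) ?_ ?_ ?_ hj2⟩
      · rwa [add_comm, drun_pre_add n (i := 1) (p := c') hc'] at hn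
      · rwa [h.st_lay _ _ _ hc']
      · have := h.par_st _ _ _ hc hc'
        rw [hp1] at this
        rwa [← Option.some.inj this]
  have hchild : ∀ {c w}, 1 < R.lay c → R.Strong (R.par c) w →
      ∃ n, drun R.st c (pre w n) = none := by
    intro c w hc hp
    have := hp.not_live 0 c (by rw [h.par_lay c hc]) rfl
    simp only [Live, not_forall, Option.not_isSome_iff_eq_none, shift_zero] at this
    exact this
  refine Lfp.le fun i j hno w hi hj => hno ⟨?_, fun c hc => ⟨?_, ?_⟩⟩
  · obtain ⟨i', hi1, hi2⟩ := hstep hi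
    obtain ⟨j', hj1, hj2⟩ := hstep hj
    exact ⟨w 0, i', j', hi1, hj1, fun hno => hno _ hi2 hj2, fun hno => hno _ hj2 hi2⟩
  · rintro rfl
    obtain ⟨n, hn⟩ := hchild hc hi
    exact hkill n c j w hn hc hi hj
  · rintro rfl
    obtain ⟨n, hn⟩ := hchild hc hj
    exact hkill n c i w hn hc hj hi

/-- From clashing states, all children of both can be killed without leaving the clash relation. -/
theorem Valid.exists_kill (h : R.Valid N d) {i j : ℕ} (hij : ¬ R.NoClash i j) :
    ∃ v i' j', v ≠ [] ∧ drun R.st i v = some i' ∧ drun R.st j v = some j' ∧ ¬ R.NoClash i' j' ∧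
      ∀ c, 1 < R.lay c → (R.par c = i ∨ R.par c = j) → drun R.st c v = none := by
  have hunfold : ∀ {i j}, ¬ R.NoClash i j →
      (∃ a i' j', R.st i a = some i' ∧ R.st j a = some j' ∧
        ¬ R.NoClash i' j' ∧ ¬ R.NoClash j' i') ∧ ∀ c, 1 < R.lay c →
        (R.par c = i → R.Kill R.NoClash c j) ∧ (R.par c = j → R.Kill R.NoClash c i) :=
    fun {i j} hn => not_not.1 fun hc => hn ((Lfp.iff monotone_clashStep i j).2 hc)
  have hkill : R.Kill R.NoClash ≤ fun c j => ∃ v p' j', drun R.st (R.par c) v = some p' ∧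
      drun R.st j v = some j' ∧ ¬ R.NoClash p' j' ∧ drun R.st c v = none := by
    refine Lfp.le ?_
    rintro c j ⟨h1, a, p', j', h2, h3, h4, h5⟩
    rcases hc : R.st c a with _ | c'
    · exact ⟨[a], p', j', h2, h3, h4, hc⟩
    · obtain ⟨v, p'', j'', h6, h7, h8, h9⟩ := h5 c' hc
      have h10 := h.par_st c a c' h1 hc
      refine ⟨a :: v, p'', j'', ?_, ?_, h8, ?_⟩
      · rwa [drun_cons_of v h10]
      · rwa [drun_cons_of v h3]
      · rwa [drun_cons_of v hc]
  -- The children with index below `n` are killed one after the other.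
  have key : ∀ n, ∃ v i' j', v ≠ [] ∧ drun R.st i v = some i' ∧ drun R.st j v = some j' ∧
      ¬ R.NoClash i' j' ∧ ∀ c, c < n → 1 < R.lay c → (R.par c = i ∨ R.par c = j) →
        drun R.st c v = none := by
    intro n
    induction n with
    | zero =>
      obtain ⟨⟨a, i', j', h1, h2, h3, -⟩, -⟩ := hunfold hij
      exact ⟨[a], i', j', by simp, h1, h2, h3, fun c hc => absurd hc (Nat.not_lt_zero c)⟩
    | succ n ih =>
      obtain ⟨v, i', j', h1, h2, h3, h4, h5⟩ := ih
      by_cases hn : 1 < R.lay n ∧ (R.par n = i ∨ R.par n = j) ∧ drun R.st n v ≠ none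
      · obtain ⟨hl, hp, hv⟩ := hn
        obtain ⟨c', hc'⟩ := Option.ne_none_iff_exists'.1 hv
        have hl' : 1 < R.lay c' := by rwa [h.drun_lay hc']
        have hpar := h.drun_par hl hc'
        obtain ⟨v', i'', j'', h6, h7, h8, h9⟩ : ∃ v' i'' j'', drun R.st i' v' = some i'' ∧
            drun R.st j' v' = some j'' ∧ ¬ R.NoClash i'' j'' ∧ drun R.st c' v' = none := by
          rcases hp with hp | hp
          · rw [hp, h2] at hpar
            have hpar := Option.some.inj hpar
            obtain ⟨v', p'', j'', h6, h7, h8, h9⟩ := hkill _ _ (((hunfold h4).2 c' hl').1 hpar.symm)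
            exact ⟨v', p'', j'', hpar ▸ h6, h7, h8, h9⟩
          · rw [hp, h3] at hpar
            have hpar := Option.some.inj hpar
            obtain ⟨v', p'', j'', h6, h7, h8, h9⟩ := hkill _ _ (((hunfold h4).2 c' hl').2 hpar.symm)
            exact ⟨v', j'', p'', h7, hpar ▸ h6, fun hno => h8 hno.symm, h9⟩
        refine ⟨v ++ v', i'', j'', by simp [h1], by rwa [drun_append_of v' h2],
          by rwa [drun_append_of v' h3], h8, fun c hc h10 h11 => ?_⟩
        rcases (Nat.lt_succ_iff_lt_or_eq.1 hc) with hc | rfl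
        · rw [drun_append, h5 c hc h10 h11]
          rfl
        · rwa [drun_append_of v' hc']
      · refine ⟨v, i', j', h1, h2, h3, h4, fun c hc h10 h11 => ?_⟩
        rcases (Nat.lt_succ_iff_lt_or_eq.1 hc) with hc | rfl
        · exact h5 c hc h10 h11
        · by_contra hne
          exact hn ⟨h10, h11, hne⟩
  obtain ⟨v, i', j', h1, h2, h3, h4, h5⟩ := key N
  exact ⟨v, i', j', h1, h2, h3, h4, fun c hc => h5 c (h.lt c (by omega)) hc⟩

/-- States that clash have a common strong word. -/
theorem Valid.exists_strong_of_clash (h : R.Valid N d) {i j : ℕ} (hij : ¬ R.NoClash i j) :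
    ∃ w, R.Strong i w ∧ R.Strong j w := by
  obtain ⟨w, hw⟩ := exists_word
    (Good := fun u => ∃ i' j', drun R.st i u = some i' ∧ drun R.st j u = some j' ∧
      ¬ R.NoClash i' j')
    (Ext := fun u v => ∀ i' j', drun R.st i u = some i' → drun R.st j u = some j' →
      ∀ c, 1 < R.lay c → (R.par c = i' ∨ R.par c = j') → drun R.st c v = none)
    ⟨i, j, rfl, rfl, hij⟩
    (by
      rintro u ⟨i', j', h1, h2, h3⟩
      obtain ⟨v, i'', j'', h4, h5, h6, h7, h8⟩ := h.exists_kill h3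
      refine ⟨v, h4, ⟨i'', j'', by rwa [drun_append_of v h1], by rwa [drun_append_of v h2], h7⟩, ?_⟩
      intro i₁ j₁ h9 h10
      rw [h1] at h9
      rw [h2] at h10
      rw [← Option.some.inj h9, ← Option.some.inj h10]
      exact h8)
  have hlive : Live R.st i w ∧ Live R.st j w := by
    constructor <;> intro n <;> obtain ⟨l, v, hl, ⟨i', j', h1, h2, -⟩, -⟩ := hw n <;>
      obtain ⟨l, rfl⟩ := Nat.exists_eq_add_of_le hl
    · rw [pre_add, drun_append] at h1
      exact Option.isSome_of_isSome_bind (f := fun p => drun R.st p (pre (shift w n) l))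
        (by rw [h1]; rfl)
    · rw [pre_add, drun_append] at h2
      exact Option.isSome_of_isSome_bind (f := fun p => drun R.st p (pre (shift w n) l))
        (by rw [h2]; rfl)
  have halive : ∀ {i}, Live R.st i w → R.lay i ≠ 0 := by
    intro i hl h0
    obtain ⟨i', hi'⟩ := hl.exists_run 1
    have h1 : R.st i (w 0) = some i' := hi'
    rw [h.st_dead i _ h0] at h1
    cases h1
  have key : ∀ (n c i' j' : ℕ), drun R.st i (pre w n) = some i' → drun R.st j (pre w n) = some j' →
      1 < R.lay c → (R.par c = i' ∨ R.par c = j') → ¬ Live R.st c (shift w n) := by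
    intro n c i' j' hi hj hc hp hl
    obtain ⟨l, v, hnl, ⟨i'', j'', h1, h2, -⟩, h4, h5⟩ := hw n
    obtain ⟨l, rfl⟩ := Nat.exists_eq_add_of_le hnl
    obtain ⟨c', hc'⟩ := hl.exists_run l
    have hpar := h.drun_par hc hc'
    have h6 := h4 i'' j'' h1 h2 c' (by rwa [h.drun_lay hc']) (by
      rw [drun_pre_add l hi] at h1
      rw [drun_pre_add l hj] at h2
      rcases hp with hp | hp
      · rw [hp, h1] at hpar
        exact .inl (Option.some.inj hpar).symm
      · rw [hp, h2] at hpar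
        exact .inr (Option.some.inj hpar).symm)
    have h7 := hl.of_run hc' v.length
    rw [shift_shift, ← h5, h6] at h7
    cases h7
  refine ⟨w, ⟨halive hlive.1, hlive.1, fun n c hc hr => ?_⟩,
    ⟨halive hlive.2, hlive.2, fun n c hc hr => ?_⟩⟩
  · obtain ⟨j', hj⟩ := hlive.2.exists_run n
    have := halive hlive.1
    exact key n c _ _ hr hj (by omega) (.inl rfl)
  · obtain ⟨i', hi⟩ := hlive.1.exists_run n
    have := halive hlive.2
    exact key n c _ _ hi hr (by omega) (.inr rfl)

/-- Every infinite run passes below a state that is strong for the rest of the word. -/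
theorem Valid.exists_strong (h : R.Valid N d) {p : ℕ} {w : ℕ → α} (hp : R.lay p ≠ 0)
    (hl : Live R.st p w) : ∃ n t, drun R.st (R.root p) (pre w n) = some (R.root t) ∧
      R.Strong t (shift w n) := by
  induction hk : d - R.lay p using Nat.strong_induction_on generalizing p w with
  | _ k ih =>
    by_cases hs : R.Strong p w
    · exact ⟨0, p, rfl, by rwa [shift_zero]⟩
    · obtain ⟨n, c, hc, hr, hlc⟩ := exists_child hp hl hs
      have h1 := h.lay_le c
      obtain ⟨m, t, h2, h3⟩ := ih (d - R.lay c) (by omega) (by omega) hlc rfl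
      refine ⟨n + m, t, ?_, by rwa [← shift_shift]⟩
      rw [drun_pre_add m (h.drun_root hr), h.root_par (by omega)]
      exact h2

theorem Valid.live_of_lay_eq_one (h : R.Valid N d) {p : ℕ} (hp : R.lay p = 1) (w : ℕ → α) :
    Live R.st p w := by
  intro n
  suffices ∃ q, drun R.st p (pre w n) = some q ∧ R.lay q = 1 by
    obtain ⟨q, hq, -⟩ := this
    rw [hq]
    rfl
  induction n with
  | zero => exact ⟨p, rfl, hp⟩
  | succ n ih =>
    obtain ⟨q, h1, h2⟩ := ih
    obtain ⟨q', h3⟩ := Option.isSome_iff_exists.1 (h.complete q (w n) h2)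
    exact ⟨q', by rw [drun_pre_succ h1, h3], by rw [h.st_lay _ _ _ h3, h2]⟩

/-- If the languages of `i` and `j` differ, then a word in only one of them is eventually strong for
states above both runs, and these are on layers of different parity. Conversely, a common strong
word of two states on layers of different parity distinguishes their roots. -/
theorem Valid.differ_iff (h : R.Valid N d) {Λ : ℕ → Set (ℕ → α)} (hc : R.Cert Λ) {i j : ℕ}
    (hi : R.lay i = 1) (hj : R.lay j = 1) : R.Differ i j ↔ Λ i ≠ Λ j := by
  constructor
  · intro hd
    suffices R.Differ ≤ fun i j => R.lay i = 1 → R.lay j = 1 → Λ i ≠ Λ j from this i j hd hi hj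
    refine Lfp.le ?_
    rintro i j (⟨p, q, h1, h2, h3, h4⟩ | ⟨a, i', j', h1, h2, h3⟩) hi hj heq
    · obtain ⟨w, hp, hq⟩ := h.exists_strong_of_clash h4
      have h5 := hc.strong p w hp
      have h6 := hc.strong q w hq
      rw [← h.root_of_anc h1, root_of_lay_le hi.le, heq] at h5
      rw [← h.root_of_anc h2, root_of_lay_le hj.le, h5] at h6
      rw [Nat.odd_add'] at h3
      rw [← Nat.not_even_iff_odd] at h3
      tauto
    · refine h3 (by rw [h.st_lay _ _ _ h1, hi]) (by rw [h.st_lay _ _ _ h2, hj]) ?_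
      ext w
      have hw : shift (fun n => Nat.casesOn n a w : ℕ → α) 1 = w := by
        funext n
        simp [shift, add_comm 1 n]
      have h4 := hc.res i (fun n => Nat.casesOn n a w) i' hi h1
      have h5 := hc.res j (fun n => Nat.casesOn n a w) j' hj h2
      rw [hw] at h4 h5
      rw [← h4, ← h5, heq]
  · intro hne
    by_contra hd
    refine hne (Set.ext fun w => ?_)
    obtain ⟨n₁, t₁, h1, h2⟩ := h.exists_strong (by omega) (h.live_of_lay_eq_one hi w)
    obtain ⟨n₂, t₂, h3, h4⟩ := h.exists_strong (by omega) (h.live_of_lay_eq_one hj w)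
    rw [root_of_lay_le hi.le] at h1
    rw [root_of_lay_le hj.le] at h3
    -- Both runs are followed until strong states have been reached in both.
    have hpush : ∀ {i n t} m, drun R.st i (pre w n) = some (R.root t) → R.Strong t (shift w n) →
        ∃ t', drun R.st i (pre w (n + m)) = some (R.root t') ∧ R.Strong t' (shift w (n + m)) := by
      intro i n t m h1 h2
      obtain ⟨t', ht'⟩ := h2.live.exists_run m
      refine ⟨t', ?_, ?_⟩
      · rw [drun_pre_add m h1, h.drun_root ht']
      · rw [← shift_shift]
        exact h.strong_of_run h2 ht'
    obtain ⟨s₁, h5, h6⟩ := hpush n₂ h1 h2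
    obtain ⟨s₂, h7, h8⟩ := hpush n₁ h3 h4
    rw [add_comm n₂ n₁] at h7 h8
    have hback : ∀ (u : List α) (i j i' j' : ℕ), drun R.st i u = some i' → drun R.st j u = some j' →
        R.Differ i' j' → R.Differ i j := by
      intro u
      induction u with
      | nil =>
        intro i j i' j' hi hj hd
        rw [Option.some.inj hi, Option.some.inj hj]
        exact hd
      | cons a u ih =>
        intro i j i' j' hi hj hd
        rw [drun_cons, Option.bind_eq_some_iff] at hi hj
        obtain ⟨i₁, hi1, hi2⟩ := hi
        obtain ⟨j₁, hj1, hj2⟩ := hj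
        exact (Lfp.iff monotone_differStep _ _).2
          (.inr ⟨a, i₁, j₁, hi1, hj1, ih _ _ _ _ hi2 hj2 hd⟩)
    rw [hc.mem_iff h hi h5, hc.mem_iff h hj h7, hc.strong _ _ h6, hc.strong _ _ h8]
    by_contra hpar
    refine hd (hback _ _ _ _ _ h5 h7 ((Lfp.iff monotone_differStep _ _).2
      (.inl ⟨s₁, s₂, h.anc_root h6.lay, h.anc_root h8.lay, ?_, h.not_noClash h6 h8⟩)))
    rw [Nat.odd_add', ← Nat.not_even_iff_odd]
    tauto

/-- The states of the first layer are identified if they are not found to differ. -/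
def LangRel (R : PLA α) (p q : ℕ) : Prop :=
  R.lay p ≠ 0 ∧ (p = q ∨ (R.lay p = 1 ∧ R.lay q = 1 ∧ ¬ R.Differ p q))

theorem Valid.langRel_iff (h : R.Valid N d) {Λ : ℕ → Set (ℕ → α)} (hc : R.Cert Λ) {p q : ℕ} :
    R.LangRel p q ↔ R.lay p ≠ 0 ∧ (p = q ∨ (R.lay p = 1 ∧ R.lay q = 1 ∧ Λ p = Λ q)) := by
  refine and_congr_right fun _ => or_congr_right (and_congr_right fun h1 => and_congr_right
    fun h2 => ?_)
  rw [h.differ_iff hc h1 h2, not_not]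

theorem Valid.isCongr_langRel (h : R.Valid N d) {Λ : ℕ → Set (ℕ → α)} (hc : R.Cert Λ) :
    R.IsCongr R.LangRel := by
  have hiff := fun p q => h.langRel_iff hc (p := p) (q := q)
  refine ⟨?_, fun q hq => ⟨hq, .inl rfl⟩, ?_, ?_, ?_, ?_⟩ <;> simp only [hiff]
  · rintro p q ⟨h1, rfl | ⟨h2, h3, -⟩⟩
    · exact ⟨rfl, h1⟩
    · exact ⟨by omega, by omega⟩
  · rintro p q ⟨h1, rfl | ⟨h2, h3, h4⟩⟩
    · exact ⟨h1, .inl rfl⟩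
    · exact ⟨by omega, .inr ⟨h3, h2, h4.symm⟩⟩
  · rintro p q r ⟨h1, rfl | ⟨h2, h3, h4⟩⟩ ⟨h5, rfl | ⟨h6, h7, h8⟩⟩
    · exact ⟨h1, .inl rfl⟩
    · exact ⟨h1, .inr ⟨h6, h7, h8⟩⟩
    · exact ⟨h1, .inr ⟨h2, h3, h4⟩⟩
    · exact ⟨h1, .inr ⟨h2, h7, h4.trans h8⟩⟩
  · rintro p q a p' ⟨h1, rfl | ⟨h2, h3, h4⟩⟩ hp
    · exact ⟨p', hp, by rwa [h.st_lay _ _ _ hp], .inl rfl⟩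
    · obtain ⟨q', hq⟩ := Option.isSome_iff_exists.1 (h.complete q a h3)
      have h5 := h.st_lay _ _ _ hp
      have h6 := h.st_lay _ _ _ hq
      refine ⟨q', hq, by omega, .inr ⟨by omega, by omega, ?_⟩⟩
      rw [← not_ne_iff, ← h.differ_iff hc (by omega) (by omega)]
      intro hd
      have h7 : R.Differ p q :=
        (Lfp.iff monotone_differStep _ _).2 (.inr ⟨a, p', q', hp, hq, hd⟩)
      exact (h.differ_iff hc h2 h3).1 h7 h4
  · rintro p q ⟨h1, rfl | ⟨h2, h3, h4⟩⟩ hp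
    · have := h.par_lay p hp
      exact ⟨by omega, .inl rfl⟩
    · omega

/-- The quotient of the first layer by language equality. -/
noncomputable def langQuot (R : PLA α) (N : ℕ) : PLA α := R.quot (R.repOf N R.LangRel)

theorem Valid.reduct_langQuot {A : PLA α} (h : R.Valid N d) {Λ : ℕ → Set (ℕ → α)} (hc : R.Cert Λ)
    {K : ℕ → Prop} {φ : ℕ → ℕ} (hs : SubQuot A R K φ) (hinit : R.init = A.init) :
    Reduct A (R.langQuot N) Λ := by
  have hE := h.isCongr_langRel hc
  have hrep := h.isRep_repOf hE
  have hΛ : ∀ q, R.lay q = 1 → Λ (R.repOf N R.LangRel q) = Λ q := by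
    intro q hq
    have h1 := (h.langRel_iff hc).1 (h.repOf_spec hE (ne_of_eq_of_ne hq one_ne_zero)).1
    rcases h1.2 with h2 | h2
    · rw [h2]
    · exact h2.2.2
  refine ⟨?_, hc.quot h hrep hΛ, fun p q hp hq hpq => ?_, K, _, hs.quot h hrep⟩
  · show Λ (R.repOf N R.LangRel R.init) = _
    rw [hΛ _ h.init_lay, hinit]
  · obtain ⟨h1, h2⟩ := quot_lay_ne (R := R) (rep := R.repOf N R.LangRel) (q := p)
      (ne_of_eq_of_ne hp one_ne_zero)
    obtain ⟨h3, h4⟩ := quot_lay_ne (R := R) (rep := R.repOf N R.LangRel) (q := q)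
      (ne_of_eq_of_ne hq one_ne_zero)
    replace hp := h2.symm.trans hp
    replace hq := h4.symm.trans hq
    rw [← h1, ← h3]
    exact h.repOf_congr hE ((h.langRel_iff hc).2 ⟨ne_of_eq_of_ne hp one_ne_zero,
      .inr ⟨hp, hq, hpq⟩⟩)

theorem Valid.langQuot (h : R.Valid N d) {Λ : ℕ → Set (ℕ → α)} (hc : R.Cert Λ) :
    (R.langQuot N).Valid N d := h.quot (h.isRep_repOf (h.isCongr_langRel hc))

theorem Recurrent.langQuot (hr : R.Recurrent) (h : R.Valid N d) {Λ : ℕ → Set (ℕ → α)}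
    (hc : R.Cert Λ) : (R.langQuot N).Recurrent := hr.quot (h.isRep_repOf (h.isCongr_langRel hc))

end PLA

/-! ### Programming with tables -/

namespace RAM

namespace Exp

/-- Expressions are used as formulas, which are true if their value is not zero. -/
def Holds (N : ℕ) (m : ℕ → ℕ → ℕ) (e : Exp) (ρ : Fin 8 → ℕ) : Prop := e.eval N m ρ ≠ 0

def and (e f : Exp) : Exp := .ite e f (.lit 0)
def not (e : Exp) : Exp := .ite e (.lit 0) (.lit 1)
def or (e f : Exp) : Exp := .ite e (.lit 1) f
def lt (e f : Exp) : Exp := .minus f e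
def eq (e f : Exp) : Exp := .not (.plus (.minus e f) (.minus f e))

/-- The entry `(e, f)` of the table in the array `a`. -/
def tab (a : ℕ) (e f : Exp) : Exp := .get a (.plus (.scale e) f)

/-- The least value of the variable `i` that satisfies `e`; the variable `j` is auxiliary. -/
def least (i j : Fin 8) (e : Exp) : Exp :=
  .sum j (.ite (.sum i (.and (.not (.lt (.var j) (.var i))) e)) (.lit 0) (.lit 1))

variable {N : ℕ} {m : ℕ → ℕ → ℕ} {ρ : Fin 8 → ℕ} {e f g : Exp}

@[simp] theorem eval_lit (c : ℕ) : (lit c).eval N m ρ = c := rfl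
@[simp] theorem eval_var (i : Fin 8) : (var i).eval N m ρ = ρ i := rfl
@[simp] theorem eval_plus : (plus e f).eval N m ρ = e.eval N m ρ + f.eval N m ρ := rfl
@[simp] theorem eval_minus : (minus e f).eval N m ρ = e.eval N m ρ - f.eval N m ρ := rfl
@[simp] theorem eval_get (a : ℕ) : (get a e).eval N m ρ = m a (e.eval N m ρ) := rfl
@[simp] theorem eval_scale : (scale e).eval N m ρ = e.eval N m ρ * N := rfl
@[simp] theorem eval_tab (a : ℕ) :
    (tab a e f).eval N m ρ = m a (e.eval N m ρ * N + f.eval N m ρ) := rfl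
open Classical in
@[simp] theorem eval_ite :
    (ite e f g).eval N m ρ = if e.Holds N m ρ then f.eval N m ρ else g.eval N m ρ := by
  simp only [eval, Holds]
  congr
@[simp] theorem eval_sum (i : Fin 8) :
    (sum i e).eval N m ρ = ∑ x ∈ Finset.range N, e.eval N m (Function.update ρ i x) := rfl

@[simp] theorem holds_and : (and e f).Holds N m ρ ↔ e.Holds N m ρ ∧ f.Holds N m ρ := by
  simp only [Holds, and, eval]
  split_ifs with h <;> simp [h]
@[simp] theorem holds_not : (not e).Holds N m ρ ↔ ¬ e.Holds N m ρ := by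
  simp only [Holds, not, eval]
  split_ifs with h <;> simp [h]
@[simp] theorem holds_or : (or e f).Holds N m ρ ↔ e.Holds N m ρ ∨ f.Holds N m ρ := by
  simp only [Holds, or, eval]
  split_ifs with h <;> simp [h]
@[simp] theorem holds_lt : (lt e f).Holds N m ρ ↔ e.eval N m ρ < f.eval N m ρ := by
  simp [Holds, lt, Nat.sub_ne_zero_iff_lt]
@[simp] theorem holds_eq : (eq e f).Holds N m ρ ↔ e.eval N m ρ = f.eval N m ρ := by
  rw [eq, holds_not]
  simp only [Holds, eval_plus, eval_minus]
  omega
@[simp] theorem holds_sum (i : Fin 8) :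
    (sum i e).Holds N m ρ ↔ ∃ x < N, e.Holds N m (Function.update ρ i x) := by
  simp [Holds, eval]
@[simp] theorem holds_tab (a : ℕ) :
    (tab a e f).Holds N m ρ ↔ m a (e.eval N m ρ * N + f.eval N m ρ) ≠ 0 := Iff.rfl
@[simp] theorem holds_get (a : ℕ) : (get a e).Holds N m ρ ↔ m a (e.eval N m ρ) ≠ 0 := Iff.rfl

theorem eval_least {i j : Fin 8} (hij : i ≠ j) {P : ℕ → Prop}
    (h : ∀ x y, x < N → (e.Holds N m (Function.update (Function.update ρ j y) i x) ↔ P x)) :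
    (least i j e).eval N m ρ = PLA.leastBelow N P := by
  simp only [least, eval_sum, eval_ite, PLA.leastBelow, eval_lit]
  refine Finset.sum_congr rfl fun y hy => ?_
  have hy' := Finset.mem_range.1 hy
  congr 1
  simp only [holds_sum, holds_and, holds_not, holds_lt, eval_var, Function.update_self,
    Function.update_of_ne hij.symm, not_lt, eq_iff_iff]
  exact ⟨fun ⟨x, h1, h2, h3⟩ => ⟨x, h2, (h x y h1).1 h3⟩,
    fun ⟨x, h1, h2⟩ => ⟨x, by omega, h1, (h x y (by omega)).2 h2⟩⟩

end Exp

@[simp] theorem cell_zero (i j : ℕ) : cell i j 0 = i := rfl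
@[simp] theorem cell_one (i j : ℕ) : cell i j 1 = j := rfl

namespace Stm

/-- Whether the array `a` occurs as a target in a statement. -/
def writes : Stm → ℕ → Bool
  | .fill b _, a => a == b
  | .seq S₁ S₂, a => S₁.writes a || S₂.writes a
  | .iter S, a => S.writes a

theorem eval_of_writes {N : ℕ} {S : Stm} {a : ℕ} (h : S.writes a = false) (m : ℕ → ℕ → ℕ) :
    S.eval N m a = m a := by
  induction S generalizing m with
  | fill b e =>
    have hab : a ≠ b := by simpa [writes] using h
    funext x
    simp [eval, writeTable, hab]
  | seq S₁ S₂ ih₁ ih₂ =>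
    simp only [writes, Bool.or_eq_false_iff] at h
    rw [eval, ih₂ h.2, ih₁ h.1]
  | iter S ih =>
    simp only [writes] at h
    rw [eval]
    generalize N = n at *
    suffices ∀ x, (S.eval n)^[x] m a = m a from this n
    intro x
    induction x with
    | zero => rfl
    | succ x ihx => rw [Function.iterate_succ_apply', ih h, ihx]

@[simp] theorem eval_seq {N : ℕ} {S₁ S₂ : Stm} {m : ℕ → ℕ → ℕ} :
    (seq S₁ S₂).eval N m = S₂.eval N (S₁.eval N m) := rfl

@[simp] theorem eval_fill_of_ne {N a b : ℕ} {e : Exp} {m : ℕ → ℕ → ℕ} (h : a ≠ b) :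
    (fill b e).eval N m a = m a := eval_of_writes (by simpa [writes] using h) m

theorem eval_fill_tab {N a i j : ℕ} {e : Exp} {m : ℕ → ℕ → ℕ} (hi : i < N) (hj : j < N) :
    (fill a e).eval N m a (i * N + j) = e.eval N m (cell i j) := by
  simp [eval, writeTable, lt_sq_of_lt hi hj, index_div hj, index_mod hj]

theorem eval_fill_row {N a j : ℕ} {e : Exp} {m : ℕ → ℕ → ℕ} (hj : j < N) :
    (fill a e).eval N m a j = e.eval N m (cell 0 j) := by
  have := eval_fill_tab (a := a) (e := e) (m := m) (lt_of_le_of_lt (Nat.zero_le j) hj) hj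
  rwa [zero_mul, zero_add] at this

/-- Iterate `S` from the empty table in the array `a`, often enough for a table to become
stable if it keeps growing until then. -/
def lfp (a : ℕ) (S : Stm) : Stm := .seq (.fill a (.lit 0)) (.iter (.iter S))

end Stm

/-- The array `t` holds the `N × N` table of the relation `X`. -/
def IsTab (N : ℕ) (t : ℕ → ℕ) (X : ℕ → ℕ → Prop) : Prop :=
  ∀ i < N, ∀ j < N, t (i * N + j) ≠ 0 ↔ X i j

theorem IsTab.eq_zero {N : ℕ} {t : ℕ → ℕ} {X : ℕ → ℕ → Prop} (h : IsTab N t X) {i j : ℕ}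
    (hi : i < N) (hj : j < N) : t (i * N + j) = 0 ↔ ¬ X i j := by
  rw [← h i hi j hj, not_not]

/-- The array `t` begins with the table of the predicate `P`. -/
def IsRow (N : ℕ) (t : ℕ → ℕ) (P : ℕ → Prop) : Prop := ∀ j < N, t j ≠ 0 ↔ P j

theorem isTab_fill {N a : ℕ} {e : Exp} {m : ℕ → ℕ → ℕ} {X : ℕ → ℕ → Prop}
    (h : ∀ i < N, ∀ j < N, e.Holds N m (cell i j) ↔ X i j) :
    IsTab N ((Stm.fill a e).eval N m a) X := by
  intro i hi j hj
  rw [Stm.eval_fill_tab hi hj]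
  exact h i hi j hj

theorem isRow_fill {N a : ℕ} {e : Exp} {m : ℕ → ℕ → ℕ} {P : ℕ → Prop}
    (h : ∀ j < N, e.Holds N m (cell 0 j) ↔ P j) :
    IsRow N ((Stm.fill a e).eval N m a) P := by
  intro j hj
  rw [Stm.eval_fill_row hj]
  exact h j hj

/-- A growing sequence of relations on the numbers below `N`, each of which determines the next
one, is stable from the index `N * N` on. -/
theorem le_of_iterate {N : ℕ} {X : ℕ → ℕ → ℕ → Prop} (hmono : ∀ n, X n ≤ X (n + 1))
    (hloc : ∀ n, (∀ i < N, ∀ j < N, X (n + 1) i j → X n i j) →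
      ∀ i < N, ∀ j < N, X (n + 2) i j → X (n + 1) i j) :
    ∀ i < N, ∀ j < N, X (N * N + 1) i j → X (N * N) i j := by
  classical
  let B : ℕ → Finset (ℕ × ℕ) := fun n =>
    (Finset.range N ×ˢ Finset.range N).filter fun p => X n p.1 p.2
  have hmem : ∀ n i j, (i, j) ∈ B n ↔ (i < N ∧ j < N) ∧ X n i j := by
    intro n i j
    simp [B]
  have hcard : ∀ n, n ≤ (B n).card ∨ ∀ i < N, ∀ j < N, X (n + 1) i j → X n i j := by
    intro n
    induction n with
    | zero => exact .inl (Nat.zero_le _)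
    | succ n ih =>
      by_cases h : ∀ i < N, ∀ j < N, X (n + 1) i j → X n i j
      · exact .inr (hloc n h)
      · left
        have h1 := ih.resolve_right h
        push Not at h
        obtain ⟨i, hi, j, hj, h2, h3⟩ := h
        have : B n ⊂ B (n + 1) := by
          refine Finset.ssubset_iff_subset_ne.2 ⟨fun ⟨i, j⟩ hp => ?_, fun heq => h3 ?_⟩
          · rw [hmem] at hp ⊢
            exact ⟨hp.1, hmono n _ _ hp.2⟩
          · have := (hmem (n + 1) i j).2 ⟨⟨hi, hj⟩, h2⟩
            rw [← heq, hmem] at this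
            exact this.2
        have := Finset.card_lt_card this
        omega
  rcases hcard (N * N) with h | h
  · have hfull : B (N * N) = Finset.range N ×ˢ Finset.range N := by
      refine Finset.eq_of_subset_of_card_le (Finset.filter_subset _ _) ?_
      simpa using h
    intro i hi j hj _
    have : (i, j) ∈ B (N * N) := by rw [hfull]; simp [hi, hj]
    exact ((hmem _ _ _).1 this).2
  · exact h

/-- If `S` computes a monotone operator `F` on tables, then `Stm.lfp a S` computes its least
fixpoint. -/
theorem isTab_lfp {N a : ℕ} {S : Stm} {F : (ℕ → ℕ → Prop) → ℕ → ℕ → Prop} (hF : Monotone F)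
    {m : ℕ → ℕ → ℕ}
    (hS : ∀ m', (∀ b, (Stm.lfp a S).writes b = false → m' b = m b) → ∀ X, IsTab N (m' a) X →
      IsTab N (S.eval N m' a) (F X)) :
    IsTab N ((Stm.lfp a S).eval N m a) (Lfp F) := by
  let M : ℕ → ℕ → ℕ → ℕ := fun n => (S.eval N)^[n] ((Stm.fill a (.lit 0)).eval N m)
  let X : ℕ → ℕ → ℕ → Prop := fun n => F^[n] fun _ _ => False
  have hXs : ∀ n, X (n + 1) = F (X n) := fun n => Function.iterate_succ_apply' _ _ _
  have hM : ∀ n, (∀ b, (Stm.lfp a S).writes b = false → M n b = m b) ∧ IsTab N (M n a) (X n) := by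
    intro n
    induction n with
    | zero =>
      refine ⟨fun b hb => ?_, isTab_fill fun i _ j _ => by simp [Exp.Holds, X]⟩
      simp only [Stm.lfp, Stm.writes, Bool.or_eq_false_iff] at hb
      exact Stm.eval_of_writes (by simpa only [Stm.writes] using hb.1) m
    | succ n ih =>
      have h1 : M (n + 1) = S.eval N (M n) := Function.iterate_succ_apply' _ _ _
      refine ⟨fun b hb => ?_, ?_⟩
      · rw [h1, Stm.eval_of_writes _ _, ih.1 b hb]
        simp only [Stm.lfp, Stm.writes, Bool.or_eq_false_iff] at hb
        exact hb.2
      · rw [h1, hXs]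
        exact hS _ ih.1 _ ih.2
  have hend : (Stm.lfp a S).eval N m = M (N * N) := by
    show ((S.eval N)^[N])^[N] _ = _
    rw [← Function.iterate_mul]
  rw [hend]
  have hmono : ∀ n, X n ≤ X (n + 1) := by
    intro n
    induction n with
    | zero => exact fun i j h => h.elim
    | succ n ih => rw [hXs, hXs (n + 1)]; exact hF ih
  have hle : ∀ n, X n ≤ Lfp F := by
    intro n
    induction n with
    | zero => exact fun i j h => h.elim
    | succ n ih => rw [hXs]; exact (hF ih).trans (Lfp.map_le hF)
  have hst := le_of_iterate (N := N) hmono fun n hn i hi j hj h => by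
    have h1 : IsTab N (M n a) (X (n + 1)) := fun i hi j hj =>
      ((hM n).2 i hi j hj).trans ⟨hmono n i j, hn i hi j hj⟩
    have h2 := hS _ (hM n).1 _ h1 i hi j hj
    have h3 := hS _ (hM n).1 _ (hM n).2 i hi j hj
    rw [hXs] at h ⊢
    exact h3.1 (h2.2 h)
  intro i hi j hj
  rw [(hM (N * N)).2 i hi j hj]
  refine ⟨hle _ i j, fun h => ?_⟩
  -- The table of the last round, made true outside of the box, is closed under the operator.
  refine h (fun i j => i < N → j < N → X (N * N) i j) ?_ hi hj
  intro i j h hi hj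
  have h1 : IsTab N (M (N * N) a) (fun i j => i < N → j < N → X (N * N) i j) := fun i hi j hj =>
    ((hM _).2 i hi j hj).trans ⟨fun h _ _ => h, fun h => h hi hj⟩
  have h2 := hS _ (hM (N * N)).1 _ h1 i hi j hj
  have h3 := hS _ (hM (N * N)).1 _ (hM (N * N)).2 i hi j hj
  exact hst i hi j hj (by rw [hXs]; exact h3.1 (h2.2 h))

end RAM

/-! ### Automata in memory -/

namespace PLA

variable {k : ℕ}

/-- The transition table of an automaton, with `0` for an undefined transition, and also for
letters out of range. -/
def code (R : PLA (Fin k)) (q a : ℕ) : ℕ :=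
  if h : a < k then (R.st q ⟨a, h⟩).elim 0 (· + 1) else 0

theorem code_of_lt (R : PLA (Fin k)) (q : ℕ) (a : Fin k) :
    R.code q a = (R.st q a).elim 0 (· + 1) := dif_pos a.2

theorem code_of_st {R : PLA (Fin k)} {q q' : ℕ} {a : Fin k} (h : R.st q a = some q') :
    R.code q a = q' + 1 := by
  rw [code_of_lt, h]
  rfl

theorem code_of_none {R : PLA (Fin k)} {q : ℕ} {a : Fin k} (h : R.st q a = none) :
    R.code q a = 0 := by
  rw [code_of_lt, h]
  rfl

theorem code_of_le {R : PLA (Fin k)} {q a : ℕ} (h : k ≤ a) : R.code q a = 0 :=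
  dif_neg (not_lt.2 h)

theorem Valid.lt_of_st {α : Type*} {R : PLA α} {N d q q' : ℕ} {a : α} (h : R.Valid N d)
    (hs : R.st q a = some q') : q' < N := by
  refine h.lt q' fun h0 => ?_
  rw [h.st_lay q a q' hs] at h0
  rw [h.st_dead q a h0] at hs
  cases hs

theorem Valid.init_lt {α : Type*} {R : PLA α} {N d : ℕ} (h : R.Valid N d) : R.init < N :=
  h.lt _ (by rw [h.init_lay]; exact one_ne_zero)

end PLA

namespace RAM

open Exp Stm

/-- The arrays `1`, `2`, `3` and `4` of the memory `m` hold the layers, the parents, the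
transitions and the initial state of the automaton `R` with states below `N`. -/
structure Rep {k : ℕ} (N : ℕ) (m : ℕ → ℕ → ℕ) (R : PLA (Fin k)) : Prop where
  letters : k ≤ N
  lay : ∀ q < N, m 1 q = R.lay q
  par : ∀ q < N, m 2 q = R.par q
  par_lt : ∀ q < N, R.par q < N
  st : ∀ q < N, ∀ a < N, m 3 (q * N + a) = R.code q a
  init : m 4 0 = R.init

variable {k N d : ℕ} {m m' : ℕ → ℕ → ℕ} {R : PLA (Fin k)}

theorem Rep.congr (h : Rep N m R) (h1 : m' 1 = m 1) (h2 : m' 2 = m 2) (h3 : m' 3 = m 3)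
    (h4 : m' 4 = m 4) : Rep N m' R :=
  ⟨h.letters, by rw [h1]; exact h.lay, by rw [h2]; exact h.par, h.par_lt, by rw [h3]; exact h.st,
    by rw [h4]; exact h.init⟩

theorem Rep.eval (h : Rep N m R) {S : Stm} (h1 : S.writes 1 = false) (h2 : S.writes 2 = false)
    (h3 : S.writes 3 = false) (h4 : S.writes 4 = false) : Rep N (S.eval N m) R :=
  h.congr (eval_of_writes h1 m) (eval_of_writes h2 m) (eval_of_writes h3 m) (eval_of_writes h4 m)

theorem Rep.st_cases (h : Rep N m R) (hv : R.Valid N d) {q : ℕ} (hq : q < N) (a : Fin k) :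
    (R.st q a = none ∧ m 3 (q * N + a) = 0) ∨
      ∃ q' < N, R.st q a = some q' ∧ m 3 (q * N + a) = q' + 1 := by
  have ha : (a : ℕ) < N := a.2.trans_le h.letters
  rcases hs : R.st q a with _ | q'
  · exact .inl ⟨rfl, by rw [h.st q hq a ha, PLA.code_of_none hs]⟩
  · exact .inr ⟨q', hv.lt_of_st hs, rfl, by rw [h.st q hq a ha, PLA.code_of_st hs]⟩

/-- A formula about some transition from `q`, as it is seen by the machine. -/
theorem Rep.exists_st (h : Rep N m R) (hv : R.Valid N d) {q : ℕ} (hq : q < N)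
    {P : Fin k → ℕ → Prop} {C : ℕ → Prop}
    (hPC : ∀ (a : Fin k) q', R.st q a = some q' → q' < N → m 3 (q * N + a) = q' + 1 →
      (C a ↔ P a q')) :
    (∃ a < N, m 3 (q * N + a) ≠ 0 ∧ C a) ↔ ∃ a q', R.st q a = some q' ∧ P a q' := by
  constructor
  · rintro ⟨a, ha, h1, h2⟩
    by_cases hk : a < k
    · rcases h.st_cases hv hq ⟨a, hk⟩ with ⟨-, h3⟩ | ⟨q', h3, h4, h5⟩
      · exact absurd h3 h1
      · exact ⟨_, q', h4, (hPC ⟨a, hk⟩ q' h4 h3 h5).1 h2⟩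
    · rw [h.st q hq a ha, PLA.code_of_le (by omega)] at h1
      exact absurd rfl h1
  · rintro ⟨a, q', h1, h2⟩
    have ha : (a : ℕ) < N := a.2.trans_le h.letters
    have h3 : m 3 (q * N + a) = q' + 1 := by rw [h.st q hq a ha, PLA.code_of_st h1]
    exact ⟨a, ha, by rw [h3]; exact Nat.succ_ne_zero q', (hPC a q' h1 (hv.lt_of_st h1) h3).2 h2⟩

/-- The layer of the state `e`. -/
def layer (e : Exp) : Exp := .get 1 e

/-- The parent of the state `e`. -/
def parent (e : Exp) : Exp := .get 2 e

/-- The code of the transition of `e` under the letter `a`: the successor of the target, or zero if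
there is no transition. -/
def trans (e a : Exp) : Exp := .tab 3 e a

/-- The target of the transition of `e` under the letter `a`, if there is one. -/
def target (e a : Exp) : Exp := .minus (trans e a) (.lit 1)

attribute [simp] layer parent trans target

/-- Reachability, in the array `10`. -/
def reachStm : Stm := lfp 10 (fill 10
  (.or (.eq (.var 0) (.var 1)) (.sum 2 (.and (trans (.var 0) (.var 2))
    (.tab 10 (target (.var 0) (.var 2)) (.var 1))))))

/-- Non-inclusion of safe languages, in the array `11`. -/
def safeStm : Stm := lfp 11 (fill 11
  (.sum 2 (.and (trans (.var 0) (.var 2)) (.or (.not (trans (.var 1) (.var 2)))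
    (.tab 11 (target (.var 0) (.var 2)) (target (.var 1) (.var 2)))))))

/-- The ancestor relation, in the array `12`. -/
def ancStm : Stm := lfp 12 (fill 12
  (.or (.and (.eq (.var 0) (.var 1)) (layer (.var 0)))
    (.and (.lt (.lit 1) (layer (.var 1))) (.tab 12 (.var 0) (parent (.var 1))))))

/-- The relation `PLA.Kill`, in the array `13`, for the relation in the array `14`. -/
def killStm : Stm := lfp 13 (fill 13
  (.and (.lt (.lit 1) (layer (.var 0))) (.sum 2 (.and (trans (parent (.var 0)) (.var 2))
    (.and (trans (.var 1) (.var 2))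
      (.and (.not (.tab 14 (target (parent (.var 0)) (.var 2)) (target (.var 1) (.var 2))))
        (.or (.not (trans (.var 0) (.var 2)))
          (.tab 13 (target (.var 0) (.var 2)) (target (.var 1) (.var 2))))))))))

/-- The relation `PLA.NoClash`, in the array `14`. -/
def clashStm : Stm := lfp 14 (.seq killStm (fill 14 (.not (.and
  (.sum 2 (.and (trans (.var 0) (.var 2)) (.and (trans (.var 1) (.var 2))
    (.and (.not (.tab 14 (target (.var 0) (.var 2)) (target (.var 1) (.var 2))))
      (.not (.tab 14 (target (.var 1) (.var 2)) (target (.var 0) (.var 2))))))))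
  (.not (.sum 2 (.and (.lt (.lit 1) (layer (.var 2)))
    (.or (.and (.eq (parent (.var 2)) (.var 0)) (.not (.tab 13 (.var 2) (.var 1))))
      (.and (.eq (parent (.var 2)) (.var 1)) (.not (.tab 13 (.var 2) (.var 0))))))))))))

/-- The relation `PLA.Differ`, in the array `15`, with the tables of its ingredients. -/
def differStm : Stm := .seq ancStm (.seq clashStm (lfp 15 (fill 15 (.or
  (.sum 2 (.sum 3 (.and (.tab 12 (.var 0) (.var 2)) (.and (.tab 12 (.var 1) (.var 3))
    (.and (.sum 4 (.eq (.plus (.plus (.var 4) (.var 4)) (.lit 1))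
      (.plus (layer (.var 2)) (layer (.var 3))))) (.not (.tab 14 (.var 2) (.var 3))))))))
  (.sum 2 (.and (trans (.var 0) (.var 2)) (.and (trans (.var 1) (.var 2))
    (.tab 15 (target (.var 0) (.var 2)) (target (.var 1) (.var 2))))))))))

theorem isTab_reach (h : Rep N m R) (hv : R.Valid N d) :
    IsTab N (reachStm.eval N m 10) R.Reach := by
  rw [← PLA.lfp_reach]
  refine isTab_lfp ?_ fun m' hm' X hX => isTab_fill fun i hi j hj => ?_
  · exact fun X Y hXY i j => Or.imp_right fun ⟨a, l, h1, h2⟩ => ⟨a, l, h1, hXY _ _ h2⟩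
  have h' : Rep N m' R := h.congr (hm' _ rfl) (hm' _ rfl) (hm' _ rfl) (hm' _ rfl)
  simp [-ne_eq]
  refine or_congr Iff.rfl (h'.exists_st hv hi fun a q' h1 h2 h3 => ?_)
  rw [h3]
  exact hX q' h2 j hj

theorem isTab_safe (h : Rep N m R) (hv : R.Valid N d) :
    IsTab N (safeStm.eval N m 11) fun i j => ¬ R.SafeLE i j := by
  rw [← PLA.lfp_not_safeLE]
  refine isTab_lfp (fun X Y hXY i j ⟨a, i', h1, h2⟩ => ⟨a, i', h1, fun j' hj => hXY _ _ (h2 j' hj)⟩)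
    fun m' hm' X hX => isTab_fill fun i hi j hj => ?_
  have h' : Rep N m' R := h.congr (hm' _ rfl) (hm' _ rfl) (hm' _ rfl) (hm' _ rfl)
  simp [-ne_eq]
  refine h'.exists_st hv hi fun a q' h1 h2 h3 => ?_
  rcases h'.st_cases hv hj a with ⟨h4, h5⟩ | ⟨j', h4, h5, h6⟩
  · simp [h4, h5]
  · simp [h3, h5, h6, hX.eq_zero h2 h4]

theorem isTab_anc (h : Rep N m R) : IsTab N (ancStm.eval N m 12) R.Anc := by
  rw [← PLA.lfp_anc]
  refine isTab_lfp ?_ fun m' hm' X hX => isTab_fill fun i hi j hj => ?_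
  · exact fun X Y hXY i j => Or.imp_right fun ⟨h1, h2⟩ => ⟨h1, hXY _ _ h2⟩
  have h' : Rep N m' R := h.congr (hm' _ rfl) (hm' _ rfl) (hm' _ rfl) (hm' _ rfl)
  simp [-ne_eq, h'.lay i hi, h'.lay j hj, h'.par j hj, hX i hi _ (h.par_lt j hj)]

theorem isTab_kill (h : Rep N m R) (hv : R.Valid N d) {X : ℕ → ℕ → Prop}
    (hX : IsTab N (m 14) X) : IsTab N (killStm.eval N m 13) (R.Kill X) := by
  refine isTab_lfp (PLA.monotone_killStep X) fun m' hm' K hK => isTab_fill fun i hi j hj => ?_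
  have h' : Rep N m' R := h.congr (hm' _ rfl) (hm' _ rfl) (hm' _ rfl) (hm' _ rfl)
  rw [← hm' 14 rfl] at hX
  simp [-ne_eq, h'.lay i hi, h'.par i hi, PLA.killStep]
  intro _
  refine h'.exists_st hv (h.par_lt i hi) (P := fun a p' => ∃ j',
    R.st j a = some j' ∧ ¬ X p' j' ∧ ∀ c', R.st i a = some c' → K c' j')
    fun a q' h1 h2 h3 => ?_
  · rcases h'.st_cases hv hj a with ⟨h4, h5⟩ | ⟨j', h4, h5, h6⟩
    · simp [h4, h5]
    · rcases h'.st_cases hv hi a with ⟨h7, h8⟩ | ⟨i', h7, h8, h9⟩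
      · simp [h3, h5, h6, h7, h8, hX.eq_zero h2 h4]
      · simp [h3, h5, h6, h8, h9, hX.eq_zero h2 h4, hK.eq_zero h7 h4]

theorem isTab_clash (h : Rep N m R) (hv : R.Valid N d) :
    IsTab N (clashStm.eval N m 14) R.NoClash := by
  refine isTab_lfp PLA.monotone_clashStep fun m' hm' X hX => isTab_fill fun i hi j hj => ?_
  have h' : Rep N m' R := h.congr (hm' _ rfl) (hm' _ rfl) (hm' _ rfl) (hm' _ rfl)
  have hK := isTab_kill h' hv hX
  replace h' : Rep N (killStm.eval N m') R := h'.eval rfl rfl rfl rfl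
  replace hX : IsTab N (killStm.eval N m' 14) X := by
    rwa [eval_of_writes (S := killStm) rfl]
  generalize killStm.eval N m' = m' at h' hK hX
  simp [-ne_eq, PLA.clashStep, -not_and, -not_exists]
  refine not_congr (and_congr (h'.exists_st hv hi (P := fun a i' => ∃ j',
    R.st j a = some j' ∧ ¬ X i' j' ∧ ¬ X j' i') fun a q' h1 h2 h3 => ?_) ?_)
  · rcases h'.st_cases hv hj a with ⟨h4, h5⟩ | ⟨j', h4, h5, h6⟩
    · simp [h4, h5]
    · simp [h3, h5, h6, hX.eq_zero h2 h4, hX.eq_zero h4 h2]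
  · constructor
    · intro hno c hc
      have hcN := hv.lt c (by omega)
      refine ⟨fun hp => ?_, fun hp => ?_⟩ <;> by_contra hk
      · refine hno ⟨c, hcN, by rwa [h'.lay c hcN], .inl ⟨by rwa [h'.par c hcN], ?_⟩⟩
        rwa [hK.eq_zero hcN hj]
      · refine hno ⟨c, hcN, by rwa [h'.lay c hcN], .inr ⟨by rwa [h'.par c hcN], ?_⟩⟩
        rwa [hK.eq_zero hcN hi]
    · rintro hall ⟨c, hcN, hc, hp | hp⟩ <;> rw [h'.lay c hcN] at hc <;> rw [h'.par c hcN] at hp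
      · rw [hK.eq_zero hcN hj] at hp
        exact hp.2 ((hall c hc).1 hp.1)
      · rw [hK.eq_zero hcN hi] at hp
        exact hp.2 ((hall c hc).2 hp.1)

theorem isTab_differ (h : Rep N m R) (hv : R.Valid N d) :
    IsTab N (differStm.eval N m 15) R.Differ := by
  have hA := isTab_anc h
  replace h : Rep N (ancStm.eval N m) R := h.eval rfl rfl rfl rfl
  have hC := isTab_clash h hv
  replace hA : IsTab N (clashStm.eval N (ancStm.eval N m) 12) R.Anc := by
    rwa [eval_of_writes (S := clashStm) rfl]
  replace h : Rep N (clashStm.eval N (ancStm.eval N m)) R := h.eval rfl rfl rfl rfl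
  rw [differStm, eval_seq, eval_seq]
  generalize clashStm.eval N (ancStm.eval N m) = m at h hA hC
  refine isTab_lfp PLA.monotone_differStep fun m' hm' X hX => isTab_fill fun i hi j hj => ?_
  have h' : Rep N m' R := h.congr (hm' _ rfl) (hm' _ rfl) (hm' _ rfl) (hm' _ rfl)
  rw [← hm' 12 rfl] at hA
  rw [← hm' 14 rfl] at hC
  simp [-ne_eq]
  unfold PLA.differStep
  refine or_congr ?_ ((h'.exists_st hv hi (P := fun a i' => ∃ j',
    R.st j a = some j' ∧ X i' j') fun a q' h1 h2 h3 => ?_).trans (by simp only [exists_and_left]))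
  · have hodd : ∀ p q, (∃ y < N, y + y + 1 = R.lay p + R.lay q) ↔ Odd (R.lay p + R.lay q) := by
      intro p q
      have := hv.lay_lt p
      have := hv.lay_lt q
      exact ⟨fun ⟨y, _, hy⟩ => ⟨y, by omega⟩, fun ⟨y, hy⟩ => ⟨y, by omega, by omega⟩⟩
    constructor
    · rintro ⟨p, hp, q, hq, h1⟩
      rw [hA i hi p hp, hA j hj q hq, hC.eq_zero hp hq, h'.lay p hp, h'.lay q hq, hodd] at h1
      exact ⟨p, q, h1⟩
    · rintro ⟨p, q, h1⟩
      have hp := hv.lt p h1.1.lay_ne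
      have hq := hv.lt q h1.2.1.lay_ne
      refine ⟨p, hp, q, hq, ?_⟩
      rwa [hA i hi p hp, hA j hj q hq, hC.eq_zero hp hq, h'.lay p hp, h'.lay q hq, hodd]
  · rcases h'.st_cases hv hj a with ⟨h4, h5⟩ | ⟨j', h4, h5, h6⟩
    · simp [h4, h5]
    · simp [h3, h5, h6, hX.eq_zero h2 h4]

end RAM

/-! ### The steps of the procedure as programs -/

namespace RAM

open Exp Stm

variable {k N d : ℕ} {m m' : ℕ → ℕ → ℕ} {R : PLA (Fin k)}

/-- The quotient by the relation in the array `16`, with the representatives in the array `17`. -/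
def quotStm : Stm :=
  .seq (fill 17 (.ite (layer (.var 1)) (least 2 3 (.tab 16 (.var 2) (.var 1))) (.var 1))) <|
  .seq (fill 3 (.ite (.and (.eq (.get 17 (.var 0)) (.var 0)) (trans (.var 0) (.var 1)))
    (.plus (.get 17 (target (.var 0) (.var 1))) (.lit 1)) (.lit 0))) <|
  .seq (fill 2 (.get 17 (parent (.var 1)))) <|
  .seq (fill 1 (.ite (.eq (.get 17 (.var 1)) (.var 1)) (layer (.var 1)) (.lit 0))) <|
  fill 4 (.get 17 (.get 4 (.lit 0)))

theorem Rep.eval_quot (h : Rep N m R) (hv : R.Valid N d) {E : ℕ → ℕ → Prop} (hE : R.IsCongr E)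
    (ht : IsTab N (m 16) E) : Rep N (quotStm.eval N m) (R.quot (R.repOf N E)) := by
  classical
  have hN : 0 < N := (Nat.zero_le _).trans_lt hv.init_lt
  have hlt : ∀ q < N, R.repOf N E q < N := by
    intro q hq
    by_cases hl : R.lay q = 0
    · rwa [PLA.repOf, if_pos hl]
    · have h1 := (hv.repOf_spec hE hl).1
      exact hv.lt _ (by rw [(hE.lay _ _ h1).1]; exact hl)
  rw [quotStm, eval_seq]
  set m₁ := (fill 17 (.ite (layer (.var 1)) (least 2 3 (.tab 16 (.var 2) (.var 1)))
    (.var 1))).eval N m with hm₁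
  have h1 : Rep N m₁ R := h.eval rfl rfl rfl rfl
  have h17 : ∀ q < N, m₁ 17 q = R.repOf N E q := by
    intro q hq
    rw [hm₁, eval_fill_row hq, eval_ite, eval_least (P := fun p => E p q) (by decide)]
    · simp [PLA.repOf, h.lay q hq, ite_not]
    · intro x y hx
      simp [-ne_eq, ht x hx q hq]
  clear_value m₁
  refine ⟨h.letters, fun q hq => ?_, fun q hq => ?_, fun q hq => hlt _ (h.par_lt q hq),
    fun q hq a ha => ?_, ?_⟩
  · simp [eval_fill_row hq, h17 q hq, h1.lay q hq, PLA.quot]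
  · simp [eval_fill_row hq, h1.par q hq, h17 _ (h.par_lt q hq), PLA.quot]
  · rw [eval_seq, eval_seq, eval_seq, eval_fill_of_ne (by decide), eval_fill_of_ne (by decide),
      eval_fill_of_ne (by decide), eval_fill_tab hq ha]
    by_cases hk : a < k
    · rcases h1.st_cases hv hq ⟨a, hk⟩ with ⟨h2, h3⟩ | ⟨q', h2, h3, h4⟩
      · have h5 : (R.quot (R.repOf N E)).st q ⟨a, hk⟩ = none := by
          simp [PLA.quot, h2]
        have h6 := PLA.code_of_none h5
        simp only at h3 h6
        simp [h3, h6]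
      · by_cases hr : R.repOf N E q = q
        · have h5 : (R.quot (R.repOf N E)).st q ⟨a, hk⟩ = some (R.repOf N E q') := by
            simp [PLA.quot, h3, hr]
          have h6 := PLA.code_of_st h5
          simp only at h4 h6
          simp [h4, h6, h17 q hq, hr, h17 q' h2]
        · have h5 : (R.quot (R.repOf N E)).st q ⟨a, hk⟩ = none := by
            simp [PLA.quot, hr]
          have h6 := PLA.code_of_none h5
          simp only at h4 h6
          simp [h4, h6, h17 q hq, hr]
    · have h3 := h1.st q hq a ha
      rw [PLA.code_of_le (by omega)] at h3
      rw [PLA.code_of_le (by omega)]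
      simp [h3]
  · simp [eval_fill_row hN, h1.init, h17 _ hv.init_lt, PLA.quot]

/-- A change of the automaton that only removes transitions, as it is seen by the machine. -/
theorem Rep.code_restrict (h : Rep N m R) (hv : R.Valid N d) {R' : PLA (Fin k)} {q a : ℕ}
    (hq : q < N) (ha : a < N) {C : Prop} [Decidable C]
    (hst : ∀ (a' : Fin k) q', (a' : ℕ) = a → R.st q a' = some q' → q' < N →
      m 3 (q * N + a) = q' + 1 → R'.st q a' = if C then some q' else none)
    (hnone : ∀ a' : Fin k, R.st q a' = none → R'.st q a' = none) :
    R'.code q a = if C then m 3 (q * N + a) else 0 := by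
  by_cases hk : a < k
  · rcases h.st_cases hv hq ⟨a, hk⟩ with ⟨h2, h3⟩ | ⟨q', h2, h3, h4⟩
    · have := PLA.code_of_none (hnone _ h2)
      simp only at this h3
      rw [this, h3, ite_self]
    · have h5 := hst ⟨a, hk⟩ q' rfl h3 h2 h4
      by_cases hC : C
      · rw [if_pos hC] at h5 ⊢
        rw [h4]
        exact PLA.code_of_st h5
      · rw [if_neg hC] at h5 ⊢
        exact PLA.code_of_none h5
  · rw [PLA.code_of_le (by omega), h.st q hq a ha, PLA.code_of_le (by omega), ite_self]

/-- The automaton `PLA.trim`. -/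
def trimStm : Stm :=
  .seq reachStm <|
  .seq (fill 3 (.ite (.or (.eq (layer (.var 0)) (.lit 1))
    (.and (trans (.var 0) (.var 1)) (.tab 10 (target (.var 0) (.var 1)) (.var 0))))
    (trans (.var 0) (.var 1)) (.lit 0))) <|
  fill 1 (.ite (.or (.eq (layer (.var 1)) (.lit 1)) (.sum 2 (trans (.var 1) (.var 2))))
    (layer (.var 1)) (.lit 0))

theorem Rep.eval_trim (h : Rep N m R) (hv : R.Valid N d) : Rep N (trimStm.eval N m) R.trim := by
  classical
  have hR := isTab_reach h hv
  replace h : Rep N (reachStm.eval N m) R := h.eval rfl rfl rfl rfl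
  rw [trimStm, eval_seq]
  generalize reachStm.eval N m = m at h hR
  rw [eval_seq]
  set m₁ := (fill 3 (.ite (.or (.eq (layer (.var 0)) (.lit 1))
    (.and (trans (.var 0) (.var 1)) (.tab 10 (target (.var 0) (.var 1)) (.var 0))))
    (trans (.var 0) (.var 1)) (.lit 0))).eval N m with hm₁
  have hcode : ∀ q < N, ∀ a < N, m₁ 3 (q * N + a) = R.trim.code q a := by
    intro q hq a ha
    rw [hm₁, eval_fill_tab hq ha, eval_ite]
    symm
    refine h.code_restrict hv hq ha (fun a' q' h1 h2 h3 h4 => ?_) fun a' h1 => ?_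
    · have h5 : R.trim.st q a' = some q' ↔ R.lay q = 1 ∨ R.Reach q' q := by
        rw [PLA.trim, PLA.restrict_st]
        exact ⟨fun h => h.2.2, fun h => ⟨h.imp_right fun hr => ⟨a', q', h2, hr⟩, h2, h⟩⟩
      simp only [holds_or, holds_eq, holds_and, layer, trans, target, holds_tab, eval_get, eval_var,
        eval_lit, eval_minus, eval_tab, cell_zero, cell_one, h.lay q hq, h4, Nat.add_sub_cancel,
        hR q' h3 q hq, ne_eq, Nat.succ_ne_zero, not_false_eq_true, true_and]
      split_ifs with h6
      · exact h5.2 h6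
      · rw [Option.eq_none_iff_forall_ne_some]
        intro q'' hq''
        have h7 := (PLA.restrict_st.1 hq'').2.1
        rw [h2] at h7
        rw [← Option.some.inj h7] at hq''
        exact h6 (h5.1 hq'')
    · rw [Option.eq_none_iff_forall_ne_some]
      intro q'' hq''
      have h7 := (PLA.restrict_st.1 hq'').2.1
      rw [h1] at h7
      cases h7
  have h1 : ∀ a ≠ 3, m₁ a = m a := fun a ha => by rw [hm₁, eval_fill_of_ne ha]
  clear_value m₁
  refine ⟨h.letters, fun q hq => ?_, fun q hq => ?_, h.par_lt, fun q hq a ha => ?_, ?_⟩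
  · rw [eval_fill_row hq]
    simp only [eval_ite, holds_or, holds_eq, holds_sum, layer, trans, holds_tab, eval_get, eval_var,
      eval_lit, cell_one, h1 1 (by decide), h.lay q hq]
    have hiff : (∃ x < N, R.trim.code q x ≠ 0) ↔ ∃ a q', R.st q a = some q' ∧
        (R.lay q = 1 ∨ R.Reach q' q) := by
      constructor
      · rintro ⟨x, hx, h1⟩
        by_cases hk : x < k
        · rw [PLA.code, dif_pos hk] at h1
          rcases h2 : R.trim.st q ⟨x, hk⟩ with _ | q'
          · rw [h2] at h1
            exact absurd rfl h1
          · obtain ⟨-, h3, h4⟩ := PLA.restrict_st.1 h2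
            exact ⟨_, q', h3, h4⟩
        · rw [PLA.code_of_le (by omega)] at h1
          exact absurd rfl h1
      · rintro ⟨a, q', h1, h2⟩
        refine ⟨a, a.2.trans_le h.letters, ?_⟩
        rw [PLA.code_of_st (R := R.trim)
          (PLA.restrict_st.2 ⟨h2.imp_right fun hr => ⟨a, q', h1, hr⟩, h1, h2⟩)]
        exact Nat.succ_ne_zero q'
    have hiff' : (∃ x < N, m₁ 3 (q * N + x) ≠ 0) ↔
        ∃ a q', R.st q a = some q' ∧ (R.lay q = 1 ∨ R.Reach q' q) := by
      rw [← hiff]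
      exact exists_congr fun x => and_congr_right fun hx => by rw [hcode q hq x hx]
    have hup : ∀ x, Function.update (cell 0 q) 2 x 1 = q := fun x => rfl
    have hup2 : ∀ x, Function.update (cell 0 q) 2 x 2 = x := fun x => rfl
    simp only [hup, hup2, hiff']
    rw [PLA.trim, PLA.restrict]
    congr 1
    rw [eq_iff_iff]
    constructor
    · rintro (h1 | ⟨a, q', h1, h2⟩)
      · exact .inl h1
      · exact h2.imp_right fun hr => ⟨a, q', h1, hr⟩
    · rintro (h1 | ⟨a, q', h1, h2⟩)
      · exact .inl h1
      · exact .inr ⟨a, q', h1, .inr h2⟩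
  · rw [eval_fill_of_ne (by decide), h1 2 (by decide)]
    exact h.par q hq
  · rw [eval_fill_of_ne (show (3 : ℕ) ≠ 1 by decide), hcode q hq a ha]
  · rw [eval_fill_of_ne (by decide), h1 4 (by decide)]
    exact h.init

/-- The first element of the predicate in the array `20`, in the array `21`, and the states below
its component, in the array `22`. -/
def underStm : Stm :=
  .seq (fill 21 (least 2 3 (.get 20 (.var 2)))) <|
  fill 22 (.and (.lt (.get 21 (.lit 0)) (.scale (.lit 1)))
    (.sum 2 (.and (.tab 12 (.var 2) (.var 1)) (.tab 10 (.get 21 (.lit 0)) (.var 2)))))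

theorem eval_under (hv : R.Valid N d) {D : ℕ → Prop} (hR : IsTab N (m 10) R.Reach)
    (hA : IsTab N (m 12) R.Anc) (hD : IsRow N (m 20) D) :
    underStm.eval N m 21 0 = PLA.leastBelow N D ∧
      ∀ q < N, underStm.eval N m 22 q ≠ 0 ↔ R.Under (PLA.leastBelow N D) q := by
  have hN : 0 < N := (Nat.zero_le _).trans_lt hv.init_lt
  rw [underStm, eval_seq]
  set m₁ := (fill 21 (least 2 3 (.get 20 (.var 2)))).eval N m with hm₁
  have h21 : m₁ 21 0 = PLA.leastBelow N D := by
    rw [hm₁, eval_fill_row hN]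
    refine eval_least (by decide) fun x y hx => ?_
    simp [-ne_eq, hD x hx]
  have h10 : IsTab N (m₁ 10) R.Reach := by rwa [hm₁, eval_fill_of_ne (by decide)]
  have h12 : IsTab N (m₁ 12) R.Anc := by rwa [hm₁, eval_fill_of_ne (by decide)]
  clear_value m₁
  refine ⟨by rw [eval_fill_of_ne (by decide), h21], ?_⟩
  refine isRow_fill fun q hq => ?_
  simp [-ne_eq, h21]
  constructor
  · rintro ⟨h1, s, hs, h2, h3⟩
    exact ⟨s, (h12 s hs q hq).1 h2, (h10 _ h1 s hs).1 h3⟩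
  · rintro ⟨s, h2, h3⟩
    have h4 := (hv.anc_lay h2).1
    have h1 := hv.lt _ (by rw [← hv.reach_lay h3]; exact h4)
    have hs := hv.lt s h4
    exact ⟨h1, s, hs, (h12 s hs q hq).2 h2, (h10 _ h1 s hs).2 h3⟩

/-- The automaton `PLA.collapseFirst`. -/
def collapseStm : Stm :=
  .seq reachStm <| .seq safeStm <| .seq ancStm <|
  .seq (fill 20 (.and (.lt (.lit 1) (layer (.var 1))) (.sum 2 (.and (.lt (.lit 1) (layer (.var 2)))
    (.and (.eq (parent (.var 2)) (.var 1)) (.not (.tab 11 (.var 1) (.var 2)))))))) <|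
  .seq underStm <|
  .seq (fill 3 (.ite (.not (.and (.get 22 (.var 0))
    (.lt (layer (.var 0)) (.plus (layer (.get 21 (.lit 0))) (.lit 2)))))
    (trans (.var 0) (.var 1)) (.lit 0))) <|
  .seq (fill 2 (.ite (.and (.get 22 (.var 1))
    (.eq (layer (.var 1)) (.plus (layer (.get 21 (.lit 0))) (.lit 2))))
    (parent (parent (parent (.var 1)))) (parent (.var 1)))) <|
  fill 1 (.ite (.get 22 (.var 1)) (.ite
    (.lt (layer (.var 1)) (.plus (layer (.get 21 (.lit 0))) (.lit 2)))
    (.lit 0) (.minus (layer (.var 1)) (.lit 2))) (layer (.var 1)))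

theorem Rep.eval_collapse (h : Rep N m R) (hv : R.Valid N d) :
    Rep N (collapseStm.eval N m) (R.collapseFirst N) := by
  classical
  have hN : 0 < N := (Nat.zero_le _).trans_lt hv.init_lt
  have h10 := isTab_reach h hv
  replace h : Rep N (reachStm.eval N m) R := h.eval rfl rfl rfl rfl
  rw [collapseStm, eval_seq]
  generalize reachStm.eval N m = m at h h10
  have h11 := isTab_safe h hv
  replace h : Rep N (safeStm.eval N m) R := h.eval rfl rfl rfl rfl
  rw [← eval_of_writes (S := safeStm) (N := N) (a := 10) rfl m] at h10
  rw [eval_seq]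
  generalize safeStm.eval N m = m at h h10 h11
  have h12 := isTab_anc h
  replace h : Rep N (ancStm.eval N m) R := h.eval rfl rfl rfl rfl
  rw [← eval_of_writes (S := ancStm) (N := N) (a := 10) rfl m] at h10
  rw [← eval_of_writes (S := ancStm) (N := N) (a := 11) rfl m] at h11
  rw [eval_seq]
  generalize ancStm.eval N m = m at h h10 h11 h12
  rw [eval_seq]
  set m₁ := (fill 20 (.and (.lt (.lit 1) (layer (.var 1))) (.sum 2
    (.and (.lt (.lit 1) (layer (.var 2))) (.and (.eq (parent (.var 2)) (.var 1))
      (.not (.tab 11 (.var 1) (.var 2)))))))).eval N m with hm₁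
  have h20 : IsRow N (m₁ 20) R.CollapseDefect := by
    refine isRow_fill fun q hq => ?_
    simp [-ne_eq, h.lay q hq, PLA.CollapseDefect]
    intro _
    constructor
    · rintro ⟨c, hc, h1⟩
      rw [h.lay c hc, h.par c hc, h11.eq_zero hq hc, not_not] at h1
      exact ⟨c, h1⟩
    · rintro ⟨c, h1⟩
      have hc := hv.lt c (by omega)
      refine ⟨c, hc, ?_⟩
      rwa [h.lay c hc, h.par c hc, h11.eq_zero hq hc, not_not]
  replace h : Rep N m₁ R := h.eval rfl rfl rfl rfl
  replace h10 : IsTab N (m₁ 10) R.Reach := by rwa [hm₁, eval_fill_of_ne (by decide)]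
  replace h12 : IsTab N (m₁ 12) R.Anc := by rwa [hm₁, eval_fill_of_ne (by decide)]
  clear_value m₁
  rw [eval_seq]
  obtain ⟨h21, h22⟩ := eval_under hv h10 h12 h20
  replace h : Rep N (underStm.eval N m₁) R := h.eval rfl rfl rfl rfl
  generalize underStm.eval N m₁ = m at h h21 h22
  -- The layer of the first defect matters only if there is one.
  have hlay : ∀ q, R.Under (PLA.leastBelow N R.CollapseDefect) q →
      m 1 (PLA.leastBelow N R.CollapseDefect) = R.lay (PLA.leastBelow N R.CollapseDefect) :=
    fun q hu => h.lay _ (hv.lt _ (hv.under_lay hu).2.2.1)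
  rw [PLA.collapseFirst]
  generalize PLA.leastBelow N R.CollapseDefect = p at h21 h22 hlay
  rw [eval_seq, eval_seq]
  refine ⟨h.letters, fun q hq => ?_, fun q hq => ?_, fun q hq => ?_, fun q hq a ha => ?_, ?_⟩
  · rw [eval_fill_row hq]
    by_cases hu : R.Under p q
    · simp [h21, (h22 q hq).2 hu, hu, hlay q hu, h.lay q hq, PLA.collapse, Nat.lt_succ_iff]
    · simp [not_not.1 (mt (h22 q hq).1 hu), hu, h.lay q hq, PLA.collapse]
  · rw [eval_fill_of_ne (by decide), eval_fill_row hq]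
    have h1 := h.par_lt q hq
    have h2 := h.par_lt _ h1
    by_cases hu : R.Under p q
    · simp [h21, (h22 q hq).2 hu, hu, hlay q hu, h.lay q hq, h.par q hq, h.par _ h1, h.par _ h2,
        PLA.collapse]
    · simp [not_not.1 (mt (h22 q hq).1 hu), hu, h.par q hq, PLA.collapse]
  · simp only [PLA.collapse]
    split_ifs
    · exact h.par_lt _ (h.par_lt _ (h.par_lt q hq))
    · exact h.par_lt q hq
  · rw [eval_fill_of_ne (by decide), eval_fill_of_ne (by decide), eval_fill_tab hq ha, eval_ite]
    symm
    refine h.code_restrict hv hq ha (fun a' q' h1 h2 h3 h4 => ?_) fun a' h1 => ?_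
    · by_cases hu : R.Under p q
      · simp [h21, (h22 q hq).2 hu, hu, hlay q hu, h.lay q hq, PLA.collapse, h2, Nat.lt_succ_iff]
        split_ifs <;> first | rfl | omega
      · simp [not_not.1 (mt (h22 q hq).1 hu), hu, PLA.collapse, h2]
    · simp [PLA.collapse, h1]
  · rw [eval_fill_of_ne (by decide), eval_fill_of_ne (by decide), eval_fill_of_ne (by decide)]
    exact h.init

/-- The automaton `PLA.deleteFirst`. -/
def deleteStm : Stm :=
  .seq reachStm <| .seq safeStm <| .seq ancStm <|
  .seq (fill 20 (.and (.lt (.lit 1) (layer (.var 1)))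
    (.sum 2 (.and (.eq (layer (.var 2)) (layer (.var 1)))
      (.and (.eq (parent (.var 2)) (parent (.var 1))) (.and (.not (.tab 11 (.var 1) (.var 2)))
        (.not (.tab 10 (.var 1) (.var 2))))))))) <|
  .seq underStm <|
  .seq (fill 3 (.ite (.not (.get 22 (.var 0))) (trans (.var 0) (.var 1)) (.lit 0))) <|
  fill 1 (.ite (.not (.get 22 (.var 1))) (layer (.var 1)) (.lit 0))

theorem Rep.eval_delete (h : Rep N m R) (hv : R.Valid N d) :
    Rep N (deleteStm.eval N m) (R.deleteFirst N) := by
  classical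
  have hN : 0 < N := (Nat.zero_le _).trans_lt hv.init_lt
  have h10 := isTab_reach h hv
  replace h : Rep N (reachStm.eval N m) R := h.eval rfl rfl rfl rfl
  rw [deleteStm, eval_seq]
  generalize reachStm.eval N m = m at h h10
  have h11 := isTab_safe h hv
  replace h : Rep N (safeStm.eval N m) R := h.eval rfl rfl rfl rfl
  rw [← eval_of_writes (S := safeStm) (N := N) (a := 10) rfl m] at h10
  rw [eval_seq]
  generalize safeStm.eval N m = m at h h10 h11
  have h12 := isTab_anc h
  replace h : Rep N (ancStm.eval N m) R := h.eval rfl rfl rfl rfl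
  rw [← eval_of_writes (S := ancStm) (N := N) (a := 10) rfl m] at h10
  rw [← eval_of_writes (S := ancStm) (N := N) (a := 11) rfl m] at h11
  rw [eval_seq]
  generalize ancStm.eval N m = m at h h10 h11 h12
  rw [eval_seq]
  set m₁ := (fill 20 (.and (.lt (.lit 1) (layer (.var 1)))
    (.sum 2 (.and (.eq (layer (.var 2)) (layer (.var 1)))
      (.and (.eq (parent (.var 2)) (parent (.var 1))) (.and (.not (.tab 11 (.var 1) (.var 2)))
        (.not (.tab 10 (.var 1) (.var 2))))))))).eval N m with hm₁
  have h20 : IsRow N (m₁ 20) R.DeleteDefect := by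
    refine isRow_fill fun q hq => ?_
    simp [-ne_eq, h.lay q hq, h.par q hq, PLA.DeleteDefect]
    intro hlq
    constructor
    · rintro ⟨c, hc, h1⟩
      rw [h.lay c hc, h.par c hc, h11.eq_zero hq hc, not_not, h10.eq_zero hq hc] at h1
      exact ⟨c, h1⟩
    · rintro ⟨c, h1⟩
      have hc := hv.lt c (by omega)
      refine ⟨c, hc, ?_⟩
      rwa [h.lay c hc, h.par c hc, h11.eq_zero hq hc, not_not, h10.eq_zero hq hc]
  replace h : Rep N m₁ R := h.eval rfl rfl rfl rfl
  replace h10 : IsTab N (m₁ 10) R.Reach := by rwa [hm₁, eval_fill_of_ne (by decide)]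
  replace h12 : IsTab N (m₁ 12) R.Anc := by rwa [hm₁, eval_fill_of_ne (by decide)]
  clear_value m₁
  rw [eval_seq]
  obtain ⟨h21, h22⟩ := eval_under hv h10 h12 h20
  replace h : Rep N (underStm.eval N m₁) R := h.eval rfl rfl rfl rfl
  generalize underStm.eval N m₁ = m at h h21 h22
  rw [PLA.deleteFirst]
  generalize PLA.leastBelow N R.DeleteDefect = p at h21 h22
  rw [eval_seq]
  refine ⟨h.letters, fun q hq => ?_, fun q hq => ?_, h.par_lt, fun q hq a ha => ?_, ?_⟩
  · rw [eval_fill_row hq]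
    by_cases hu : R.Under p q
    · simp [(h22 q hq).2 hu, hu, PLA.delete, PLA.restrict]
    · simp [not_not.1 (mt (h22 q hq).1 hu), hu, h.lay q hq, PLA.delete, PLA.restrict]
  · rw [eval_fill_of_ne (by decide), eval_fill_of_ne (by decide)]
    exact h.par q hq
  · rw [eval_fill_of_ne (by decide), eval_fill_tab hq ha, eval_ite]
    symm
    refine h.code_restrict hv hq ha (fun a' q' h1 h2 h3 h4 => ?_) fun a' h1 => ?_
    · simp [-ne_eq, -ite_not, h22 q hq, PLA.delete, PLA.restrict, h2, Option.filter]
    · simp [PLA.delete, PLA.restrict, h1]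
  · rw [eval_fill_of_ne (by decide), eval_fill_of_ne (by decide)]
    exact h.init

/-- The automaton `PLA.merge`. -/
def mergeStm : Stm :=
  .seq safeStm <|
  .seq (fill 16 (.and (layer (.var 0)) (.and (.eq (layer (.var 0)) (layer (.var 1)))
    (.and (.eq (parent (.var 0)) (parent (.var 1))) (.and (.not (.tab 11 (.var 0) (.var 1)))
      (.not (.tab 11 (.var 1) (.var 0)))))))) <|
  quotStm

theorem Rep.eval_merge (h : Rep N m R) (hv : R.Valid N d) :
    Rep N (mergeStm.eval N m) (R.merge N) := by
  have h11 := isTab_safe h hv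
  replace h : Rep N (safeStm.eval N m) R := h.eval rfl rfl rfl rfl
  rw [mergeStm, eval_seq, eval_seq]
  generalize safeStm.eval N m = m at h h11
  refine Rep.eval_quot (h.eval rfl rfl rfl rfl) hv hv.isCongr_mergeRel
    (isTab_fill fun i hi j hj => ?_)
  simp [h.lay i hi, h.lay j hj, h.par i hi, h.par j hj, h11.eq_zero hi hj, h11.eq_zero hj hi,
    PLA.MergeRel]

/-- The automaton `PLA.langQuot`. -/
def langStm : Stm :=
  .seq differStm <|
  .seq (fill 16 (.and (layer (.var 0)) (.or (.eq (.var 0) (.var 1))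
    (.and (.eq (layer (.var 0)) (.lit 1)) (.and (.eq (layer (.var 1)) (.lit 1))
      (.not (.tab 15 (.var 0) (.var 1)))))))) <|
  quotStm

theorem Rep.eval_lang (h : Rep N m R) (hv : R.Valid N d) {Λ : ℕ → Set (ℕ → Fin k)}
    (hc : R.Cert Λ) : Rep N (langStm.eval N m) (R.langQuot N) := by
  have h15 := isTab_differ h hv
  replace h : Rep N (differStm.eval N m) R := h.eval rfl rfl rfl rfl
  rw [langStm, eval_seq, eval_seq]
  generalize differStm.eval N m = m at h h15
  refine Rep.eval_quot (h.eval rfl rfl rfl rfl) hv (hv.isCongr_langRel hc)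
    (isTab_fill fun i hi j hj => ?_)
  simp [h.lay i hi, h.lay j hj, h15.eq_zero hi hj, PLA.LangRel]

/-- A round of the minimisation procedure. -/
def roundStm : Stm := .seq collapseStm <| .seq deleteStm mergeStm

theorem Rep.eval_round (h : Rep N m R) (hv : R.Valid N d) (hr : R.Recurrent) :
    Rep N (roundStm.eval N m) (R.round N) ∧ (R.round N).Valid N d ∧ (R.round N).Recurrent := by
  have h1 : (R.collapseFirst N).Valid N d ∧ (R.collapseFirst N).Recurrent := by
    rcases hv.collapseFirst_or with ⟨-, he⟩ | ⟨p, hp, he⟩ <;> rw [he]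
    · exact ⟨hv, hr⟩
    · exact ⟨hv.collapse hr hp.1, hr.collapse hv hp.1⟩
  have h2 : ((R.collapseFirst N).deleteFirst N).Valid N d ∧
      ((R.collapseFirst N).deleteFirst N).Recurrent := by
    rcases h1.1.deleteFirst_or with ⟨-, he⟩ | ⟨p, hp, he⟩ <;> rw [he]
    · exact h1
    · exact ⟨h1.1.delete h1.2 (.inl hp.1), h1.2.restrict_delete h1.1 (.inl hp.1)⟩
  have hrep := h2.1.isRep_repOf h2.1.isCongr_mergeRel
  exact ⟨((h.eval_collapse hv).eval_delete h1.1).eval_merge h2.1, h2.1.quot hrep, h2.2.quot hrep⟩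

theorem Rep.eval_iter_round (h : Rep N m R) (hv : R.Valid N d) (hr : R.Recurrent) :
    Rep N ((Stm.iter roundStm).eval N m) ((PLA.round N)^[N] R) := by
  rw [Stm.eval]
  suffices ∀ x, Rep N ((roundStm.eval N)^[x] m) ((PLA.round N)^[x] R) ∧
    ((PLA.round N)^[x] R).Valid N d ∧ ((PLA.round N)^[x] R).Recurrent from (this N).1
  intro x
  induction x with
  | zero => exact ⟨h, hv, hr⟩
  | succ x ih =>
    rw [Function.iterate_succ_apply', Function.iterate_succ_apply']
    exact ih.1.eval_round ih.2.1 ih.2.2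

end RAM

/-! ### Reading the input and writing the output -/

namespace LayeredAutomaton

variable {k n : ℕ} (A : LayeredAutomaton (Fin k) (Fin n))

theorem code_eq : A.code = [A.d, k, n, (A.init : ℕ)] ++ (List.ofFn (fun q => A.layer q) ++
    (List.ofFn (fun q => (A.parent q : ℕ)) ++ List.ofFn fun t : Fin (n * k) =>
      (A.step t.divNat t.modNat).elim 0 fun q => (q : ℕ) + 1)) := by
  rw [List.ofFn_mul, code, List.append_assoc, List.append_assoc]
  congr 5
  refine funext fun q => congrArg List.ofFn (funext fun a => ?_)
  have hk : 0 < k := a.pos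
  have h1 : (⟨q * k + a, by
      calc (q : ℕ) * k + a < (q + 1) * k := by rw [add_mul, one_mul]; omega
        _ ≤ n * k := Nat.mul_le_mul_right k q.2⟩ : Fin (n * k)).divNat = q := by
    ext
    simp [Fin.divNat, Nat.add_div_of_dvd_right, Nat.div_eq_of_lt, hk]
  have h2 : (⟨q * k + a, by
      calc (q : ℕ) * k + a < (q + 1) * k := by rw [add_mul, one_mul]; omega
        _ ≤ n * k := Nat.mul_le_mul_right k q.2⟩ : Fin (n * k)).modNat = a := by
    ext
    simp [Fin.modNat, Nat.mod_eq_of_lt]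
  rw [h1, h2]
  cases A.step q a <;> rfl

theorem length_code : A.code.length = 4 + 2 * n + n * k := by
  simp [code_eq]
  omega

theorem getD_code_head : A.code.getD 0 0 = A.d ∧ A.code.getD 1 0 = k ∧ A.code.getD 2 0 = n ∧
    A.code.getD 3 0 = A.init := ⟨rfl, rfl, rfl, rfl⟩

theorem getD_ofFn {m : ℕ} (f : Fin m → ℕ) (i : Fin m) : (List.ofFn f).getD i 0 = f i := by
  simp [List.getD_eq_getElem?_getD]

theorem getD_code_layer (q : Fin n) : A.code.getD (4 + q) 0 = A.layer q := by
  rw [code_eq, List.getD_append_right _ _ _ _ (by simp), List.getD_append _ _ _ _ (by simp)]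
  rw [← getD_ofFn (fun q => A.layer q)]
  congr 1
  simp

theorem getD_code_parent (q : Fin n) : A.code.getD (4 + n + q) 0 = A.parent q := by
  rw [code_eq, List.getD_append_right _ _ _ _ (by simp; omega),
    List.getD_append_right _ _ _ _ (by simp; omega), List.getD_append _ _ _ _ (by simp; omega)]
  rw [← getD_ofFn (fun q => (A.parent q : ℕ))]
  congr 1
  simp
  omega

theorem getD_code_step (q : Fin n) (a : Fin k) : A.code.getD (4 + n + n + (q * k + a)) 0 =
    (A.step q a).elim 0 fun q => (q : ℕ) + 1 := by
  have hk : 0 < k := a.pos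
  have hlt : (q : ℕ) * k + a < n * k := by
    calc (q : ℕ) * k + a < (q + 1) * k := by rw [add_mul, one_mul]; omega
      _ ≤ n * k := Nat.mul_le_mul_right k q.2
  rw [code_eq, List.getD_append_right _ _ _ _ (by simp; omega),
    List.getD_append_right _ _ _ _ (by simp; omega),
    List.getD_append_right _ _ _ _ (by simp; omega)]
  have h1 : (⟨q * k + a, hlt⟩ : Fin (n * k)).divNat = q := by
    ext
    simp [Fin.divNat, Nat.add_div_of_dvd_right, Nat.div_eq_of_lt, hk]
  have h2 : (⟨q * k + a, hlt⟩ : Fin (n * k)).modNat = a := by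
    ext
    simp [Fin.modNat, Nat.mod_eq_of_lt]
  have h3 := getD_ofFn (fun t : Fin (n * k) =>
      (A.step t.divNat t.modNat).elim 0 fun q => (q : ℕ) + 1) ⟨q * k + a, hlt⟩
  simp only [h1, h2] at h3
  rw [← h3]
  congr 1
  simp
  omega

theorem length_code_le : A.code.length ≤ 4 + 2 * A.size + A.size ^ 2 := by
  rw [length_code, size]
  nlinarith [Nat.zero_le A.d]

end LayeredAutomaton

namespace RAM

open Exp Stm

variable {k N d : ℕ} {m m' : ℕ → ℕ → ℕ} {R : PLA (Fin k)}

/-- The product of `e` and `f`, if the value of `f` is at most `N`; the variable `i` is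
auxiliary. -/
def Exp.mul (i : Fin 8) (e f : Exp) : Exp := .sum i (.ite (.lt (.var i) f) e (.lit 0))

theorem Exp.eval_mul {i : Fin 8} {e f : Exp} {ρ : Fin 8 → ℕ} {x y : ℕ}
    (he : ∀ v, e.eval N m (Function.update ρ i v) = x)
    (hf : ∀ v, f.eval N m (Function.update ρ i v) = y) (hy : y ≤ N) :
    (mul i e f).eval N m ρ = x * y := by
  simp only [mul, eval_sum, eval_ite, holds_lt, eval_var, Function.update_self, he, hf, eval_lit]
  rw [← Finset.sum_filter, show (Finset.range N).filter (· < y) = Finset.range y by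
    ext v
    simp only [Finset.mem_filter, Finset.mem_range]
    omega]
  simp [mul_comm]

/-- Entries of the input. -/
def input (e : Exp) : Exp := .get 0 e

attribute [simp] input

/-- Read the automaton from the input. -/
def loadStm : Stm :=
  .seq (fill 1 (.ite (.lt (.var 1) (input (.lit 2))) (input (.plus (.lit 4) (.var 1))) (.lit 0))) <|
  .seq (fill 2 (.ite (.lt (.var 1) (input (.lit 2)))
    (input (.plus (.plus (.lit 4) (input (.lit 2))) (.var 1))) (.lit 0))) <|
  .seq (fill 3 (.ite (.and (.lt (.var 0) (input (.lit 2))) (.lt (.var 1) (input (.lit 1))))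
    (input (.plus (.plus (.plus (.lit 4) (input (.lit 2))) (input (.lit 2)))
      (.plus (.mul 2 (.var 0) (input (.lit 1))) (.var 1)))) (.lit 0))) <|
  fill 4 (input (.lit 3))

theorem rep_load {n : ℕ} (A : LayeredAutomaton (Fin k) (Fin n))
    (hm : m 0 = fun i => A.code.getD i 0)
    (hN : N = A.code.length) : Rep N (loadStm.eval N m) (PLA.ofLA A) := by
  obtain ⟨-, hk, hn, hi⟩ := A.getD_code_head
  have hn0 : 0 < n := A.init.pos
  have hlen := A.length_code
  have hkN : k ≤ N := by
    have := Nat.le_mul_of_pos_left k hn0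
    omega
  have hN0 : 0 < N := by omega
  have h0 : ∀ i, m 0 i = A.code.getD i 0 := fun i => by rw [hm]
  rw [loadStm, eval_seq, eval_seq, eval_seq]
  refine ⟨hkN, fun q hq => ?_, fun q hq => ?_, fun q hq => ?_, fun q hq a ha => ?_, ?_⟩
  · rw [eval_fill_of_ne (by decide), eval_fill_of_ne (by decide), eval_fill_of_ne (by decide),
      eval_fill_row hq]
    simp only [eval_ite, holds_lt, input, eval_get, eval_lit, eval_var, eval_plus, cell_one, h0, hn,
      PLA.ofLA]
    by_cases h : q < n
    · rw [if_pos h, dif_pos h]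
      exact A.getD_code_layer ⟨q, h⟩
    · rw [if_neg h, dif_neg h]
  · rw [eval_fill_of_ne (by decide), eval_fill_of_ne (by decide), eval_fill_row hq]
    simp only [eval_ite, holds_lt, input, eval_get, eval_lit, eval_var, eval_plus, cell_one,
      eval_fill_of_ne (show (0 : ℕ) ≠ 1 by decide), h0, hn, PLA.ofLA]
    by_cases h : q < n
    · rw [if_pos h, dif_pos h]
      exact A.getD_code_parent ⟨q, h⟩
    · rw [if_neg h, dif_neg h]
  · simp only [PLA.ofLA]
    split_ifs with h
    · omega
    · exact hN0
  · have h1 : ∀ i, (fill 2 (.ite (.lt (.var 1) (input (.lit 2)))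
        (input (.plus (.plus (.lit 4) (input (.lit 2))) (.var 1))) (.lit 0))).eval N
        ((fill 1 (.ite (.lt (.var 1) (input (.lit 2))) (input (.plus (.lit 4) (.var 1)))
        (.lit 0))).eval N m) 0 i = A.code.getD i 0 := fun i => by
      rw [eval_fill_of_ne (by decide), eval_fill_of_ne (by decide), h0]
    rw [eval_fill_of_ne (by decide), eval_fill_tab hq ha]
    generalize (fill 2 _).eval N _ = m₂ at h1
    have hmul : (Exp.mul 2 (.var 0) (input (.lit 1))).eval N m₂ (cell q a) = q * k :=
      eval_mul (fun _ => rfl) (fun _ => (h1 1).trans hk) hkN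
    simp only [eval_ite, holds_and, holds_lt, eval_get, eval_lit, eval_var, eval_plus, hmul,
      input, cell_one, cell_zero, h1, hk, hn] at hmul ⊢
    by_cases h : q < n ∧ a < k
    · rw [if_pos h, PLA.code, dif_pos h.2]
      have h2 := A.getD_code_step ⟨q, h.1⟩ ⟨a, h.2⟩
      simp only at h2
      rw [h2]
      simp only [PLA.ofLA, dif_pos h.1]
      cases A.step ⟨q, h.1⟩ ⟨a, h.2⟩ <;> rfl
    · rw [if_neg h, PLA.code]
      split_ifs with h2
      · simp only [PLA.ofLA]
        rw [dif_neg (by tauto)]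
        rfl
      · rfl
  · rw [eval_fill_row hN0]
    exact (congrFun (by rw [eval_fill_of_ne (by decide), eval_fill_of_ne (by decide),
      eval_fill_of_ne (by decide), hm]) 3).trans hi

/-- The numbers of smaller states, in the array `30`, the number of all states, in the array `31`,
and the enumeration of the states, in the array `32`. -/
def rankStm : Stm :=
  .seq (fill 30 (.sum 2 (.ite (.and (layer (.var 2)) (.lt (.var 2) (.var 1)))
    (.lit 1) (.lit 0)))) <|
  .seq (fill 31 (.sum 2 (.ite (layer (.var 2)) (.lit 1) (.lit 0)))) <|
  fill 32 (.sum 2 (.ite (.and (layer (.var 2)) (.eq (.get 30 (.var 2)) (.var 1))) (.var 2)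
    (.lit 0)))

/-- The length of the output. -/
def outLength : Exp :=
  .plus (.plus (.lit 4) (.plus (.get 31 (.lit 0)) (.get 31 (.lit 0))))
    (.mul 2 (.get 31 (.lit 0)) (input (.lit 1)))

/-- The entry of the output with the index in the variable `1`. -/
def outEntry : Exp :=
  .ite (.eq (.var 1) (.lit 0)) (input (.lit 0)) <|
  .ite (.eq (.var 1) (.lit 1)) (input (.lit 1)) <|
  .ite (.eq (.var 1) (.lit 2)) (.get 31 (.lit 0)) <|
  .ite (.eq (.var 1) (.lit 3)) (.get 30 (.get 4 (.lit 0))) <|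
  .ite (.lt (.var 1) (.plus (.lit 4) (.get 31 (.lit 0))))
    (layer (.get 32 (.minus (.var 1) (.lit 4)))) <|
  .ite (.lt (.var 1) (.plus (.plus (.lit 4) (.get 31 (.lit 0))) (.get 31 (.lit 0))))
    (.get 30 (parent (.get 32 (.minus (.var 1) (.plus (.lit 4) (.get 31 (.lit 0))))))) <|
  .sum 2 (.sum 3 (.ite (.and (.lt (.var 3) (input (.lit 1))) (.eq (.var 1)
      (.plus (.plus (.plus (.lit 4) (.get 31 (.lit 0))) (.get 31 (.lit 0)))
        (.plus (.mul 4 (.var 2) (input (.lit 1))) (.var 3)))))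
    (.ite (trans (.get 32 (.var 2)) (.var 3))
      (.plus (.get 30 (target (.get 32 (.var 2)) (.var 3))) (.lit 1)) (.lit 0)) (.lit 0)))

open Classical in
/-- The states of `R` can be renamed in increasing order. -/
theorem exists_equiv_count {α : Type*} {R : PLA α} (h : R.Valid N d) :
    ∃ e : Fin (Nat.count (fun q => R.lay q ≠ 0) N) ≃ {q // R.lay q ≠ 0},
      ∀ i, Nat.count (fun q => R.lay q ≠ 0) (e i) = i := by
  let P : ℕ → Prop := fun q => R.lay q ≠ 0
  have hlt : ∀ q : {q // P q}, Nat.count P q < Nat.count P N := fun q =>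
    Nat.count_strict_mono q.2 (h.lt _ q.2)
  let f : {q // P q} → Fin (Nat.count P N) := fun q => ⟨Nat.count P q, hlt q⟩
  have hf : Function.Bijective f := by
    constructor
    · intro q r hqr
      exact Subtype.ext (Nat.count_injective q.2 r.2 (congrArg Fin.val hqr))
    · intro i
      have hcard : ∀ hfin : {x | P x}.Finite, (i : ℕ) < hfin.toFinset.card := by
        intro hfin
        refine i.2.trans_le ?_
        rw [Nat.count_eq_card_filter_range]
        exact Finset.card_le_card fun x hx => by simpa using (Finset.mem_filter.1 hx).2
      exact ⟨⟨Nat.nth P i, Nat.nth_mem _ hcard⟩, Fin.ext (Nat.count_nth hcard)⟩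
  refine ⟨(Equiv.ofBijective f hf).symm, fun i => ?_⟩
  exact congrArg Fin.val ((Equiv.ofBijective f hf).apply_symm_apply i)

open Classical in
theorem eval_rank (h : Rep N m R) (hv : R.Valid N d) {M : ℕ} {e : Fin M → ℕ}
    (he : ∀ i, R.lay (e i) ≠ 0) (hM : M = Nat.count (fun q => R.lay q ≠ 0) N)
    (hcount : ∀ i, Nat.count (fun q => R.lay q ≠ 0) (e i) = i) :
    (∀ q < N, rankStm.eval N m 30 q = Nat.count (fun q => R.lay q ≠ 0) q) ∧
      rankStm.eval N m 31 0 = M ∧ ∀ i : Fin M, rankStm.eval N m 32 i = e i := by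
  have hN : 0 < N := (Nat.zero_le _).trans_lt hv.init_lt
  rw [rankStm, eval_seq, eval_seq]
  set m₁ := (fill 30 (.sum 2 (.ite (.and (layer (.var 2)) (.lt (.var 2) (.var 1))) (.lit 1)
    (.lit 0)))).eval N m with hm₁
  have h30 : ∀ q < N, m₁ 30 q = Nat.count (fun q => R.lay q ≠ 0) q := by
    intro q hq
    rw [hm₁, eval_fill_row hq, Nat.count_eq_card_filter_range, Finset.card_filter]
    have hsub : Finset.range q ⊆ Finset.range N := by
      intro x hx
      simp only [Finset.mem_range] at hx ⊢
      omega
    rw [eval_sum]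
    refine (Finset.sum_subset hsub fun x _ hx => ?_).symm.trans
      (Finset.sum_congr rfl fun x hx => ?_)
    · rw [Finset.mem_range] at hx
      simp [hx]
    · rw [Finset.mem_range] at hx
      simp [hx, h.lay x (by omega)]
  have h1 : Rep N m₁ R := h.eval rfl rfl rfl rfl
  clear_value m₁
  have h31 : (fill 31 (.sum 2 (.ite (layer (.var 2)) (.lit 1) (.lit 0)))).eval N m₁ 31 0 = M := by
    rw [eval_fill_row hN, hM, Nat.count_eq_card_filter_range, Finset.card_filter, eval_sum]
    refine Finset.sum_congr rfl fun x hx => ?_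
    simp [h1.lay x (Finset.mem_range.1 hx)]
  have h2 : Rep N ((fill 31 (.sum 2 (.ite (layer (.var 2)) (.lit 1) (.lit 0)))).eval N m₁) R :=
    h1.eval rfl rfl rfl rfl
  rw [← eval_fill_of_ne (show (30 : ℕ) ≠ 31 by decide)
    (N := N) (e := .sum 2 (.ite (layer (.var 2)) (.lit 1) (.lit 0))) (m := m₁)] at h30
  generalize (fill 31 _).eval N m₁ = m₂ at h2 h30 h31
  refine ⟨fun q hq => ?_, ?_, fun i => ?_⟩
  · rw [eval_fill_of_ne (by decide), h30 q hq]
  · rw [eval_fill_of_ne (by decide), h31]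
  · have hi := hv.lt _ (he i)
    have hiN : (i : ℕ) < N := by
      rw [← hcount i]
      exact (Nat.count_le _).trans_lt hi
    rw [eval_fill_row hiN, eval_sum]
    rw [Finset.sum_eq_single (e i)]
    · simp [h2.lay _ hi, he i, h30 _ hi, hcount]
    · intro x hx hne
      have hx := Finset.mem_range.1 hx
      simp only [eval_ite, holds_and, layer, holds_get, eval_var, holds_eq, eval_get,
        Function.update_self, h2.lay x hx, h30 x hx, eval_lit]
      rw [if_neg]
      rintro ⟨h3, h4⟩
      exact hne (Nat.count_injective h3 (he i) (h4.trans (hcount i).symm))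
    · intro hx
      exact absurd (Finset.mem_range.2 hi) hx

/-- The output is the code of the automaton in memory, with the states renamed in increasing
order. -/
theorem eval_out (h : Rep N m R) {M : ℕ} {B : LayeredAutomaton (Fin k) (Fin M)} {e : Fin M → ℕ}
    (hv : R.Valid N d) (hB : PLA.Models B R e) (hMN : M ≤ N) (hd : m 0 0 = B.d) (hk : m 0 1 = k)
    (h30 : ∀ i, m 30 (e i) = i) (h31 : m 31 0 = M) (h32 : ∀ i : Fin M, m 32 i = e i) :
    outLength.eval N m (cell 0 0) = B.code.length ∧
      ∀ j (_ : j < B.code.length), outEntry.eval N m (cell 0 j) = B.code.getD j 0 := by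
  have heN : ∀ i, e i < N := fun i => hv.lt _ (hB.lay_ne i)
  obtain ⟨c0, c1, c2, c3⟩ := B.getD_code_head
  have hlen := B.length_code
  constructor
  · have hmul : (Exp.mul 2 (.get 31 (.lit 0)) (.get 0 (.lit 1))).eval N m (cell 0 0) = M * k :=
      eval_mul (fun _ => h31) (fun _ => hk) h.letters
    simp only [outLength, input, eval_plus, eval_lit, eval_get, hmul, h31, hlen]
    omega
  · intro j hj
    rw [hlen] at hj
    simp only [outEntry, eval_ite, holds_eq, holds_lt, eval_var, eval_lit, cell_one, input,
      eval_get, eval_plus, eval_minus, layer, parent, h31, hd, hk]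
    split_ifs with j0 j1 j2 j3 j4 j5
    · rw [j0, c0]
    · rw [j1, c1]
    · rw [j2, c2]
    · rw [j3, c3, h.init, hB.init, h30]
    · obtain ⟨q, rfl⟩ : ∃ q, j = 4 + q := ⟨j - 4, by omega⟩
      have hq := h32 ⟨q, by omega⟩
      have hc := B.getD_code_layer ⟨q, by omega⟩
      simp only at hq hc
      rw [Nat.add_sub_cancel_left, hq, h.lay _ (heN _), hB.lay, hc]
    · obtain ⟨q, rfl⟩ : ∃ q, j = 4 + M + q := ⟨j - (4 + M), by omega⟩
      have hq := h32 ⟨q, by omega⟩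
      have hc := B.getD_code_parent ⟨q, by omega⟩
      simp only at hq hc
      rw [Nat.add_sub_cancel_left, hq, h.par _ (heN _), hB.par, h30, hc]
    · -- The sum has exactly one nonzero term at most, for the state and the letter of the entry.
      obtain ⟨t, rfl⟩ : ∃ t, j = 4 + M + M + t := ⟨j - (4 + M + M), by omega⟩
      have ht : t < M * k := by omega
      have hk0 : 0 < k := by
        rcases Nat.eq_zero_or_pos k with rfl | h0
        · omega
        · exact h0
      have hq : t / k < M := (Nat.div_lt_iff_lt_mul hk0).2 ht
      have ha : t % k < k := Nat.mod_lt _ hk0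
      have hqa : t / k * k + t % k = t := Nat.div_add_mod' t k
      have hmul : ∀ q a : ℕ, (Exp.mul 4 (.var 2) (.get 0 (.lit 1))).eval N m (Function.update
          (Function.update (cell 0 (4 + M + M + t)) 2 q) 3 a) = q * k := fun q a =>
        eval_mul (fun _ => rfl) (fun _ => hk) h.letters
      have hcond : ∀ q a : ℕ, (a < k ∧ 4 + M + M + t = 4 + M + M + (q * k + a)) →
          q = t / k ∧ a = t % k := by
        rintro q a ⟨h1, h2⟩
        obtain rfl : t = q * k + a := by omega
        rw [Nat.mul_comm, Nat.mul_add_div hk0, Nat.mul_add_mod, Nat.div_eq_of_lt h1,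
          Nat.mod_eq_of_lt h1]
        exact ⟨rfl, rfl⟩
      simp only [eval_sum, eval_ite, holds_and, holds_lt, holds_eq, eval_var, eval_plus, eval_get,
        eval_lit, hmul, h31, hk, Function.update_self, trans, holds_tab, target, eval_minus,
        eval_tab, Function.update_of_ne (show (2 : Fin 8) ≠ 3 by decide),
        Function.update_of_ne (show (1 : Fin 8) ≠ 3 by decide),
        Function.update_of_ne (show (1 : Fin 8) ≠ 2 by decide), cell_one]
      rw [Finset.sum_eq_single (t / k), Finset.sum_eq_single (t % k)]
      · have h1 := h32 ⟨t / k, hq⟩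
        have hc := B.getD_code_step ⟨t / k, hq⟩ ⟨t % k, ha⟩
        simp only at h1 hc
        rw [hqa] at hc
        rw [if_pos ⟨ha, by rw [hqa]⟩, hc, h1, h.st _ (heN _) _ (ha.trans_le h.letters)]
        rcases hs : B.step ⟨t / k, hq⟩ ⟨t % k, ha⟩ with _ | q'
        · have h2 := hB.st ⟨t / k, hq⟩ ⟨t % k, ha⟩
          rw [hs] at h2
          rw [PLA.code_of_none h2]
          simp
        · have h2 := (hB.st_iff _ _ _).2 hs
          rw [PLA.code_of_st h2, Nat.add_sub_cancel, h30]
          simp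
      · exact fun a _ hne => if_neg fun hca => hne (hcond _ _ hca).2
      · exact fun hn => absurd (Finset.mem_range.2 (ha.trans_le h.letters)) hn
      · exact fun q _ hne => Finset.sum_eq_zero fun a _ => if_neg fun hca => hne (hcond _ _ hca).1
      · exact fun hn => absurd (Finset.mem_range.2 (hq.trans_le hMN)) hn

end RAM

/-! ### The minimisation algorithm -/

namespace RAM

open Stm

variable {k N d : ℕ} {m : ℕ → ℕ → ℕ} {R : PLA (Fin k)}

/-- The minimisation procedure, up to the output. -/
def minimiseStm : Stm :=
  .seq loadStm <| .seq trimStm <| .seq langStm <| .seq (.iter roundStm) rankStm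

/-- The procedure leaves the automaton `round^N (langQuot (trim A))` in memory, and the program
built from it outputs each automaton that arises from it by numbering its states in increasing
order. -/
theorem exists_minimise : ∃ (P : Prog) (T : Polynomial ℕ), ∀ {k n M : ℕ}
    (A : LayeredAutomaton (Fin k) (Fin n)) {Λ : ℕ → Set (ℕ → Fin k)}, (PLA.ofLA A).Cert Λ →
    ∀ {B : LayeredAutomaton (Fin k) (Fin M)} {R : PLA (Fin k)} {e : Fin M → ℕ},
      R = (PLA.round A.code.length)^[A.code.length]
        ((PLA.ofLA A).trim.langQuot A.code.length) →
      PLA.Models B R e → B.d = A.d → M ≤ n → R.Valid A.code.length A.d →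
      (open Classical in M = Nat.count (fun q => R.lay q ≠ 0) A.code.length) →
      (open Classical in ∀ i, Nat.count (fun q => R.lay q ≠ 0) (e i) = i) →
      Outputs P A.code B.code (T.eval A.size) := by
  obtain ⟨P, T, h⟩ := exists_outputs minimiseStm outEntry outLength
  refine ⟨P, T.comp (4 + 2 * Polynomial.X + Polynomial.X ^ 2), ?_⟩
  intro k n M A Λ hc B R e hR hB hd hM hv hcard hcount
  obtain ⟨t, s, ht, hrun, hout⟩ := h A.code B.code fun m hm => by
    have hlen := A.length_code
    have hlenB := B.length_code
    have hle : B.code.length ≤ A.code.length := by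
      have := Nat.mul_le_mul_right k hM
      omega
    have hMN : M ≤ A.code.length := by omega
    set N := A.code.length with hN
    have hvA := PLA.valid_ofLA A (show n < N by omega)
    have hvT := hvA.trim
    have hcT := hc.trim hvA
    set m₀ : ℕ → ℕ → ℕ := fun a i => if a = 0 then A.code.getD i 0 else 0 with hm₀
    have h0 : m 0 = m₀ 0 := by
      rw [hm]
      exact eval_of_writes (S := minimiseStm) (a := 0) rfl m₀
    have h1 : Rep N (loadStm.eval N m₀) (PLA.ofLA A) := rep_load A rfl hN
    have h2 := ((h1.eval_trim hvA).eval_lang hvT hcT).eval_iter_round (hvT.langQuot hcT)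
      (hvA.recurrent_trim.langQuot hvT hcT)
    rw [← hR] at h2
    rw [minimiseStm, eval_seq, eval_seq, eval_seq, eval_seq] at hm
    obtain ⟨h30, h31, h32⟩ := eval_rank h2 hv hB.lay_ne hcard hcount
    have h3 : Rep N (rankStm.eval N _) R := h2.eval rfl rfl rfl rfl
    rw [← hm] at h3 h30 h31 h32
    obtain ⟨c0, c1, -, -⟩ := A.getD_code_head
    obtain ⟨h4, h5⟩ := eval_out h3 hv hB hMN ((congrFun h0 0).trans (c0.trans hd.symm))
      ((congrFun h0 1).trans c1) (fun i => (h30 _ (hv.lt _ (hB.lay_ne i))).trans (hcount i)) h31 h32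
    refine ⟨hle, h4, fun j hj => (h5 j hj).trans ?_⟩
    exact List.getD_eq_getElem _ _ hj
  refine ⟨t, s, ht.trans ?_, hrun, hout⟩
  simp only [Polynomial.eval_comp, Polynomial.eval_add, Polynomial.eval_mul, Polynomial.eval_pow,
    Polynomial.eval_X, Polynomial.eval_ofNat]
  exact eval_le_eval_of_le T A.length_code_le

end RAM

theorem mainTheorem2 :
    ∃ (P : RAM.Prog) (time : Polynomial ℕ),
      ∀ (k n : ℕ) (A : LayeredAutomaton (Fin k) (Fin n)), A.Consistent →
        ∃ (m : ℕ) (B : LayeredAutomaton (Fin k) (Fin m)),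
          RAM.Outputs P A.code B.code (time.eval A.size) ∧
          A.Equivalent B ∧ B.Consistent ∧
          B.Normal ∧ B.Centralised ∧ B.SafeMinimal ∧
          (∃ (j : ℕ) (A' : LayeredAutomaton (Fin k) (Fin j)),
            A'.IsSubautomaton A ∧
            ∃ φ : Fin j → Fin m, A'.IsStrongMorphism B φ ∧ Function.Surjective φ) ∧
          m ≤ n ∧ B.numLeaves ≤ A.numLeaves := by
  obtain ⟨P, T, h⟩ := RAM.exists_minimise
  refine ⟨P, T, fun k n A hA => ?_⟩
  have hmA := PLA.models_ofLA A
  obtain ⟨Λ₀, hΛ₀⟩ := hA.exists_cert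
  obtain ⟨Λ, hΛ, -⟩ := hmA.exists_cert hΛ₀
  have hvA := PLA.valid_ofLA (N := A.code.length) A (by rw [A.length_code]; omega)
  have hvT := hvA.trim
  have hcT := hΛ.trim hvA
  have hred := hvT.reduct_langQuot hcT
    ((PLA.SubQuot.refl hvA).sub hvT hvA.subStep_trim) hvA.subStep_trim.init
  obtain ⟨hv, hr, hred, hs⟩ := hred.stable_iterate (hvT.langQuot hcT)
    (hvA.recurrent_trim.langQuot hvT hcT)
  obtain ⟨e, he⟩ := RAM.exists_equiv_count hv
  have hmB := PLA.models_toLA hv e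
  obtain ⟨K, φ, hsub⟩ := hred.subQuot
  have hfin := hsub.exists_subautomaton hvA hv hmB
  exact ⟨_, PLA.toLA hv e, h A hΛ rfl hmB rfl hfin.2.1 hv rfl he,
    hmA.equivalent hmB hΛ hred.cert hred.init.symm, (hmB.cert hred.cert).consistent,
    hmB.normal hv hr hs.collapse, hmB.centralised hv hr hs.delete,
    hmB.safeMinimal hred.cert hred.minimal hs.merge, hfin⟩
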